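/- Let $n\ge 2$, $T>0$, $\varepsilon>0$, $\mathbb T^n=\mathbb R^n/\mathbb Z^n$, $Q_T=\mathbb T^n\times(0,T)$, let $1<p<\infty$ and let $R\in[2,\infty]$, $Q\in(n,\infty]$ satisfy $\frac{n}{2Q}+\frac1R\le\frac12$ (with $1/\infty=0$). For every $M\ge 0$ there is a constant $C$, depending only on $n,T,\varepsilon,p,Q,R,M$, with the following property. Let $H:Q_T\times\mathbb R^n\to\mathbb R$ be measurable in $(x,t)$ for every $p$ and of class $C^1$ in $p$ for a.e. $(x,t)$ (no convexity is assumed). Let $g_1,g_2\in L^p(\mathbb T^n)$ and $f_1,f_2\in L^1(0,T;L^p(\mathbb T^n))$, and for $i=1,2$ let $u_i$ be a weak energy solution of the backward viscous Hamilton–Jacobi equation $$-\partial_t u_i-\varepsilon\Delta u_i+H(x,t,Du_i)=f_i \ \text{ in } Q_T,\qquad u_i(\cdot,T)=g_i \ \text{ a.e. in } \mathbb T^n,$$ that is: $u_i\in C(\overline Q_T)$, $u_i\in L^2(0,T;H^1(\mathbb T^n))$, $\partial_tu_i\in L^2(0,T;H^{-1}(\mathbb T^n))$, $H(\cdot,\cdot,Du_i)\in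 L^1(Q_T)$, and $$\iint_{Q_T}\bigl(u_i\,\partial_t\varphi+\varepsilon\,Du_i\cdot D\varphi+H(x,t,Du_i)\,\varphi\bigr)\,dx\,dt=\iint_{Q_T}f_i\,\varphi\,dx\,dt$$ for all smooth $\varphi$ on $Q_T$ whose support is contained in $\mathbb T^n\times[a,b]$ for some $0<a$, $b<T$. Assume that $D_pH\in L^R(0,T;L^Q(\mathbb T^n))$ along the segment joining the two gradients, with norm at most $M$: $$\bigl\|D_pH\bigl(\cdot,\cdot,\theta Du_1+(1-\theta)Du_2\bigr)\bigr\|_{L^R(0,T;L^Q(\mathbb T^n))}\le M\qquad\text{for all }\theta\in[0,1].$$ Then for all $t\in(0,T)$ $$\|(u_1-u_2)(t)\|_{L^p(\mathbb T^n)}\le C\Bigl(\|g_1-g_2\|_{L^p(\mathbb T^n)}+\int_0^T\|f_1(s)-f_2(s)\|_{L^p(\mathbb T^n)}\,ds\Bigr).$$ -/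

import Mathlib

open MeasureTheory Set
open scoped ENNReal NNReal ContDiff

noncomputable section

namespace ViscousHJ

/-- The flat torus `ℝⁿ / ℤⁿ`; its `volume` is the normalised Lebesgue (Haar) measure. -/
abbrev Torus (n : ℕ) : Type := UnitAddTorus (Fin n)

/-- `ℝⁿ` with the Euclidean norm. -/
abbrev Vec (n : ℕ) : Type := EuclideanSpace ℝ (Fin n)

/-- The quotient map `ℝⁿ → ℝⁿ / ℤⁿ`. -/
def toTorus {n : ℕ} (y : Vec n) : Torus n := fun i => ((y i : ℝ) : UnitAddCircle)

/-- Smooth functions on the torus: those whose periodic lift to `ℝⁿ` is `C^∞`. -/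
def TorusSmooth {n : ℕ} (ψ : Torus n → ℝ) : Prop :=
  ContDiff ℝ ∞ (fun y : Vec n => ψ (toTorus y))

/-- The classical gradient `Dψ` of a function on the torus. -/
def torusGrad {n : ℕ} (ψ : Torus n → ℝ) (x : Torus n) : Vec n :=
  WithLp.toLp 2 (fun i : Fin n =>
    deriv (fun s : ℝ => ψ (x + Pi.single i (s : UnitAddCircle))) 0)

/-- Test functions on `𝕋ⁿ × (0,T)`: smooth, and supported in `𝕋ⁿ × [a,b]` for some
`0 < a`, `b < T`. -/
structure IsTestFunction {n : ℕ} (T : ℝ) (φ : Torus n × ℝ → ℝ) : Prop where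
  smooth : ContDiff ℝ ∞ (fun z : Vec n × ℝ => φ (toTorus z.1, z.2))
  support : ∃ a b : ℝ, 0 < a ∧ b < T ∧ ∀ x t, t ∉ Icc a b → φ (x, t) = 0

/-- The time derivative `∂ₜφ`. -/
def timeDeriv {n : ℕ} (φ : Torus n × ℝ → ℝ) (z : Torus n × ℝ) : ℝ :=
  deriv (fun s : ℝ => φ (z.1, s)) z.2

/-- The spatial gradient `Dφ` of a function of `(x,t)`. -/
def spaceGrad {n : ℕ} (φ : Torus n × ℝ → ℝ) (z : Torus n × ℝ) : Vec n :=
  torusGrad (fun x => φ (x, z.2)) z.1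

/-- Lebesgue measure on `Q_T = 𝕋ⁿ × (0,T)`. -/
def cylMeasure (n : ℕ) (T : ℝ) : Measure (Torus n × ℝ) :=
  (volume : Measure (Torus n)).prod ((volume : Measure ℝ).restrict (Ioo 0 T))

/-- The norm of `L^R(0,T; L^Q(𝕋ⁿ))`, with values in `[0,∞]`. -/
def mixedNorm {n : ℕ} {F : Type*} [NormedAddCommGroup F] (T : ℝ) (R Q : ℝ≥0∞)
    (h : Torus n × ℝ → F) : ℝ≥0∞ :=
  eLpNorm (fun t : ℝ => eLpNorm (fun x : Torus n => h (x, t)) Q volume) R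
    ((volume : Measure ℝ).restrict (Ioo 0 T))

/-- Membership in `L^R(0,T; L^Q(𝕋ⁿ))`. -/
def MemMixed {n : ℕ} {F : Type*} [NormedAddCommGroup F] (T : ℝ) (R Q : ℝ≥0∞)
    (h : Torus n × ℝ → F) : Prop :=
  AEStronglyMeasurable h (cylMeasure n T) ∧ mixedNorm T R Q h < ⊤

/-- `V` is the weak gradient of `v` on the torus. -/
def IsWeakGrad {n : ℕ} (v : Torus n → ℝ) (V : Torus n → Vec n) : Prop :=
  ∀ ψ : Torus n → ℝ, TorusSmooth ψ → ∀ i : Fin n,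
    ∫ x, v x * torusGrad ψ x i = - ∫ x, V x i * ψ x

/-- `u` belongs to the parabolic energy class
`{u ∈ L²(0,T; H¹(𝕋ⁿ)), ∂ₜu ∈ L²(0,T; H⁻¹(𝕋ⁿ))}` and `Du` is its weak spatial gradient.
Elements of `L²(0,T; H⁻¹)` are the distributions `F₀ + div F` with `F₀, F ∈ L²(Q_T)`. -/
structure InEnergyClass {n : ℕ} (T : ℝ) (u : Torus n × ℝ → ℝ) (Du : Torus n × ℝ → Vec n) :
    Prop where
  memLp : MemLp u 2 (cylMeasure n T)
  memLp_grad : MemLp Du 2 (cylMeasure n T)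
  weakGrad : ∀ᵐ t ∂((volume : Measure ℝ).restrict (Ioo 0 T)),
    IsWeakGrad (fun x => u (x, t)) (fun x => Du (x, t))
  timeDeriv_dual : ∃ (F₀ : Torus n × ℝ → ℝ) (F : Torus n × ℝ → Vec n),
    MemLp F₀ 2 (cylMeasure n T) ∧ MemLp F 2 (cylMeasure n T) ∧
    ∀ φ : Torus n × ℝ → ℝ, IsTestFunction T φ →
      - ∫ z, u z * timeDeriv φ z ∂(cylMeasure n T)
        = ∫ z, (F₀ z * φ z - inner ℝ (F z) (spaceGrad φ z)) ∂(cylMeasure n T)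

/-- A Hamiltonian `H(x,t,p)` on `Q_T × ℝⁿ`: measurable in `(x,t)` for every `p`, and of class
`C¹` in `p` for almost every `(x,t)`. -/
structure IsHamiltonian {n : ℕ} (T : ℝ) (H : Torus n × ℝ → Vec n → ℝ) : Prop where
  measurable : ∀ p : Vec n, AEStronglyMeasurable (fun z => H z p) (cylMeasure n T)
  contDiff : ∀ᵐ z ∂(cylMeasure n T), ContDiff ℝ 1 (H z)

/-- `u`, with weak spatial gradient `Du`, is a weak energy solution, continuous on
`𝕋ⁿ × [0,T]`, of
`-∂ₜu - ε Δu + H(x,t,Du) = f` in `𝕋ⁿ × (0,T)`, `u(·,T) = g`. -/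
structure IsEnergySolution {n : ℕ} (T ε : ℝ) (H : Torus n × ℝ → Vec n → ℝ)
    (f : Torus n × ℝ → ℝ) (g : Torus n → ℝ)
    (u : Torus n × ℝ → ℝ) (Du : Torus n × ℝ → Vec n) : Prop where
  continuousOn : ContinuousOn u (univ ×ˢ Icc 0 T)
  energy : InEnergyClass T u Du
  integrable_hamiltonian : Integrable (fun z => H z (Du z)) (cylMeasure n T)
  equation : ∀ φ : Torus n × ℝ → ℝ, IsTestFunction T φ →
    ∫ z, (u z * timeDeriv φ z + ε * inner ℝ (Du z) (spaceGrad φ z) + H z (Du z) * φ z)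
        ∂(cylMeasure n T)
      = ∫ z, f z * φ z ∂(cylMeasure n T)
  terminal : (fun x => u (x, T)) =ᵐ[volume] g

end ViscousHJ

end

open ViscousHJ

open MeasureTheory Set Filter Topology
open scoped ENNReal NNReal ContDiff

noncomputable section

namespace ViscousHJ

variable {n : ℕ}

/-! The difference `w = u₁ - u₂` solves a linear equation `∂ₜw + εΔw = G`, and the fundamental
theorem of calculus along the segment of gradients gives `|G| ≤ (∫₀¹ |D_pH(θDu₁ + (1-θ)Du₂)| dθ)
|Dw| + |f₁ - f₂|`. Only the size of this drift matters, so convexity of `H` plays no role.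

Put `Φ(r) = (r² + σ²)^(p/2)` and `ρ = (w² + σ²)^(p/2-1)`. Testing the equation with `Φ'(w)` gives
`d/dt ∫Φ(w) = ε∫Φ''(w)|Dw|² + ∫Φ'(w)G`, so, read backwards from `T`, diffusion is dissipative. Since
`p > 1`, `Φ''(w)` is at least a positive multiple of `ρ`. As `Φ'² ≤ p²Φρ`, Young's inequality splits
the drift term, with drift `β`, into a part absorbed by `ρ|Dw|²` and a multiple of `∫β²Φ(w) =
∫β²ψ²`, where `ψ = Φ(w)^(1/2)` and `|Dψ|² ≤ (p²/4)ρ|Dw|²`.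

The key estimate (`exists_slice_estimate`) is `∫β²ψ² ≤ δ‖Dψ‖₂² + K(1 + ‖β‖_Q^(2/s))‖ψ‖₂²` with `s =
1 - n/Q > 0`. It follows from Hölder and a Gagliardo–Nirenberg inequality, obtained by iterating the
Gagliardo inequality on powers of a function (`HasGN.step`). The condition `n/(2Q) + 1/R ≤ 1/2` says
precisely that `2/s ≤ R`, so the growth rate `‖β‖_Q^(2/s)` is integrable in time with a bound
depending on `M`. All this is done for each fixed `θ` and then averaged over `θ ∈ [0,1]`, which
requires a jointly measurable version of the drift.

The source contributes `p‖f‖_p (∫Φ)^(1-1/p)`; a Gronwall inequality with this sublinear term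
(`gronwall_rpow`) bounds `(∫Φ(w))^(1/p)` linearly in the data, and `σ → 0` gives the `L^p` norm.

The energy identity (`IsLinearSolution.energy`) must be justified for a distributional equation with
`G` only in `L¹`. Mollification in space commutes with the operator; at each point the mollified
solution is absolutely continuous in time, so the classical chain rule applies. Boundedness of `w`
keeps `Φ'(w)` and `Φ''(w)` bounded, and the mollification is then removed. -/

instance torusProbability : IsProbabilityMeasure (volume : Measure (Torus n)) := by
  constructor
  rw [volume_pi, ← Set.pi_univ univ, Measure.pi_pi]
  simp [AddCircle.measure_univ]

/-! ### Smooth functions on the torus and their partial derivatives -/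

lemma isOpenQuotientMap_toTorus : IsOpenQuotientMap (toTorus : Vec n → Torus n) := by
  have h : IsOpenQuotientMap (fun y : Fin n → ℝ => fun i => ((y i : ℝ) : UnitAddCircle)) :=
    IsOpenQuotientMap.piMap (fun _ => QuotientAddGroup.isOpenQuotientMap_mk)
  exact h.comp (EuclideanSpace.equiv (Fin n) ℝ).toHomeomorph.isOpenQuotientMap

lemma toTorus_surjective (x : Torus n) : ∃ y : Vec n, toTorus y = x :=
  isOpenQuotientMap_toTorus.surjective x

lemma toTorus_add (y z : Vec n) : toTorus (y + z) = toTorus y + toTorus z := by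
  ext i; simp [toTorus]

lemma toTorus_smul_single (i : Fin n) (s : ℝ) :
    toTorus (s • EuclideanSpace.single i (1 : ℝ)) = Pi.single i (s : UnitAddCircle) := by
  ext j
  by_cases h : j = i
  · subst h; simp [toTorus]
  · simp [toTorus, h]

/-- The translation of `x` by `s` along the `i`-th coordinate circle. -/
def shift (i : Fin n) (x : Torus n) (s : ℝ) : Torus n := x + Pi.single i (s : UnitAddCircle)

lemma continuous_shift (i : Fin n) : Continuous (fun q : Torus n × ℝ => shift i q.1 q.2) := by
  unfold shift
  refine continuous_fst.add ?_
  refine (continuous_single i).comp ?_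
  exact (AddCircle.continuous_mk' 1).comp continuous_snd

lemma shift_add (i : Fin n) (x : Torus n) (s t : ℝ) :
    shift i (shift i x s) t = shift i x (s + t) := by
  simp only [shift, add_assoc, ← Pi.single_add, AddCircle.coe_add]

@[simp] lemma shift_zero (i : Fin n) (x : Torus n) : shift i x 0 = x := by simp [shift]

lemma shift_sub (i : Fin n) (x z : Torus n) (s : ℝ) : shift i x s - z = shift i (x - z) s := by
  simp only [shift]; abel

/-- `h'` is the `i`-th partial derivative of `h`. -/
def HasPartial (h : Torus n → ℝ) (i : Fin n) (h' : Torus n → ℝ) : Prop :=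
  ∀ x, HasDerivAt (fun s : ℝ => h (shift i x s)) (h' x) 0

/-- The derivative at parameter `0` is known at every base point, so the group law of translations
moves it to every parameter. -/
lemma HasPartial.hasDerivAt {h h' : Torus n → ℝ} {i : Fin n} (H : HasPartial h i h')
    (x : Torus n) (s : ℝ) : HasDerivAt (fun s : ℝ => h (shift i x s)) (h' (shift i x s)) s := by
  have h1 := H (shift i x s)
  simp only [shift_add] at h1
  have h2 : HasDerivAt (fun r : ℝ => r - s) 1 s := (hasDerivAt_id s).sub_const s
  have h3 := HasDerivAt.comp (h₂ := fun r : ℝ => h (shift i x (s + r))) (h := fun r => r - s)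
    (h₂' := h' (shift i x s)) s (by simpa using h1) h2
  simpa [Function.comp_def] using h3

lemma TorusSmooth.continuous {ψ : Torus n → ℝ} (h : TorusSmooth ψ) : Continuous ψ :=
  isOpenQuotientMap_toTorus.isQuotientMap.continuous_iff.2 (ContDiff.continuous h)

lemma shift_toTorus (i : Fin n) (y : Vec n) (s : ℝ) :
    shift i (toTorus y) s = toTorus (y + s • EuclideanSpace.single i (1 : ℝ)) := by
  rw [toTorus_add, toTorus_smul_single]; rfl

lemma TorusSmooth.hasDerivAt_lift {ψ : Torus n → ℝ} (h : TorusSmooth ψ) (i : Fin n) (y : Vec n) :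
    HasDerivAt (fun s : ℝ => ψ (shift i (toTorus y) s))
      (fderiv ℝ (fun y : Vec n => ψ (toTorus y)) y (EuclideanSpace.single i 1)) 0 := by
  simp only [shift_toTorus]
  have h1 : HasFDerivAt (fun y : Vec n => ψ (toTorus y))
      (fderiv ℝ (fun y : Vec n => ψ (toTorus y)) y) y :=
    ((ContDiff.differentiable h (by simp)) y).hasFDerivAt
  have h2 : HasDerivAt (fun s : ℝ => y + s • EuclideanSpace.single i (1 : ℝ))
      (EuclideanSpace.single i (1 : ℝ)) 0 := by
    simpa using ((hasDerivAt_id (0 : ℝ)).smul_const (EuclideanSpace.single i (1 : ℝ))).const_add y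
  have := HasFDerivAt.comp_hasDerivAt (0 : ℝ) (l := fun y : Vec n => ψ (toTorus y))
    (f := fun s : ℝ => y + s • EuclideanSpace.single i (1 : ℝ)) (by simpa using h1) h2
  simpa [Function.comp_def] using this

lemma TorusSmooth.hasPartial {ψ : Torus n → ℝ} (h : TorusSmooth ψ) (i : Fin n) :
    HasPartial ψ i (fun x => torusGrad ψ x i) := by
  intro x
  obtain ⟨y, rfl⟩ := toTorus_surjective x
  have := h.hasDerivAt_lift i y
  exact this.differentiableAt.hasDerivAt

lemma TorusSmooth.torusGrad {ψ : Torus n → ℝ} (h : TorusSmooth ψ) (i : Fin n) :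
    TorusSmooth (fun x => torusGrad ψ x i) := by
  have : (fun y : Vec n => ViscousHJ.torusGrad ψ (toTorus y) i)
      = fun y => fderiv ℝ (fun y : Vec n => ψ (toTorus y)) y (EuclideanSpace.single i 1) := by
    ext y
    exact (h.hasDerivAt_lift i y).deriv
  unfold TorusSmooth
  rw [this]
  exact (ContDiff.fderiv_right (m := ∞) h (by simp)).clm_apply contDiff_const

lemma TorusSmooth.const_sub {ψ : Torus n → ℝ} (h : TorusSmooth ψ) (y : Torus n) :
    TorusSmooth (fun x => ψ (y - x)) := by
  obtain ⟨z, rfl⟩ := toTorus_surjective y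
  have : (fun x : Vec n => ψ (toTorus z - toTorus x)) = (fun x => ψ (toTorus (z - x))) := by
    ext x
    congr 1
  unfold TorusSmooth
  rw [this]
  exact ContDiff.comp (g := fun y : Vec n => ψ (toTorus y)) h (contDiff_const.sub contDiff_id)

lemma TorusSmooth.torusGrad_const_sub {ψ : Torus n → ℝ} (h : TorusSmooth ψ) (y x : Torus n)
    (i : Fin n) : ViscousHJ.torusGrad (fun x => ψ (y - x)) x i
      = - ViscousHJ.torusGrad ψ (y - x) i := by
  have h1 : HasDerivAt (fun s : ℝ => ψ (shift i (y - x) s))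
    (ViscousHJ.torusGrad ψ (y - x) i) (-0) := by simpa using h.hasPartial i (y - x)
  have h2 := HasDerivAt.comp (0 : ℝ) h1 (hasDerivAt_neg (0 : ℝ))
  have h3 : (fun s : ℝ => ψ (y - shift i x s)) = (fun s : ℝ => ψ (shift i (y - x) s)) ∘ Neg.neg := by
    ext s
    simp only [Function.comp, shift]
    congr 1
    ext j
    simp only [Pi.sub_apply, Pi.add_apply]
    by_cases hj : j = i
    · subst hj; simp; abel
    · simp [hj]
  rw [← h3] at h2
  exact h2.deriv.trans (by simp)

lemma continuous_exists_bound {h : Torus n → ℝ} (hc : Continuous h) : ∃ C, 0 ≤ C ∧ ∀ x, ‖h x‖ ≤ C := by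
  obtain ⟨C, hC⟩ := isCompact_univ.exists_bound_of_continuousOn hc.continuousOn
  exact ⟨max C 0, le_max_right _ _, fun x => (hC x (mem_univ x)).trans (le_max_left _ _)⟩

lemma Continuous.integrable_torus {h : Torus n → ℝ} (hc : Continuous h) :
    Integrable h volume := hc.integrable_of_hasCompactSupport (HasCompactSupport.of_compactSpace h)

/-- By translation invariance `s ↦ ∫ h(x + s eᵢ)` is constant; differentiating under the integral at
`0` gives the claim. This is the integration by parts used below. -/
lemma integral_partial_eq_zero {h h' : Torus n → ℝ} {i : Fin n} (hc : Continuous h)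
    (hc' : Continuous h') (H : HasPartial h i h') : ∫ x, h' x = 0 := by
  obtain ⟨C, hC0, hC⟩ := continuous_exists_bound hc'
  have key := hasDerivAt_integral_of_dominated_loc_of_deriv_le (μ := (volume : Measure (Torus n)))
    (F := fun (s : ℝ) (x : Torus n) => h (shift i x s)) (x₀ := (0 : ℝ)) (s := univ)
    (bound := fun _ => C) (F' := fun s x => h' (shift i x s)) Filter.univ_mem
    (Eventually.of_forall fun s => (hc.comp ((continuous_shift i).comp
      (continuous_id.prodMk continuous_const))).aestronglyMeasurable)
    (by simpa using Continuous.integrable_torus hc)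
    (by simpa using hc'.aestronglyMeasurable)
    (Eventually.of_forall fun x s _ => hC _) (integrable_const C)
    (Eventually.of_forall fun x s _ => H.hasDerivAt x s)
  have h1 : (fun s : ℝ => ∫ x : Torus n, h (shift i x s)) = fun _ => ∫ x, h x := by
    ext s
    exact integral_add_right_eq_self h (Pi.single i (s : UnitAddCircle))
  have h2 := key.2
  rw [h1] at h2
  simpa using h2.unique (hasDerivAt_const (0 : ℝ) (∫ x, h x))

/-! ### Convolution on the torus -/

/-- The convolution of `k` and `f` on the torus. -/
def conv (k f : Torus n → ℝ) (y : Torus n) : ℝ := ∫ x, k (y - x) * f x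

lemma integrable_conv_integrand {k f : Torus n → ℝ} (hk : Continuous k) (hf : Integrable f volume)
    (y : Torus n) : Integrable (fun x => k (y - x) * f x) volume := by
  obtain ⟨C, hC0, hC⟩ := continuous_exists_bound hk
  exact hf.bdd_mul (hk.comp (continuous_const.sub continuous_id)).aestronglyMeasurable
    (Eventually.of_forall fun x => hC _)

lemma continuous_conv {k f : Torus n → ℝ} (hk : Continuous k) (hf : Integrable f volume) :
    Continuous (conv k f) := by
  obtain ⟨C, hC0, hC⟩ := continuous_exists_bound hk
  refine continuous_of_dominated (bound := fun x => C * ‖f x‖)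
    (fun y => (integrable_conv_integrand hk hf y).aestronglyMeasurable)
    (fun y => Eventually.of_forall fun x => ?_) (hf.norm.const_mul C)
    (Eventually.of_forall fun x => ?_)
  · rw [norm_mul]; gcongr; exact hC _
  · exact (hk.comp (continuous_id.sub continuous_const)).mul continuous_const

/-- All derivatives fall on the kernel, so `f` need only be integrable. -/
lemma hasPartial_conv {k k' f : Torus n → ℝ} {i : Fin n} (hk : Continuous k) (hk' : Continuous k')
    (H : HasPartial k i k') (hf : Integrable f volume) :
    HasPartial (conv k f) i (conv k' f) := by
  intro y
  obtain ⟨C, hC0, hC⟩ := continuous_exists_bound hk'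
  have key := hasDerivAt_integral_of_dominated_loc_of_deriv_le (μ := (volume : Measure (Torus n)))
    (F := fun (s : ℝ) (x : Torus n) => k (shift i y s - x) * f x) (x₀ := (0 : ℝ)) (s := univ)
    (bound := fun x => C * ‖f x‖) (F' := fun s x => k' (shift i y s - x) * f x) Filter.univ_mem
    (Eventually.of_forall fun s => (integrable_conv_integrand hk hf _).aestronglyMeasurable)
    (integrable_conv_integrand hk hf _)
    (integrable_conv_integrand hk' hf _).aestronglyMeasurable
    (Eventually.of_forall fun x s _ => by rw [norm_mul]; gcongr; exact hC _)
    (hf.norm.const_mul C)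
    (Eventually.of_forall fun x s _ => by
      simp only [shift_sub]
      exact (H.hasDerivAt (y - x) s).mul_const (f x))
  simpa [conv] using key.2

/-- The weak gradient is tested with `x ↦ k (y - x)`: the sign from the reflection cancels the sign
from integration by parts. -/
lemma conv_partial_of_isWeakGrad {k w : Torus n → ℝ} {V : Torus n → Vec n} (hk : TorusSmooth k)
    (hV : IsWeakGrad w V) (i : Fin n) (y : Torus n) :
    conv (fun x => torusGrad k x i) w y = conv k (fun x => V x i) y := by
  have h := hV _ (hk.const_sub y) i
  simp only [hk.torusGrad_const_sub] at h
  simp only [mul_neg, integral_neg, neg_inj] at h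
  simpa only [conv, mul_comm] using h

lemma HasPartial.comp {h h' : Torus n → ℝ} {i : Fin n} (H : HasPartial h i h') {Φ Φ' : ℝ → ℝ}
    (hΦ : ∀ r, HasDerivAt Φ (Φ' r) r) :
    HasPartial (fun x => Φ (h x)) i (fun x => Φ' (h x) * h' x) := by
  intro x
  have h1 : HasDerivAt Φ (Φ' (h x)) (h (shift i x 0)) := by simpa using hΦ (h x)
  exact HasDerivAt.comp (h₂ := Φ) (0 : ℝ) h1 (H x)

lemma HasPartial.mul {f f' g g' : Torus n → ℝ} {i : Fin n} (hf : HasPartial f i f')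
    (hg : HasPartial g i g') :
    HasPartial (fun x => f x * g x) i (fun x => f' x * g x + f x * g' x) := by
  intro x
  have := (hf x).mul (hg x)
  simp only [shift_zero] at this
  exact this

/-! ### A smooth approximate identity on the torus -/

/-- The function `(1 + cos (2πs)) / 2` on the circle. -/
def circleBump (a : UnitAddCircle) : ℝ := (1 + (fourier 1 a : ℂ).re) / 2

lemma circleBump_coe (s : ℝ) : circleBump (s : UnitAddCircle) = (1 + Real.cos (2 * Real.pi * s)) / 2 := by
  unfold circleBump
  rw [fourier_coe_apply]
  have : (2 * Real.pi * Complex.I * (1 : ℤ) * s / (1 : ℝ) : ℂ) = ((2 * Real.pi * s : ℝ) : ℂ) * Complex.I := by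
    push_cast; ring
  rw [this, Complex.exp_ofReal_mul_I_re]

lemma circleBump_nonneg (a : UnitAddCircle) : 0 ≤ circleBump a := by
  induction a using QuotientAddGroup.induction_on with
  | H s => rw [circleBump_coe]; linarith [Real.neg_one_le_cos (2 * Real.pi * s)]

lemma circleBump_le_one (a : UnitAddCircle) : circleBump a ≤ 1 := by
  induction a using QuotientAddGroup.induction_on with
  | H s => rw [circleBump_coe]; linarith [Real.cos_le_one (2 * Real.pi * s)]

lemma circleBump_lt_one {a : UnitAddCircle} (ha : a ≠ 0) : circleBump a < 1 := by
  refine lt_of_le_of_ne (circleBump_le_one a) fun h => ha ?_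
  induction a using QuotientAddGroup.induction_on with
  | H s =>
    rw [circleBump_coe] at h
    obtain ⟨k, hk⟩ := (Real.cos_eq_one_iff _).1 (show Real.cos (2 * Real.pi * s) = 1 by linarith)
    refine (AddCircle.coe_eq_zero_iff 1).2 ⟨k, ?_⟩
    have : (2 * Real.pi) * (k - s) = 0 := by linarith
    rcases mul_eq_zero.1 this with h | h
    · exact absurd h (by positivity)
    · simp; linarith

lemma circleBump_neg (a : UnitAddCircle) : circleBump (-a) = circleBump a := by
  induction a using QuotientAddGroup.induction_on with
  | H s =>
    have h1 : (-(s : UnitAddCircle)) = ((-s : ℝ) : UnitAddCircle) := rfl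
    have h2 := circleBump_coe (-s)
    rw [mul_neg, Real.cos_neg, ← circleBump_coe] at h2
    exact h2

/-- The product of the functions `circleBump` in all coordinates. -/
def torusBump (x : Torus n) : ℝ := ∏ i, circleBump (x i)

lemma torusSmooth_torusBump_pow (m : ℕ) (c : ℝ) :
    TorusSmooth (fun x : Torus n => torusBump x ^ m * c) := by
  unfold TorusSmooth
  simp only [torusBump, toTorus, circleBump_coe]
  fun_prop

lemma continuous_torusBump : Continuous (torusBump : Torus n → ℝ) := by
  simpa using (torusSmooth_torusBump_pow (n := n) 1 1).continuous

lemma torusBump_nonneg (x : Torus n) : 0 ≤ torusBump x :=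
  Finset.prod_nonneg fun _ _ => circleBump_nonneg _

lemma torusBump_zero : torusBump (0 : Torus n) = 1 := by
  have : circleBump 0 = 1 := by
    have := circleBump_coe 0
    simpa using this
  simp [torusBump, this]

lemma torusBump_lt_one {x : Torus n} (hx : x ≠ 0) : torusBump x < 1 := by
  obtain ⟨i, hi⟩ := Function.ne_iff.1 hx
  unfold torusBump
  rw [← Finset.mul_prod_erase _ _ (Finset.mem_univ i)]
  calc circleBump (x i) * ∏ j ∈ Finset.univ.erase i, circleBump (x j)
      ≤ circleBump (x i) * 1 := by
        gcongr
        · exact circleBump_nonneg _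
        · exact Finset.prod_le_one (fun _ _ => circleBump_nonneg _) (fun _ _ => circleBump_le_one _)
    _ < 1 := by simpa using circleBump_lt_one hi

lemma torusBump_neg (x : Torus n) : torusBump (-x) = torusBump x := by
  simp [torusBump, circleBump_neg]

lemma integral_torusBump_pow_pos (m : ℕ) : 0 < ∫ x : Torus n, torusBump x ^ m := by
  have hc : Continuous fun x : Torus n => torusBump x ^ m := continuous_torusBump.pow m
  exact Continuous.integral_pos_of_hasCompactSupport_nonneg_nonzero (x := 0) hc
    (HasCompactSupport.of_compactSpace _)
    (fun x => pow_nonneg (torusBump_nonneg x) m) (by simp [torusBump_zero])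

/-- A smooth approximate identity on the torus, concentrating at `0` as `m → ∞`. -/
def kernel (m : ℕ) (x : Torus n) : ℝ := torusBump x ^ m * (∫ z : Torus n, torusBump z ^ m)⁻¹

lemma torusSmooth_kernel (m : ℕ) : TorusSmooth (kernel m : Torus n → ℝ) :=
  torusSmooth_torusBump_pow m _

lemma continuous_kernel (m : ℕ) : Continuous (kernel m : Torus n → ℝ) :=
  (torusSmooth_kernel m).continuous

lemma kernel_nonneg (m : ℕ) (x : Torus n) : 0 ≤ kernel m x :=
  mul_nonneg (pow_nonneg (torusBump_nonneg x) m) (inv_nonneg.2 (integral_torusBump_pow_pos m).le)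

lemma kernel_neg (m : ℕ) (x : Torus n) : kernel m (-x) = kernel m x := by
  simp [kernel, torusBump_neg]

lemma kernel_sub_comm (m : ℕ) (x y : Torus n) : kernel m (x - y) = kernel m (y - x) := by
  rw [← kernel_neg, neg_sub]

lemma integral_kernel (m : ℕ) : ∫ x : Torus n, kernel m x = 1 := by
  unfold kernel
  rw [integral_mul_const, mul_inv_cancel₀ (integral_torusBump_pow_pos m).ne']

lemma integral_kernel_sub (m : ℕ) (y : Torus n) : ∫ x : Torus n, kernel m (y - x) = 1 := by
  simp_rw [kernel_sub_comm m y, integral_sub_right_eq_self (kernel m) y, integral_kernel]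

lemma lintegral_kernel_sub (m : ℕ) (y : Torus n) :
    ∫⁻ x : Torus n, ENNReal.ofReal (kernel m (y - x)) = 1 := by
  rw [← ofReal_integral_eq_lintegral_ofReal, integral_kernel_sub, ENNReal.ofReal_one]
  · exact Continuous.integrable_torus ((continuous_kernel m).comp (continuous_const.sub continuous_id))
  · exact Eventually.of_forall fun x => kernel_nonneg m _

lemma conv_kernel_eq (m : ℕ) (g : Torus n → ℝ) (y : Torus n) :
    conv (kernel m) g y = ∫ z, kernel m z * g (y + z) := by
  unfold conv
  rw [← integral_add_right_eq_self _ y]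
  refine integral_congr_ae (Eventually.of_forall fun z => ?_)
  simp only [add_comm z y]
  rw [show y - (y + z) = -z by abel, kernel_neg]

/-- Normalised powers of a function with a unique maximum at `0` concentrate at `0`. Applying this
to the `C(Torus n, ℝ)`-valued map `z ↦ g(· + z)` makes the convergence uniform, since the norm of
that space is the sup norm. -/
lemma tendstoUniformly_conv_kernel {g : Torus n → ℝ} (hg : Continuous g) :
    TendstoUniformly (fun m => conv (kernel m) g) g atTop := by
  let G : C(Torus n × Torus n, ℝ) := ⟨fun q => g (q.2 + q.1), by fun_prop⟩
  let F : C(Torus n, C(Torus n, ℝ)) := G.curry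
  have h := tendsto_setIntegral_pow_smul_of_unique_maximum_of_isCompact_of_continuousOn
    (μ := (volume : Measure (Torus n))) (x₀ := 0) (s := univ) (g := F) isCompact_univ
    (c := torusBump) continuous_torusBump.continuousOn
    (fun y _ hy => by rw [torusBump_zero]; exact torusBump_lt_one hy)
    (fun x _ => torusBump_nonneg x) (by simp [torusBump_zero]) (by simp) F.continuous.continuousOn
  rw [ContinuousMap.tendsto_iff_tendstoUniformly] at h
  have hF : ∀ m : ℕ, Integrable (fun x : Torus n => torusBump x ^ m • F x) volume := fun m =>
    Continuous.integrable_of_hasCompactSupport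
      ((continuous_torusBump.pow m).smul F.continuous) (HasCompactSupport.of_compactSpace _)
  convert h using 2 with m
  · ext y
    rw [conv_kernel_eq, ContinuousMap.smul_apply]
    have := (ContinuousMap.evalCLM ℝ y).integral_comp_comm (hF m)
    simp only [ContinuousMap.evalCLM_apply] at this
    rw [Measure.restrict_univ, ← this, smul_eq_mul, ← integral_const_mul]
    refine integral_congr_ae (Eventually.of_forall fun z => ?_)
    simp [kernel, F, G]
    ring
  · ext y; simp [F, G]

lemma enorm_conv_kernel_le (m : ℕ) (f : Torus n → ℝ) (y : Torus n) :
    ‖conv (kernel m) f y‖ₑ ≤ ∫⁻ x, ENNReal.ofReal (kernel m (y - x)) * ‖f x‖ₑ := by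
  refine (enorm_integral_le_lintegral_enorm _).trans (le_of_eq ?_)
  refine lintegral_congr fun x => ?_
  rw [enorm_mul, Real.enorm_eq_ofReal (kernel_nonneg m _)]

/-- Jensen's inequality for the probability density `kernel m (y - ·)`, obtained from Hölder with
weights `1 - 1/q` and `1/q`. -/
lemma enorm_conv_kernel_rpow_le (m : ℕ) {f : Torus n → ℝ} (hf : AEStronglyMeasurable f volume)
    {q : ℝ} (hq : 1 ≤ q) (y : Torus n) :
    ‖conv (kernel m) f y‖ₑ ^ q ≤ ∫⁻ x, ENNReal.ofReal (kernel m (y - x)) * ‖f x‖ₑ ^ q := by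
  have hq0 : 0 < q := by linarith
  have hk : AEMeasurable (fun x : Torus n => ENNReal.ofReal (kernel m (y - x))) volume :=
    (ENNReal.continuous_ofReal.comp ((continuous_kernel m).comp
      (continuous_const.sub continuous_id))).measurable.aemeasurable
  have h := ENNReal.lintegral_mul_norm_pow_le hk (hk.mul (hf.enorm.pow_const q))
    (p := 1 - 1 / q) (q := 1 / q) (by rw [sub_nonneg, div_le_one hq0]; exact hq) (by positivity)
    (by ring)
  rw [lintegral_kernel_sub, ENNReal.one_rpow, one_mul] at h
  have h2 : ‖conv (kernel m) f y‖ₑ ≤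
      (∫⁻ x, ENNReal.ofReal (kernel m (y - x)) * ‖f x‖ₑ ^ q) ^ (1 / q) := by
    refine (enorm_conv_kernel_le m f y).trans (le_trans (le_of_eq ?_) h)
    refine lintegral_congr fun x => ?_
    simp only [Pi.mul_apply]
    rw [ENNReal.mul_rpow_of_nonneg _ _ (by positivity : (0 : ℝ) ≤ 1 / q), ← mul_assoc,
      ← ENNReal.rpow_add_of_nonneg, ← ENNReal.rpow_mul]
    · simp [hq0.ne']
    · rw [sub_nonneg, div_le_one hq0]; exact hq
    · positivity
  calc _ ≤ ((∫⁻ x, ENNReal.ofReal (kernel m (y - x)) * ‖f x‖ₑ ^ q) ^ (1 / q)) ^ q := by gcongr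
    _ = _ := by rw [← ENNReal.rpow_mul]; simp [hq0.ne']

/-- Integrating the pointwise Jensen bound in `y` and exchanging integrals: by symmetry the kernel
has mass one in either variable. -/
lemma lintegral_conv_kernel_rpow_le (m : ℕ) {f : Torus n → ℝ} (hf : AEStronglyMeasurable f volume)
    {q : ℝ} (hq : 1 ≤ q) :
    ∫⁻ y, ‖conv (kernel m) f y‖ₑ ^ q ≤ ∫⁻ x, ‖f x‖ₑ ^ q := by
  calc ∫⁻ y, ‖conv (kernel m) f y‖ₑ ^ q
      ≤ ∫⁻ y, ∫⁻ x, ENNReal.ofReal (kernel m (y - x)) * ‖f x‖ₑ ^ q := by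
        gcongr with y; exact enorm_conv_kernel_rpow_le m hf hq y
    _ = ∫⁻ x, ∫⁻ y, ENNReal.ofReal (kernel m (y - x)) * ‖f x‖ₑ ^ q := by
        rw [lintegral_lintegral_swap]
        refine AEMeasurable.mul ?_ ((hf.comp_snd).enorm.pow_const q)
        exact (ENNReal.continuous_ofReal.comp ((continuous_kernel m).comp
          (continuous_fst.sub continuous_snd))).measurable.aemeasurable
    _ = ∫⁻ x, ‖f x‖ₑ ^ q := by
        refine lintegral_congr fun x => ?_
        rw [lintegral_mul_const]
        · simp_rw [kernel_sub_comm m _ x, lintegral_kernel_sub, one_mul]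
        · exact (ENNReal.continuous_ofReal.comp ((continuous_kernel m).comp
            (continuous_id.sub continuous_const))).measurable

lemma eLpNorm_conv_kernel_le (m : ℕ) {f : Torus n → ℝ} (hf : AEStronglyMeasurable f volume)
    {q : ℝ≥0∞} (hq : 1 ≤ q) (hq' : q ≠ ⊤) :
    eLpNorm (conv (kernel m) f) q volume ≤ eLpNorm f q volume := by
  have h1 : 1 ≤ q.toReal := by
    rw [← ENNReal.toReal_one]; exact ENNReal.toReal_mono hq' hq
  rw [eLpNorm_eq_lintegral_rpow_enorm_toReal (by positivity) hq',
    eLpNorm_eq_lintegral_rpow_enorm_toReal (by positivity) hq']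
  exact ENNReal.rpow_le_rpow (lintegral_conv_kernel_rpow_le m hf h1) (by positivity)

lemma conv_sub {k f g : Torus n → ℝ} (hk : Continuous k) (hf : Integrable f volume)
    (hg : Integrable g volume) (y : Torus n) :
    conv k (fun x => f x - g x) y = conv k f y - conv k g y := by
  unfold conv
  rw [← integral_sub (integrable_conv_integrand hk hf y) (integrable_conv_integrand hk hg y)]
  simp_rw [mul_sub]

/-- Three-`η` argument: density of continuous functions, the contraction property of mollification,
and uniform convergence for the continuous approximant. -/
lemma tendsto_eLpNorm_conv_kernel {f : Torus n → ℝ} {q : ℝ≥0∞} (hq : 1 ≤ q) (hq' : q ≠ ⊤)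
    (hf : MemLp f q volume) :
    Tendsto (fun m => eLpNorm (fun y => conv (kernel m) f y - f y) q volume) atTop (𝓝 0) := by
  rw [ENNReal.tendsto_nhds_zero]
  intro η hη
  by_cases hηt : η = ⊤
  · simp [hηt]
  have hη3 : η / 3 ≠ 0 := by simp [hη.ne']
  obtain ⟨g, -, hg, hgc, hgm⟩ := hf.exists_hasCompactSupport_eLpNorm_sub_le hq' hη3
  have hη' : 0 < (η / 3).toReal := ENNReal.toReal_pos hη3 (ENNReal.div_ne_top hηt (by simp))
  have hfi : Integrable f volume := hf.integrable hq
  have hgi : Integrable g volume := Continuous.integrable_torus hgc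
  filter_upwards [Metric.tendstoUniformly_iff.1 (tendstoUniformly_conv_kernel hgc) _ hη'] with m hm
  have e : (fun y => conv (kernel m) f y - f y) = (conv (kernel m) (fun x => f x - g x)
      + fun y => conv (kernel m) g y - g y) + fun y => g y - f y := by
    ext y
    simp only [Pi.add_apply, conv_sub (continuous_kernel m) hfi hgi]
    ring
  have m1 := (continuous_conv (continuous_kernel m) (hfi.sub hgi)).aestronglyMeasurable
    (μ := (volume : Measure (Torus n)))
  have m2 : AEStronglyMeasurable (fun y => conv (kernel m) g y - g y) (volume : Measure (Torus n)) :=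
    ((continuous_conv (continuous_kernel m) hgi).sub hgc).aestronglyMeasurable
  have h1 : eLpNorm (conv (kernel m) (fun x => f x - g x)) q volume ≤ η / 3 :=
    (eLpNorm_conv_kernel_le m (hfi.sub hgi).aestronglyMeasurable hq hq').trans hg
  have h2 : eLpNorm (fun y => conv (kernel m) g y - g y) q volume ≤ η / 3 := by
    refine (eLpNorm_le_of_ae_bound (C := (η / 3).toReal) (Eventually.of_forall fun y => ?_)).trans ?_
    · have := hm y
      rw [dist_comm, Real.dist_eq] at this
      exact this.le
    · simp only [measure_univ, ENNReal.one_rpow, one_mul]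
      exact ENNReal.ofReal_toReal_le
  have h3 : eLpNorm (fun y => g y - f y) q volume ≤ η / 3 := by
    rw [← eLpNorm_neg]
    refine le_trans (le_of_eq ?_) hg
    congr 1
    ext y; simp
  rw [e]
  calc _ ≤ eLpNorm (conv (kernel m) (fun x => f x - g x)) q volume
        + eLpNorm (fun y => conv (kernel m) g y - g y) q volume
        + eLpNorm (fun y => g y - f y) q volume :=
      (eLpNorm_add_le (m1.add m2) (hgc.aestronglyMeasurable.sub hf.1) hq).trans
        (add_le_add_left (eLpNorm_add_le m1 m2 hq) _)
    _ ≤ η / 3 + η / 3 + η / 3 := by gcongr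
    _ = η := ENNReal.add_thirds η

/-! ### Absolutely continuous functions of one variable -/

/-- An absolutely continuous `U` has bounded range on the interval, and a `C¹` function is Lipschitz
on that range. -/
lemma absolutelyContinuousOnInterval_comp {U Φ Φ' : ℝ → ℝ} {a b : ℝ}
    (hU : AbsolutelyContinuousOnInterval U a b) (hΦ : ∀ r, HasDerivAt Φ (Φ' r) r)
    (hΦ' : Continuous Φ') : AbsolutelyContinuousOnInterval (fun t => Φ (U t)) a b := by
  obtain ⟨B, hB⟩ := hU.exists_bound
  obtain ⟨K, hK⟩ := (isCompact_Icc (a := -B) (b := B)).exists_bound_of_continuousOn hΦ'.continuousOn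
  -- The constant `max K 1` rather than `K` is strictly positive, so that `ε / max K 1` is an
  -- admissible tolerance.
  have hlip : ∀ x ∈ Icc (-B) B, ∀ y ∈ Icc (-B) B, ‖Φ y - Φ x‖ ≤ (max K 1) * ‖y - x‖ :=
    fun x hx y hy => (convex_Icc (-B) B).norm_image_sub_le_of_norm_hasDerivWithin_le
      (fun z _ => (hΦ z).hasDerivWithinAt) (fun z hz => (hK z hz).trans (le_max_left _ _)) hx hy
  have hK1 : 0 < max K 1 := lt_of_lt_of_le one_pos (le_max_right _ _)
  rw [absolutelyContinuousOnInterval_iff] at hU ⊢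
  intro ε hε
  obtain ⟨δ, hδ, h⟩ := hU (ε / max K 1) (by positivity)
  refine ⟨δ, hδ, fun E hE hlen => ?_⟩
  have h1 := h E hE hlen
  rw [lt_div_iff₀ hK1] at h1
  refine lt_of_le_of_lt ?_ h1
  rw [Finset.sum_mul]
  refine Finset.sum_le_sum fun i hi => ?_
  have hm : ∀ x ∈ uIcc a b, U x ∈ Icc (-B) B := fun x hx => abs_le.1 (hB x hx)
  have hE' := (hE.1 i hi)
  rw [Real.dist_eq, Real.dist_eq, mul_comm]
  exact hlip _ (hm _ hE'.2) _ (hm _ hE'.1)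

/-- `W` is the primitive of an integrable function, so `Φ ∘ W` is absolutely continuous and is the
integral of its a.e. derivative. -/
lemma integral_chain_rule {W A Φ Φ' : ℝ → ℝ} {a b : ℝ} (hab : a ≤ b)
    (hA : IntervalIntegrable A volume a b) (hW : ∀ t ∈ Icc a b, W t - W a = ∫ τ in a..t, A τ)
    (hΦ : ∀ r, HasDerivAt Φ (Φ' r) r) (hΦ' : Continuous Φ') :
    Φ (W b) - Φ (W a) = ∫ τ in a..b, Φ' (W τ) * A τ := by
  -- `W` is controlled only on `[a,b]`; the primitive `U` agrees with it there and can be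
  -- differentiated in the ordinary two-sided sense.
  let U : ℝ → ℝ := fun t => W a + ∫ τ in a..t, A τ
  have hUW : ∀ t ∈ Icc a b, U t = W t := fun t ht => by
    have := hW t ht; simp only [U]; linarith
  have hUac : AbsolutelyContinuousOnInterval U a b :=
    (contDiffOn_const (c := W a)).absolutelyContinuousOnInterval.add
      (hA.absolutelyContinuousOnInterval_intervalIntegral left_mem_uIcc)
  have h := (absolutelyContinuousOnInterval_comp hUac hΦ hΦ').integral_deriv_eq_sub
  rw [hUW b ⟨hab, le_rfl⟩, hUW a ⟨le_rfl, hab⟩] at h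
  rw [← h]
  refine intervalIntegral.integral_congr_ae ?_
  filter_upwards [hA.ae_hasDerivAt_integral] with t ht hta
  have ht' : t ∈ uIcc a b := uIoc_subset_uIcc hta
  have h1 : HasDerivAt U (A t) t := (ht ht' a left_mem_uIcc).const_add (W a)
  have h2 := HasDerivAt.comp (h₂ := Φ) t (hΦ (U t)) h1
  rw [uIcc_of_le hab] at ht'
  rw [← hUW t ht']
  exact h2.deriv

/-! ### Steep smooth steps in time, and functions with an integrable weak derivative -/

lemma contDiff_smoothTransition : ContDiff ℝ ∞ Real.smoothTransition :=
  Real.smoothTransition.contDiff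

lemma hasDerivAt_smoothTransition (x : ℝ) :
    HasDerivAt Real.smoothTransition (deriv Real.smoothTransition x) x :=
  (contDiff_smoothTransition.differentiable (by simp) x).hasDerivAt

lemma continuous_deriv_smoothTransition : Continuous (deriv Real.smoothTransition) :=
  contDiff_smoothTransition.continuous_deriv (by simp)

lemma deriv_smoothTransition_eq_zero {x : ℝ} (hx : x ∉ Icc (0 : ℝ) 1) :
    deriv Real.smoothTransition x = 0 := by
  by_cases h : x < 0
  · have : Real.smoothTransition =ᶠ[𝓝 x] fun _ => 0 := by
      filter_upwards [Iio_mem_nhds h] with y hy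
      exact Real.smoothTransition.zero_of_nonpos (le_of_lt hy)
    simpa using this.deriv_eq
  · have h1 : 1 < x := by
      by_contra h1; exact hx ⟨not_lt.1 h, not_lt.1 h1⟩
    have : Real.smoothTransition =ᶠ[𝓝 x] fun _ => 1 := by
      filter_upwards [Ioi_mem_nhds h1] with y hy
      exact Real.smoothTransition.one_of_one_le (le_of_lt hy)
    simpa using this.deriv_eq

lemma integrable_deriv_smoothTransition : Integrable (deriv Real.smoothTransition) volume :=
  continuous_deriv_smoothTransition.integrable_of_hasCompactSupport
    (HasCompactSupport.intro isCompact_Icc fun _ hx => deriv_smoothTransition_eq_zero hx)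

lemma integral_deriv_smoothTransition : ∫ x, deriv Real.smoothTransition x = 1 := by
  have h := integral_of_hasDerivAt_of_tendsto (f := Real.smoothTransition) (m := 0) (n := 1)
    (fun x => hasDerivAt_smoothTransition x) integrable_deriv_smoothTransition
    (tendsto_const_nhds.congr' ?_) (tendsto_const_nhds.congr' ?_)
  · simpa using h
  · filter_upwards [eventually_le_atBot (0 : ℝ)] with y hy
    exact (Real.smoothTransition.zero_of_nonpos hy).symm
  · filter_upwards [eventually_ge_atTop (1 : ℝ)] with y hy
    exact (Real.smoothTransition.one_of_one_le hy).symm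

/-- The derivative of a step steepened by `k + 1` is an approximate identity at `s`: rescale by `σ =
(k + 1)(τ - s)` and use dominated convergence. -/
lemma tendsto_integral_mul_deriv_smoothTransition {m : ℝ → ℝ} (hm : Continuous m) {C : ℝ}
    (hC : ∀ t, ‖m t‖ ≤ C) (s : ℝ) :
    Tendsto (fun k : ℕ => ∫ τ, m τ * ((k + 1 : ℝ) *
      deriv Real.smoothTransition ((k + 1 : ℝ) * (τ - s)))) atTop (𝓝 (m s)) := by
  have e : ∀ k : ℕ, ∫ τ, m τ * ((k + 1 : ℝ) * deriv Real.smoothTransition ((k + 1 : ℝ) * (τ - s)))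
      = ∫ σ, m (s + σ * (k + 1 : ℝ)⁻¹) * deriv Real.smoothTransition σ := by
    intro k
    have hk : (0 : ℝ) < k + 1 := by positivity
    rw [← integral_add_right_eq_self _ s]
    have h := Measure.integral_comp_mul_left (fun σ => (k + 1 : ℝ) *
      (m (s + σ * (k + 1 : ℝ)⁻¹) * deriv Real.smoothTransition σ)) (k + 1 : ℝ)
    rw [integral_const_mul _ (fun σ => m (s + σ * (k + 1 : ℝ)⁻¹) * _),
      abs_of_pos (inv_pos.2 hk), smul_eq_mul, inv_mul_cancel_left₀ hk.ne'] at h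
    rw [← h]
    refine integral_congr_ae (Eventually.of_forall fun τ => ?_)
    have h2 : (k + 1 : ℝ) * τ * (k + 1 : ℝ)⁻¹ = τ := by field_simp
    simp only [add_sub_cancel_right, h2, add_comm s τ]
    ring
  simp_rw [e]
  have hlim : ∫ σ, m s * deriv Real.smoothTransition σ = m s := by
    rw [integral_const_mul, integral_deriv_smoothTransition, mul_one]
  conv => rhs; rw [← hlim]
  refine tendsto_integral_of_dominated_convergence
    (fun σ => C * ‖deriv Real.smoothTransition σ‖) (fun k => ?_)
    (integrable_deriv_smoothTransition.norm.const_mul C) (fun k => Eventually.of_forall fun σ => ?_)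
    (Eventually.of_forall fun σ => ?_)
  · exact ((hm.comp (by fun_prop)).mul continuous_deriv_smoothTransition).aestronglyMeasurable
  · rw [norm_mul]; gcongr; exact hC _
  · refine Tendsto.mul_const _ ((hm.tendsto s).comp ?_)
    have h1 : Tendsto (fun k : ℕ => (k + 1 : ℝ)⁻¹) atTop (𝓝 0) := by
      simpa using tendsto_one_div_add_atTop_nhds_zero_nat (𝕜 := ℝ)
    simpa using (h1.const_mul σ).const_add s

lemma tendsto_smoothTransition_indicator (s τ : ℝ) :
    Tendsto (fun k : ℕ => Real.smoothTransition ((k + 1 : ℝ) * (τ - s))) atTop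
      (𝓝 (if s < τ then 1 else 0)) := by
  refine tendsto_const_nhds.congr' ?_
  split_ifs with h
  · obtain ⟨N, hN⟩ := exists_nat_gt (τ - s)⁻¹
    filter_upwards [eventually_ge_atTop N] with k hk
    refine (Real.smoothTransition.one_of_one_le ?_).symm
    have h1 : 0 < τ - s := sub_pos.2 h
    rw [inv_lt_iff_one_lt_mul₀ h1] at hN
    have : (N : ℝ) ≤ k := by exact_mod_cast hk
    nlinarith
  · refine Eventually.of_forall fun k => (Real.smoothTransition.zero_of_nonpos ?_).symm
    exact mul_nonpos_of_nonneg_of_nonpos (by positivity) (by linarith)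

/-- The test functions are differences of two steep steps, at `s` and at `t`. They tend to the
indicator of `(s,t]`, while their derivatives tend to `δ_s - δ_t`; the limit of the weak identity is
`m s - m t + ∫ A = 0`. -/
lemma sub_eq_integral_of_weak_deriv {m A : ℝ → ℝ} {T : ℝ} (hm : ContinuousOn m (Icc 0 T))
    (hA : IntegrableOn A (Ioo 0 T) volume)
    (h : ∀ η : ℝ → ℝ, ContDiff ℝ ∞ η → (∃ a b, 0 < a ∧ b < T ∧ ∀ t ∉ Icc a b, η t = 0) →
      ∫ t in Ioo 0 T, (m t * deriv η t + A t * η t) = 0)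
    {s t : ℝ} (hs : 0 < s) (hst : s ≤ t) (ht : t < T) : m t - m s = ∫ τ in s..t, A τ := by
  have hT : (0 : ℝ) ≤ T := by linarith
  -- A continuous bounded extension to the line, so that the convergence to `δ_s` and `δ_t` can be
  -- used without boundary terms.
  let M : ℝ → ℝ := IccExtend hT ((Icc 0 T).domRestrict m)
  have hM : Continuous M := (continuousOn_iff_continuous_domRestrict.1 hm).Icc_extend'
  have hMm : ∀ τ ∈ Icc 0 T, M τ = m τ := fun τ hτ => IccExtend_of_mem hT _ hτ
  obtain ⟨C, hC⟩ := isCompact_Icc.exists_bound_of_continuousOn hm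
  have hMC : ∀ τ, ‖M τ‖ ≤ C := fun τ => hC _ (projIcc 0 T hT τ).2
  let S := Real.smoothTransition
  let η : ℕ → ℝ → ℝ := fun k τ => S ((k + 1 : ℝ) * (τ - s)) - S ((k + 1 : ℝ) * (τ - t))
  let d : ℕ → ℝ → ℝ → ℝ := fun k r τ => (k + 1 : ℝ) * deriv S ((k + 1 : ℝ) * (τ - r))
  have hd : ∀ (k : ℕ) (r τ : ℝ), HasDerivAt (fun τ => S ((k + 1 : ℝ) * (τ - r))) (d k r τ) τ := by
    intro k r τ
    have h1 : HasDerivAt (fun τ : ℝ => (k + 1 : ℝ) * (τ - r)) (k + 1 : ℝ) τ := by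
      simpa using ((hasDerivAt_id τ).sub_const r).const_mul (k + 1 : ℝ)
    have := HasDerivAt.comp (h₂ := S) τ (hasDerivAt_smoothTransition _) h1
    simpa [d, mul_comm, Function.comp_def] using this
  have hdz : ∀ (k : ℕ) (r τ : ℝ), τ ∉ Icc r (r + (k + 1 : ℝ)⁻¹) → d k r τ = 0 := by
    intro k r τ hτ
    have hk : (0 : ℝ) < k + 1 := by positivity
    simp only [d, S]
    rw [deriv_smoothTransition_eq_zero, mul_zero]
    rintro ⟨h1, h2⟩
    refine hτ ⟨?_, ?_⟩
    · nlinarith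
    · have : τ - r ≤ (k + 1 : ℝ)⁻¹ := by
        rw [← one_div, le_div_iff₀ hk]; linarith
      linarith
  have hdc : ∀ k r, Continuous (d k r) := fun k r =>
    continuous_const.mul (continuous_deriv_smoothTransition.comp (by fun_prop))
  -- The ramp starting at `t` has length `(k + 1)⁻¹`; for `k ≥ N` it ends before `T`, so the test
  -- function is admissible.
  obtain ⟨N, hN⟩ := exists_nat_gt (T - t)⁻¹
  have hNk : ∀ k ≥ N, t + (k + 1 : ℝ)⁻¹ < T := by
    intro k hk
    have h1 : (N : ℝ) ≤ k := by exact_mod_cast hk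
    have h2 : (k + 1 : ℝ)⁻¹ < T - t := inv_lt_of_inv_lt₀ (by linarith) (by linarith)
    linarith
  have hηz : ∀ k : ℕ, ∀ τ ∉ Icc s (t + (k + 1 : ℝ)⁻¹), η k τ = 0 := by
    intro k τ hτ
    have hk : (0 : ℝ) < k + 1 := by positivity
    simp only [η, S]
    by_cases h1 : τ < s
    · rw [Real.smoothTransition.zero_of_nonpos, Real.smoothTransition.zero_of_nonpos, sub_zero]
      · exact mul_nonpos_of_nonneg_of_nonpos hk.le (by linarith)
      · exact mul_nonpos_of_nonneg_of_nonpos hk.le (by linarith)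
    · have h2 : (k + 1 : ℝ)⁻¹ < τ - t := by
        by_contra h2; exact hτ ⟨not_lt.1 h1, by linarith⟩
      have h3 : 1 < (k + 1 : ℝ) * (τ - t) := by rwa [inv_lt_iff_one_lt_mul₀' hk] at h2
      rw [Real.smoothTransition.one_of_one_le, Real.smoothTransition.one_of_one_le, sub_self]
      · exact h3.le
      · nlinarith
  have hηd : ∀ k τ, deriv (η k) τ = d k s τ - d k t τ := fun k τ =>
    ((hd k s τ).sub (hd k t τ)).deriv
  have hηs : ∀ k, ContDiff ℝ ∞ (η k) := fun k =>
    (contDiff_smoothTransition.comp (by fun_prop)).sub (contDiff_smoothTransition.comp (by fun_prop))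
  have hη1 : ∀ k τ, ‖η k τ‖ ≤ 1 := by
    intro k τ
    rw [Real.norm_eq_abs, abs_le]
    have a1 := Real.smoothTransition.nonneg ((k + 1 : ℝ) * (τ - s))
    have a2 := Real.smoothTransition.le_one ((k + 1 : ℝ) * (τ - s))
    have a3 := Real.smoothTransition.nonneg ((k + 1 : ℝ) * (τ - t))
    have a4 := Real.smoothTransition.le_one ((k + 1 : ℝ) * (τ - t))
    constructor <;> simp only [η, S] <;> linarith
  have hL1 : Tendsto (fun k : ℕ => ∫ τ in Ioo 0 T, m τ * deriv (η k) τ) atTop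
      (𝓝 (M s - M t)) := by
    refine ((tendsto_integral_mul_deriv_smoothTransition hM hMC s).sub
      (tendsto_integral_mul_deriv_smoothTransition hM hMC t)).congr' ?_
    filter_upwards [eventually_ge_atTop N] with k hk
    have hint : ∀ r, Integrable (fun τ => M τ * d k r τ) volume := fun r =>
      (hM.mul (hdc k r)).integrable_of_hasCompactSupport
        (HasCompactSupport.intro isCompact_Icc fun τ hτ => by rw [Pi.mul_apply, hdz k r τ hτ, mul_zero])
    have hz : ∀ τ ∉ Ioo 0 T, M τ * d k s τ - M τ * d k t τ = 0 := by
      intro τ hτ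
      have hk2 := hNk k hk
      have hk3 : (0 : ℝ) < (k + 1 : ℝ)⁻¹ := by positivity
      rw [hdz k s τ, hdz k t τ]
      · simp
      · rintro ⟨h1, h2⟩; exact hτ ⟨by linarith, by linarith⟩
      · rintro ⟨h1, h2⟩; exact hτ ⟨by linarith, by linarith⟩
    rw [← integral_sub (hint s) (hint t), ← setIntegral_eq_integral_of_forall_compl_eq_zero hz]
    refine setIntegral_congr_fun measurableSet_Ioo fun τ hτ => ?_
    simp only [hηd, hMm τ (Ioo_subset_Icc_self hτ)]
    ring
  have hL2 : Tendsto (fun k : ℕ => ∫ τ in Ioo 0 T, A τ * η k τ) atTop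
      (𝓝 (∫ τ in Ioo 0 T, A τ * ((Ioc s t).indicator (fun _ => 1) τ))) := by
    refine tendsto_integral_of_dominated_convergence (fun τ => ‖A τ‖)
      (fun k => hA.aestronglyMeasurable.mul (hηs k).continuous.aestronglyMeasurable)
      hA.norm (fun k => Eventually.of_forall fun τ => ?_) (Eventually.of_forall fun τ => ?_)
    · rw [norm_mul]
      exact mul_le_of_le_one_right (norm_nonneg _) (hη1 k τ)
    · have := ((tendsto_smoothTransition_indicator s τ).sub
        (tendsto_smoothTransition_indicator t τ)).const_mul (A τ)
      convert this using 3
      by_cases h1 : s < τ <;> by_cases h2 : t < τ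
      · simp [h1, h2]
      · simp [h1, h2, not_lt.1 h2]
      · exact absurd (lt_of_le_of_lt hst h2) h1
      · simp [h1, h2]
  have hL3 : ∫ τ in Ioo 0 T, A τ * ((Ioc s t).indicator (fun _ => 1) τ) = ∫ τ in s..t, A τ := by
    rw [intervalIntegral.integral_of_le hst]
    have : (fun τ => A τ * ((Ioc s t).indicator (fun _ => (1 : ℝ)) τ)) = (Ioc s t).indicator A := by
      ext τ; by_cases hτ : τ ∈ Ioc s t <;> simp [hτ]
    rw [this, setIntegral_indicator measurableSet_Ioc, inter_eq_self_of_subset_right]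
    exact fun τ hτ => ⟨by linarith [hτ.1], by linarith [hτ.2]⟩
  have h0 : ∀ᶠ k in atTop, (∫ τ in Ioo 0 T, m τ * deriv (η k) τ)
      + ∫ τ in Ioo 0 T, A τ * η k τ = 0 := by
    filter_upwards [eventually_ge_atTop N] with k hk
    refine (integral_add ?_ ?_).symm.trans
      (h (η k) (hηs k) ⟨s, t + (k + 1 : ℝ)⁻¹, hs, hNk k hk, hηz k⟩)
    · have hc : ContinuousOn (fun τ => m τ * deriv (η k) τ) (Icc 0 T) :=
        hm.mul ((hηs k).continuous_deriv (by simp)).continuousOn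
      exact hc.integrableOn_Icc.mono_set Ioo_subset_Icc_self
    · exact hA.mul_bdd (hηs k).continuous.aestronglyMeasurable (Eventually.of_forall (hη1 k))
  have hL := tendsto_nhds_unique ((hL1.add hL2).congr' h0) tendsto_const_nhds
  rw [hL3, hMm s ⟨hs.le, by linarith⟩, hMm t ⟨by linarith, ht.le⟩] at hL
  linarith

/-! ### The linear equation satisfied by the difference of two solutions -/

/-- `w`, with weak gradient `V`, is a bounded continuous weak solution of `∂ₜw + εΔw = G`. -/
structure IsLinearSolution (T ε : ℝ) (w : Torus n × ℝ → ℝ) (V : Torus n × ℝ → Vec n)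
    (G : Torus n × ℝ → ℝ) : Prop where
  continuous : Continuous w
  bounded : ∃ C, ∀ z, ‖w z‖ ≤ C
  stronglyMeasurable_grad : StronglyMeasurable V
  memLp_grad : MemLp V 2 (cylMeasure n T)
  weakGrad : ∀ᵐ t ∂((volume : Measure ℝ).restrict (Ioo 0 T)),
    IsWeakGrad (fun x => w (x, t)) (fun x => V (x, t))
  stronglyMeasurable_source : StronglyMeasurable G
  integrable_source : Integrable G (cylMeasure n T)
  equation : ∀ (ψ : Torus n → ℝ) (η : ℝ → ℝ), TorusSmooth ψ → ContDiff ℝ ∞ η →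
    (∃ a b, 0 < a ∧ b < T ∧ ∀ t ∉ Icc a b, η t = 0) →
    ∫ z, (w z * ψ z.1 * deriv η z.2
      + (ε * inner ℝ (V z) (torusGrad ψ z.1) + G z * ψ z.1) * η z.2) ∂(cylMeasure n T) = 0

/-! ### Test functions that split the space and time variables -/

instance cylMeasure_isFinite (T : ℝ) : IsFiniteMeasure (cylMeasure n T) := by
  unfold cylMeasure; infer_instance

lemma isTestFunction_mul {ψ : Torus n → ℝ} (hψ : TorusSmooth ψ) {η : ℝ → ℝ} (hη : ContDiff ℝ ∞ η)
    {T : ℝ} (hs : ∃ a b, 0 < a ∧ b < T ∧ ∀ t ∉ Icc a b, η t = 0) :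
    IsTestFunction T (fun z : Torus n × ℝ => ψ z.1 * η z.2) := by
  constructor
  · exact (ContDiff.comp (g := fun y : Vec n => ψ (toTorus y)) hψ contDiff_fst).mul
      (hη.comp contDiff_snd)
  · obtain ⟨a, b, ha, hb, h⟩ := hs
    exact ⟨a, b, ha, hb, fun x t ht => by simp [h t ht]⟩

lemma timeDeriv_mul (ψ : Torus n → ℝ) {η : ℝ → ℝ} (hη : ContDiff ℝ ∞ η) (z : Torus n × ℝ) :
    timeDeriv (fun z : Torus n × ℝ => ψ z.1 * η z.2) z = ψ z.1 * deriv η z.2 := by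
  unfold timeDeriv
  exact (((hη.differentiable (by simp)) z.2).hasDerivAt.const_mul (ψ z.1)).deriv

lemma torusGrad_mul_const {ψ : Torus n → ℝ} (hψ : TorusSmooth ψ) (c : ℝ) (x : Torus n) :
    torusGrad (fun x => ψ x * c) x = c • torusGrad ψ x := by
  ext i
  have h := (hψ.hasPartial i x).mul_const c
  have h2 : torusGrad (fun x => ψ x * c) x i = torusGrad ψ x i * c := h.deriv
  rw [h2, PiLp.smul_apply, smul_eq_mul, mul_comm]

lemma spaceGrad_mul {ψ : Torus n → ℝ} (hψ : TorusSmooth ψ) (η : ℝ → ℝ) (z : Torus n × ℝ) :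
    spaceGrad (fun z : Torus n × ℝ => ψ z.1 * η z.2) z = η z.2 • torusGrad ψ z.1 := by
  unfold spaceGrad
  exact torusGrad_mul_const hψ (η z.2) z.1

lemma TorusSmooth.continuous_torusGrad {ψ : Torus n → ℝ} (h : TorusSmooth ψ) :
    Continuous (ViscousHJ.torusGrad ψ) := by
  have : Continuous fun x => (fun i => ViscousHJ.torusGrad ψ x i) :=
    continuous_pi fun i => (h.torusGrad i).continuous
  exact (PiLp.continuous_toLp 2 _).comp this

namespace IsLinearSolution

variable {T ε : ℝ} {w : Torus n × ℝ → ℝ} {V : Torus n × ℝ → Vec n} {G : Torus n × ℝ → ℝ}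

lemma integrable_grad (h : IsLinearSolution T ε w V G) : Integrable V (cylMeasure n T) :=
  h.memLp_grad.integrable (by norm_num)

lemma ae_integrable_source (h : IsLinearSolution T ε w V G) :
    ∀ᵐ t ∂((volume : Measure ℝ).restrict (Ioo 0 T)), Integrable (fun x => G (x, t)) volume :=
  Integrable.prod_left_ae (μ := (volume : Measure (Torus n))) h.integrable_source

lemma ae_memLp_grad (h : IsLinearSolution T ε w V G) :
    ∀ᵐ t ∂((volume : Measure ℝ).restrict (Ioo 0 T)), MemLp (fun x => V (x, t)) 2 volume := by
  have h1 := (memLp_two_iff_integrable_sq_norm h.memLp_grad.1).1 h.memLp_grad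
  filter_upwards [Integrable.prod_left_ae (μ := (volume : Measure (Torus n))) h1] with t ht
  exact (memLp_two_iff_integrable_sq_norm
    (h.stronglyMeasurable_grad.comp_measurable measurable_prodMk_right).aestronglyMeasurable).2 ht

lemma continuous_slice (h : IsLinearSolution T ε w V G) (t : ℝ) :
    Continuous (fun x => w (x, t)) := h.continuous.comp (by fun_prop)

/-- The weak formulation tested with a function of the space variable. -/
lemma integral_mul_sub (h : IsLinearSolution T ε w V G) {ψ : Torus n → ℝ} (hψ : TorusSmooth ψ)
    {s t : ℝ} (hs : 0 < s) (hst : s ≤ t) (ht : t < T) :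
    (∫ x, w (x, t) * ψ x) - ∫ x, w (x, s) * ψ x
      = ∫ τ in s..t, ∫ x, (ε * inner ℝ (V (x, τ)) (torusGrad ψ x) + G (x, τ) * ψ x) := by
  obtain ⟨C, hC⟩ := h.bounded
  obtain ⟨D, hD0, hD⟩ := continuous_exists_bound hψ.continuous
  obtain ⟨E, hE⟩ := isCompact_univ.exists_bound_of_continuousOn
    hψ.continuous_torusGrad.continuousOn
  have hC0 : 0 ≤ C := (norm_nonneg _).trans (hC 0)
  have i1 : Integrable (fun z : Torus n × ℝ => inner ℝ (V z) (torusGrad ψ z.1)) (cylMeasure n T) := by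
    refine (h.integrable_grad.norm.mul_const E).mono'
      (h.integrable_grad.aestronglyMeasurable.inner
        (hψ.continuous_torusGrad.comp continuous_fst).aestronglyMeasurable)
      (Eventually.of_forall fun z => ?_)
    exact (norm_inner_le_norm _ _).trans (by gcongr; exact hE z.1 (mem_univ _))
  have i2 : Integrable (fun z : Torus n × ℝ => G z * ψ z.1) (cylMeasure n T) :=
    h.integrable_source.mul_bdd (hψ.continuous.comp continuous_fst).aestronglyMeasurable
      (Eventually.of_forall fun z => hD z.1)
  have i12 : Integrable (fun z : Torus n × ℝ => ε * inner ℝ (V z) (torusGrad ψ z.1) + G z * ψ z.1)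
      (cylMeasure n T) := (i1.const_mul ε).add i2
  refine sub_eq_integral_of_weak_deriv (T := T)
    (m := fun τ => ∫ x, w (x, τ) * ψ x) ?_ ?_ ?_ hs hst ht
  · refine Continuous.continuousOn ?_
    refine continuous_of_dominated (bound := fun x => C * D)
      (fun τ => ((h.continuous_slice τ).mul hψ.continuous).aestronglyMeasurable)
      (fun τ => Eventually.of_forall fun x => ?_) (integrable_const _)
      (Eventually.of_forall fun x => ?_)
    · rw [norm_mul]; exact mul_le_mul (hC _) (hD _) (norm_nonneg _) hC0
    · exact (h.continuous.comp (by fun_prop)).mul continuous_const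
  · exact Integrable.integral_prod_right i12
  · intro η hη hsupp
    have e2 := h.equation ψ η hψ hη hsupp
    obtain ⟨a, b, ha, hb, hz⟩ := hsupp
    have hηc : HasCompactSupport η := HasCompactSupport.intro isCompact_Icc hz
    obtain ⟨M, hM⟩ := hηc.exists_bound_of_continuous hη.continuous
    obtain ⟨M', hM'⟩ := (hηc.deriv).exists_bound_of_continuous (hη.continuous_deriv (by simp))
    have j1 : Integrable (fun z : Torus n × ℝ => w z * ψ z.1 * deriv η z.2) (cylMeasure n T) := by
      refine Integrable.of_bound (C := C * D * M') ?_ (Eventually.of_forall fun z => ?_)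
      · exact ((h.continuous.mul (hψ.continuous.comp continuous_fst)).mul
          ((hη.continuous_deriv (by simp)).comp continuous_snd)).aestronglyMeasurable
      · rw [norm_mul, norm_mul]
        have := hM' z.2
        have := hC z
        have := hD z.1
        gcongr
    have j2 : Integrable (fun z : Torus n × ℝ =>
        (ε * inner ℝ (V z) (torusGrad ψ z.1) + G z * ψ z.1) * η z.2) (cylMeasure n T) :=
      i12.mul_bdd (hη.continuous.comp continuous_snd).aestronglyMeasurable
        (Eventually.of_forall fun z => hM z.2)
    refine Eq.trans ?_ e2
    unfold cylMeasure at j1 j2 i12 ⊢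
    refine Eq.trans ?_ (integral_prod_symm _ (j1.add j2)).symm
    refine integral_congr_ae ?_
    filter_upwards [j1.prod_left_ae, j2.prod_left_ae] with τ h1 h2
    simp only [Pi.add_apply] at h1 h2 ⊢
    rw [integral_add h1 h2, integral_mul_const, integral_mul_const]

end IsLinearSolution

/-! ### Limits of integrals under spatial mollification -/

lemma tendsto_integral_mul_of_tendsto {a : ℕ → Torus n → ℝ} {b : Torus n → ℝ}
    (ha : ∀ m, Continuous (a m)) {C : ℝ} (hC : ∀ m x, ‖a m x‖ ≤ C)
    (hab : ∀ x, Tendsto (fun m => a m x) atTop (𝓝 (b x)))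
    {P : ℕ → Torus n → ℝ} {Q : Torus n → ℝ} (hP : ∀ m, Integrable (P m) volume)
    (hQ : Integrable Q volume)
    (hPQ : Tendsto (fun m => eLpNorm (fun x => P m x - Q x) 1 volume) atTop (𝓝 0)) :
    Tendsto (fun m => ∫ x, a m x * P m x) atTop (𝓝 (∫ x, b x * Q x)) := by
  have hC0 : 0 ≤ C := (norm_nonneg _).trans (hC 0 0)
  have e : ∀ m, ∫ x, a m x * P m x = (∫ x, a m x * Q x) + ∫ x, a m x * (P m x - Q x) := by
    intro m
    rw [← integral_add]
    · simp_rw [← mul_add, add_sub_cancel]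
    · exact hQ.bdd_mul (ha m).aestronglyMeasurable (Eventually.of_forall (hC m))
    · exact ((hP m).sub hQ).bdd_mul (ha m).aestronglyMeasurable (Eventually.of_forall (hC m))
  simp_rw [e]
  rw [show (∫ x, b x * Q x) = (∫ x, b x * Q x) + 0 by ring]
  refine Tendsto.add ?_ ?_
  · refine tendsto_integral_of_dominated_convergence (fun x => C * ‖Q x‖)
      (fun m => (ha m).aestronglyMeasurable.mul hQ.aestronglyMeasurable) (hQ.norm.const_mul C)
      (fun m => Eventually.of_forall fun x => ?_)
      (Eventually.of_forall fun x => (hab x).mul_const _)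
    rw [norm_mul]; gcongr; exact hC m x
  · have h1 : Tendsto (fun m => C * (eLpNorm (fun x => P m x - Q x) 1 volume).toReal) atTop (𝓝 0) := by
      have := ((ENNReal.tendsto_toReal ENNReal.zero_ne_top).comp hPQ).const_mul C
      simpa using this
    refine squeeze_zero_norm (fun m => ?_) h1
    have hi := (hP m).sub hQ
    calc ‖∫ x, a m x * (P m x - Q x)‖ ≤ ∫ x, C * ‖P m x - Q x‖ := by
          refine norm_integral_le_of_norm_le (hi.norm.const_mul C) (Eventually.of_forall fun x => ?_)
          rw [norm_mul]; gcongr; exact hC m x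
      _ = C * (eLpNorm (fun x => P m x - Q x) 1 volume).toReal := by
          rw [integral_const_mul, eLpNorm_one_eq_lintegral_enorm, integral_norm_eq_lintegral_enorm]
          exact hi.aestronglyMeasurable

/-- Factor `a² - b² = (a - b)(a + b)`: the first factor tends to `0` in `L²`, and the second is
bounded in `L²` by contraction. -/
lemma tendsto_eLpNorm_conv_kernel_sq {f : Torus n → ℝ} (hf : MemLp f 2 volume) :
    Tendsto (fun m => eLpNorm (fun y => conv (kernel m) f y ^ 2 - f y ^ 2) 1 volume) atTop (𝓝 0) := by
  have hfi : Integrable f volume := hf.integrable (by norm_num)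
  have hc : ∀ m, AEStronglyMeasurable (conv (kernel m) f) volume := fun m =>
    (continuous_conv (continuous_kernel m) hfi).aestronglyMeasurable
  have h1 : Tendsto (fun m => eLpNorm (fun y => conv (kernel m) f y - f y) 2 volume
      * (2 * eLpNorm f 2 volume)) atTop (𝓝 0) := by
    have := ENNReal.Tendsto.mul_const (tendsto_eLpNorm_conv_kernel (q := 2) (by norm_num) (by norm_num) hf)
      (b := 2 * eLpNorm f 2 volume) (Or.inr (ENNReal.mul_ne_top (by norm_num) hf.2.ne))
    simpa using this
  refine tendsto_of_tendsto_of_tendsto_of_le_of_le tendsto_const_nhds h1 (fun _ => zero_le) ?_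
  intro m
  have h2 : eLpNorm (fun y => conv (kernel m) f y + f y) 2 volume ≤ 2 * eLpNorm f 2 volume := by
    refine (eLpNorm_add_le (hc m) hf.1 (by norm_num)).trans ?_
    rw [two_mul]
    gcongr
    exact eLpNorm_conv_kernel_le m hf.1 (by norm_num) (by norm_num)
  calc eLpNorm (fun y => conv (kernel m) f y ^ 2 - f y ^ 2) 1 volume
      = eLpNorm ((fun y => conv (kernel m) f y - f y) • fun y => conv (kernel m) f y + f y) 1 volume := by
        congr 1; ext y; simp; ring
    _ ≤ eLpNorm (fun y => conv (kernel m) f y - f y) 2 volume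
        * eLpNorm (fun y => conv (kernel m) f y + f y) 2 volume :=
        eLpNorm_smul_le_mul_eLpNorm ((hc m).add hf.1) ((hc m).sub hf.1)
    _ ≤ _ := mul_le_mul_right h2 _

lemma norm_conv_le {k f : Torus n → ℝ} {C : ℝ} (hC : ∀ x, ‖k x‖ ≤ C) (hf : Integrable f volume)
    (y : Torus n) : ‖conv k f y‖ ≤ C * ∫ x, ‖f x‖ := by
  unfold conv
  rw [← integral_const_mul]
  refine norm_integral_le_of_norm_le (hf.norm.const_mul C) (Eventually.of_forall fun x => ?_)
  rw [norm_mul]; gcongr; exact hC _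

lemma norm_conv_kernel_le {f : Torus n → ℝ} {C : ℝ} (hC : ∀ x, ‖f x‖ ≤ C) (m : ℕ) (y : Torus n) :
    ‖conv (kernel m) f y‖ ≤ C := by
  have hk : Continuous fun x : Torus n => kernel m (y - x) :=
    (continuous_kernel m).comp (continuous_const.sub continuous_id)
  have : ‖conv (kernel m) f y‖ ≤ ∫ x, kernel m (y - x) * C := by
    refine norm_integral_le_of_norm_le ((Continuous.integrable_torus hk).mul_const C)
      (Eventually.of_forall fun x => ?_)
    rw [norm_mul, Real.norm_of_nonneg (kernel_nonneg _ _)]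
    exact mul_le_mul_of_nonneg_left (hC x) (kernel_nonneg _ _)
  rwa [integral_mul_const, integral_kernel_sub, one_mul] at this

lemma stronglyMeasurable_conv {k : Torus n → ℝ} (hk : Continuous k) {f : Torus n × ℝ → ℝ}
    (hf : StronglyMeasurable f) :
    StronglyMeasurable (fun z : Torus n × ℝ => conv k (fun x => f (x, z.2)) z.1) := by
  unfold conv
  refine StronglyMeasurable.integral_prod_right (ν := volume)
    (f := fun (z : Torus n × ℝ) (x : Torus n) => k (z.1 - x) * f (x, z.2)) ?_
  have h1 : Continuous fun q : (Torus n × ℝ) × Torus n => k (q.1.1 - q.2) := by fun_prop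
  exact h1.stronglyMeasurable.mul (hf.comp_measurable (by fun_prop))

/-! ### The mollified equation and the energy identity -/

namespace IsLinearSolution

variable {T ε : ℝ} {w : Torus n × ℝ → ℝ} {V : Torus n × ℝ → Vec n} {G : Torus n × ℝ → ℝ}

lemma continuous_conv_uncurry (h : IsLinearSolution T ε w V G) {k : Torus n → ℝ}
    (hk : Continuous k) :
    Continuous (fun z : Torus n × ℝ => conv k (fun x => w (x, z.2)) z.1) := by
  obtain ⟨C, hC⟩ := h.bounded
  obtain ⟨D, hD0, hD⟩ := continuous_exists_bound hk
  unfold conv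
  refine continuous_of_dominated (bound := fun x => D * C)
    (fun z => ?_) (fun z => Eventually.of_forall fun x => ?_) (integrable_const _)
    (Eventually.of_forall fun x => ?_)
  · exact ((hk.comp (by fun_prop)).mul (h.continuous.comp (by fun_prop))).aestronglyMeasurable
  · rw [norm_mul]
    exact mul_le_mul (hD _) (hC _) (norm_nonneg _) hD0
  · exact (hk.comp (by fun_prop)).mul (h.continuous.comp (by fun_prop))

/-- The time derivative of the spatially mollified solution. -/
def mollifiedRate (ε : ℝ) (V : Torus n × ℝ → Vec n) (G : Torus n × ℝ → ℝ) (k : Torus n → ℝ)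
    (z : Torus n × ℝ) : ℝ :=
  (∑ i, -ε * conv (fun x => torusGrad k x i) (fun x => V (x, z.2) i) z.1)
    + conv k (fun x => G (x, z.2)) z.1

lemma stronglyMeasurable_comp (h : IsLinearSolution T ε w V G) (i : Fin n) :
    StronglyMeasurable (fun z => V z i) :=
  (EuclideanSpace.proj (𝕜 := ℝ) i).continuous.comp_stronglyMeasurable h.stronglyMeasurable_grad

lemma stronglyMeasurable_mollifiedRate (h : IsLinearSolution T ε w V G) {k : Torus n → ℝ}
    (hk : TorusSmooth k) : StronglyMeasurable (mollifiedRate ε V G k) := by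
  unfold mollifiedRate
  refine StronglyMeasurable.add ?_ (stronglyMeasurable_conv hk.continuous h.stronglyMeasurable_source)
  refine Finset.stronglyMeasurable_fun_sum _ fun i _ => ?_
  exact (stronglyMeasurable_conv (hk.torusGrad i).continuous (h.stronglyMeasurable_comp i)).const_mul _

lemma ae_integrable_comp (h : IsLinearSolution T ε w V G) :
    ∀ᵐ t ∂((volume : Measure ℝ).restrict (Ioo 0 T)), ∀ i,
      MemLp (fun x => V (x, t) i) 2 volume := by
  filter_upwards [h.ae_memLp_grad] with t ht i
  refine ht.of_le ?_ (Eventually.of_forall fun x => PiLp.norm_apply_le _ i)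
  exact ((h.stronglyMeasurable_comp i).comp_measurable measurable_prodMk_right).aestronglyMeasurable

/-- The evolution of the mollified solution at a point. -/
lemma conv_sub_conv (h : IsLinearSolution T ε w V G) {k : Torus n → ℝ} (hk : TorusSmooth k)
    (y : Torus n) {s t : ℝ} (hs : 0 < s) (hst : s ≤ t) (ht : t < T) :
    conv k (fun x => w (x, t)) y - conv k (fun x => w (x, s)) y
      = ∫ τ in s..t, mollifiedRate ε V G k (y, τ) := by
  -- The test function `x ↦ k (y - x)` turns the weak formulation into the evolution of the
  -- convolution at the point `y`.
  have e := h.integral_mul_sub (hk.const_sub y) hs hst ht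
  unfold conv
  simp_rw [mul_comm (k _)]
  rw [e, intervalIntegral.integral_of_le hst, intervalIntegral.integral_of_le hst]
  have hsub : Ioc s t ⊆ Ioo 0 T := fun τ hτ => ⟨hs.trans hτ.1, hτ.2.trans_lt ht⟩
  refine integral_congr_ae ?_
  filter_upwards [ae_restrict_of_ae_restrict_of_subset hsub h.ae_integrable_comp,
    ae_restrict_of_ae_restrict_of_subset hsub h.ae_integrable_source] with τ hV hG
  have hV' : ∀ i, Integrable (fun x => torusGrad k (y - x) i * V (x, τ) i) volume := fun i =>
    integrable_conv_integrand (hk.torusGrad i).continuous ((hV i).integrable (by norm_num)) y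
  have hG' := integrable_conv_integrand hk.continuous hG y
  have e2 : ∀ x, ε * inner ℝ (V (x, τ)) (torusGrad (fun x => k (y - x)) x) + G (x, τ) * k (y - x)
      = (∑ i, -ε * (torusGrad k (y - x) i * V (x, τ) i)) + k (y - x) * G (x, τ) := by
    intro x
    rw [PiLp.inner_apply, Finset.mul_sum]
    congr 1
    · refine Finset.sum_congr rfl fun i _ => ?_
      rw [hk.torusGrad_const_sub]
      simp
    · ring
  simp_rw [e2]
  rw [integral_add (integrable_finsetSum _ fun i _ => (hV' i).const_mul (-ε)) hG',
    integral_finsetSum _ fun i _ => (hV' i).const_mul (-ε)]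
  simp only [integral_const_mul]
  rfl

/-- A bound of the rate which does not depend on the space variable. -/
lemma exists_rate_bound (h : IsLinearSolution T ε w V G) {k : Torus n → ℝ} (hk : TorusSmooth k) :
    ∃ B : ℝ → ℝ, Integrable B ((volume : Measure ℝ).restrict (Ioo 0 T)) ∧
      ∀ᵐ t ∂((volume : Measure ℝ).restrict (Ioo 0 T)), ∀ y,
        ‖mollifiedRate ε V G k (y, t)‖ ≤ B t := by
  choose D hD0 hD using fun i => continuous_exists_bound (hk.torusGrad i).continuous
  obtain ⟨E, hE0, hE⟩ := continuous_exists_bound hk.continuous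
  have i1 : ∀ i, Integrable (fun z => V z i) (cylMeasure n T) := fun i =>
    h.integrable_grad.mono (h.stronglyMeasurable_comp i).aestronglyMeasurable
      (Eventually.of_forall fun x => PiLp.norm_apply_le _ i)
  refine ⟨fun t => (∑ i, |ε| * (D i * ∫ x, ‖V (x, t) i‖)) + E * ∫ x, ‖G (x, t)‖, ?_, ?_⟩
  · refine Integrable.add (integrable_finsetSum _ fun i _ => ?_) ?_
    · exact ((Integrable.integral_prod_right (i1 i).norm).const_mul _).const_mul _
    · exact (Integrable.integral_prod_right h.integrable_source.norm).const_mul _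
  · filter_upwards [h.ae_integrable_comp, h.ae_integrable_source] with t hV hG y
    unfold mollifiedRate
    refine (norm_add_le _ _).trans (add_le_add ((norm_sum_le _ _).trans
      (Finset.sum_le_sum fun i _ => ?_)) (norm_conv_le hE hG y))
    rw [norm_mul, norm_neg, Real.norm_eq_abs ε]
    exact mul_le_mul_of_nonneg_left (norm_conv_le (hD i) ((hV i).integrable (by norm_num)) y)
      (abs_nonneg _)

lemma continuous_slice_uncurry (h : IsLinearSolution T ε w V G) {k : Torus n → ℝ}
    (hk : Continuous k) (t : ℝ) : Continuous (conv k (fun x => w (x, t))) :=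
  (h.continuous_conv_uncurry hk).comp (g := fun z : Torus n × ℝ => conv k (fun x => w (x, z.2)) z.1)
    (f := fun y => (y, t)) (by fun_prop)

lemma exists_bound_comp (h : IsLinearSolution T ε w V G) {Ψ : ℝ → ℝ} (hΨ : Continuous Ψ) :
    ∃ C, 0 ≤ C ∧ (∀ z, ‖Ψ (w z)‖ ≤ C) ∧
      ∀ m t y, ‖Ψ (conv (kernel m) (fun x => w (x, t)) y)‖ ≤ C := by
  obtain ⟨C, hC⟩ := h.bounded
  obtain ⟨D, hD⟩ := (isCompact_Icc (a := -C) (b := C)).exists_bound_of_continuousOn hΨ.continuousOn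
  refine ⟨max D 0, le_max_right _ _, fun z => ?_, fun m t y => ?_⟩
  · exact (hD _ (abs_le.1 (hC z))).trans (le_max_left _ _)
  · exact (hD _ (abs_le.1 (norm_conv_kernel_le (fun x => hC (x, t)) m y))).trans (le_max_left _ _)

/-- The spatial part of the energy identity for the mollified solution. -/
lemma integral_mul_mollifiedRate {m : ℕ} {t : ℝ} {Φ' Φ'' : ℝ → ℝ}
    (hΦ' : ∀ r, HasDerivAt Φ' (Φ'' r) r) (hc : Continuous Φ'')
    (hw : Continuous fun x => w (x, t)) (hg : IsWeakGrad (fun x => w (x, t)) (fun x => V (x, t)))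
    (hV : ∀ i, MemLp (fun x => V (x, t) i) 2 volume) (hG : Integrable (fun x => G (x, t)) volume) :
    ∫ y, Φ' (conv (kernel m) (fun x => w (x, t)) y) * mollifiedRate ε V G (kernel m) (y, t)
      = (∑ i, ε * ∫ y, Φ'' (conv (kernel m) (fun x => w (x, t)) y)
          * conv (kernel m) (fun x => V (x, t) i) y ^ 2)
        + ∫ y, Φ' (conv (kernel m) (fun x => w (x, t)) y) * conv (kernel m) (fun x => G (x, t)) y := by
  have hk := torusSmooth_kernel (n := n) m
  have hVi : ∀ i, Integrable (fun x => V (x, t) i) volume := fun i => (hV i).integrable (by norm_num)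
  set W := conv (kernel m) (fun x => w (x, t)) with hW
  have hwi : Integrable (fun x => w (x, t)) volume := Continuous.integrable_torus hw
  have cW : Continuous W := continuous_conv hk.continuous hwi
  have cΦ' : Continuous Φ' := continuous_iff_continuousAt.2 fun r => (hΦ' r).continuousAt
  have cP : ∀ i, Continuous (conv (kernel m) (fun x => V (x, t) i)) := fun i =>
    continuous_conv hk.continuous (hVi i)
  have cL : ∀ i, Continuous (conv (fun x => torusGrad (kernel m) x i) (fun x => V (x, t) i)) :=
    fun i => continuous_conv (hk.torusGrad i).continuous (hVi i)
  have pW : ∀ i, HasPartial W i (conv (kernel m) (fun x => V (x, t) i)) := by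
    intro i
    have := hasPartial_conv hk.continuous (hk.torusGrad i).continuous (hk.hasPartial i) hwi
    convert this using 1
    ext y
    exact (conv_partial_of_isWeakGrad hk hg i y).symm
  have key : ∀ i, ∫ y, Φ' (W y) * (-ε * conv (fun x => torusGrad (kernel m) x i) (fun x => V (x, t) i) y)
      = ε * ∫ y, Φ'' (W y) * conv (kernel m) (fun x => V (x, t) i) y ^ 2 := by
    intro i
    -- The function with zero mean derivative is `Φ'(W)` times the mollified `Vᵢ`. Since the
    -- mollified `Vᵢ` is also `∂ᵢW`, the product rule yields the `Φ''` term and the diffusive part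
    -- of the rate.
    have h0 := integral_partial_eq_zero ((cΦ'.comp cW).mul (cP i))
      ((((hc.comp cW).mul (cP i)).mul (cP i)).add ((cΦ'.comp cW).mul (cL i)))
      (((pW i).comp hΦ').mul (hasPartial_conv hk.continuous (hk.torusGrad i).continuous
        (hk.hasPartial i) (hVi i)))
    rw [integral_add' (Continuous.integrable_torus (((hc.comp cW).mul (cP i)).mul (cP i)))
      (Continuous.integrable_torus ((cΦ'.comp cW).mul (cL i)))] at h0
    simp only [Pi.mul_apply, Function.comp_apply] at h0
    have e1 : ∫ y, Φ' (W y) * (-ε * conv (fun x => torusGrad (kernel m) x i) (fun x => V (x, t) i) y)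
        = -ε * ∫ y, Φ' (W y) * conv (fun x => torusGrad (kernel m) x i) (fun x => V (x, t) i) y := by
      rw [← integral_const_mul]; congr 1; ext y; ring
    have e2 : ∫ y, Φ'' (W y) * conv (kernel m) (fun x => V (x, t) i) y ^ 2
        = ∫ y, Φ'' (W y) * conv (kernel m) (fun x => V (x, t) i) y
          * conv (kernel m) (fun x => V (x, t) i) y := by
      congr 1; ext y; ring
    rw [e1, e2]
    linear_combination (-ε) * h0
  unfold mollifiedRate
  simp_rw [mul_add, Finset.mul_sum]
  rw [integral_add, integral_finsetSum]
  · congr 1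
    exact Finset.sum_congr rfl fun i _ => key i
  · exact fun i _ => Continuous.integrable_torus ((cΦ'.comp cW).mul (continuous_const.mul (cL i)))
  · exact integrable_finsetSum _ fun i _ =>
      Continuous.integrable_torus ((cΦ'.comp cW).mul (continuous_const.mul (cL i)))
  · exact Continuous.integrable_torus ((cΦ'.comp cW).mul (continuous_conv hk.continuous hG))

/-- The energy identity for the mollified solution. -/
lemma mollified_energy (h : IsLinearSolution T ε w V G) (m : ℕ) {Φ Φ' Φ'' : ℝ → ℝ}
    (hΦ : ∀ r, HasDerivAt Φ (Φ' r) r) (hΦ' : ∀ r, HasDerivAt Φ' (Φ'' r) r) (hc : Continuous Φ'')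
    {s t : ℝ} (hs : 0 < s) (hst : s ≤ t) (ht : t < T) :
    (∫ y, Φ (conv (kernel m) (fun x => w (x, t)) y)) - ∫ y, Φ (conv (kernel m) (fun x => w (x, s)) y)
      = ∫ τ in Ioc s t, ((∑ i, ε * ∫ y, Φ'' (conv (kernel m) (fun x => w (x, τ)) y)
          * conv (kernel m) (fun x => V (x, τ) i) y ^ 2)
        + ∫ y, Φ' (conv (kernel m) (fun x => w (x, τ)) y)
          * conv (kernel m) (fun x => G (x, τ)) y) := by
  have hk := torusSmooth_kernel (n := n) m
  have hsub : Ioc s t ⊆ Ioo 0 T := fun τ hτ => ⟨hs.trans hτ.1, hτ.2.trans_lt ht⟩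
  have cΦ : Continuous Φ := continuous_iff_continuousAt.2 fun r => (hΦ r).continuousAt
  have cΦ' : Continuous Φ' := continuous_iff_continuousAt.2 fun r => (hΦ' r).continuousAt
  obtain ⟨C, hC0, -, hC⟩ := h.exists_bound_comp cΦ'
  -- A majorant integrable in time and uniform in space serves both the chain rule at each point and
  -- the exchange of integrals.
  obtain ⟨B, hBi, hB⟩ := h.exists_rate_bound hk
  have hBi' : Integrable B (volume.restrict (Ioc s t)) :=
    hBi.mono_measure (Measure.restrict_mono hsub le_rfl)
  have hB' := ae_restrict_of_ae_restrict_of_subset hsub hB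
  have mR := h.stronglyMeasurable_mollifiedRate hk
  have hint : Integrable (fun z : Torus n × ℝ => Φ' (conv (kernel m) (fun x => w (x, z.2)) z.1)
      * mollifiedRate ε V G (kernel m) z) ((volume : Measure (Torus n)).prod (volume.restrict (Ioc s t))) := by
    refine Integrable.mono' (g := fun z : Torus n × ℝ => C * B z.2)
      ((hBi'.comp_snd volume).const_mul C) ?_ ?_
    · exact ((cΦ'.comp (h.continuous_conv_uncurry hk.continuous)).stronglyMeasurable.mul
        mR).aestronglyMeasurable
    · have : ∀ᵐ z ∂((volume : Measure (Torus n)).prod (volume.restrict (Ioc s t))),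
          ∀ y, ‖mollifiedRate ε V G (kernel m) (y, z.2)‖ ≤ B z.2 :=
        (Measure.quasiMeasurePreserving_snd (μ := (volume : Measure (Torus n)))).ae hB'
      filter_upwards [this] with z hz
      rw [norm_mul]
      exact mul_le_mul (hC _ _ _) (hz z.1) (norm_nonneg _) hC0
  -- At fixed `y` the mollified solution is a primitive in time, so the one-variable chain rule
  -- applies there.
  have step : ∀ y, Φ (conv (kernel m) (fun x => w (x, t)) y) - Φ (conv (kernel m) (fun x => w (x, s)) y)
      = ∫ τ in Ioc s t, Φ' (conv (kernel m) (fun x => w (x, τ)) y)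
        * mollifiedRate ε V G (kernel m) (y, τ) := by
    intro y
    have hA : IntervalIntegrable (fun τ => mollifiedRate ε V G (kernel m) (y, τ)) volume s t := by
      rw [intervalIntegrable_iff_integrableOn_Ioc_of_le hst]
      refine Integrable.mono' hBi' (mR.comp_measurable measurable_prodMk_left).aestronglyMeasurable ?_
      filter_upwards [hB'] with τ hτ using hτ y
    rw [← intervalIntegral.integral_of_le hst]
    exact integral_chain_rule (W := fun τ => conv (kernel m) (fun x => w (x, τ)) y) hst hA
      (fun r hr => h.conv_sub_conv hk y hs hr.1 (hr.2.trans_lt ht)) hΦ cΦ'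
  have cS : ∀ r, Integrable (fun y => Φ (conv (kernel m) (fun x => w (x, r)) y)) volume := fun r =>
    Continuous.integrable_torus (cΦ.comp (h.continuous_slice_uncurry hk.continuous r))
  rw [← integral_sub (cS t) (cS s)]
  simp_rw [step]
  rw [integral_integral_swap hint]
  refine integral_congr_ae ?_
  filter_upwards [ae_restrict_of_ae_restrict_of_subset hsub h.ae_integrable_comp,
    ae_restrict_of_ae_restrict_of_subset hsub h.ae_integrable_source,
    ae_restrict_of_ae_restrict_of_subset hsub h.weakGrad] with τ hV hG hg
  exact integral_mul_mollifiedRate hΦ' hc (h.continuous_slice τ) hg hV hG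

lemma tendsto_conv_comp (h : IsLinearSolution T ε w V G) {Ψ : ℝ → ℝ} (hΨ : Continuous Ψ) (t : ℝ)
    (y : Torus n) :
    Tendsto (fun m => Ψ (conv (kernel m) (fun x => w (x, t)) y)) atTop (𝓝 (Ψ (w (y, t)))) :=
  (hΨ.tendsto _).comp ((tendstoUniformly_conv_kernel (h.continuous_slice t)).tendsto_at y)

/-- The energy identity. -/
lemma energy (h : IsLinearSolution T ε w V G) {Φ Φ' Φ'' : ℝ → ℝ}
    (hΦ : ∀ r, HasDerivAt Φ (Φ' r) r) (hΦ' : ∀ r, HasDerivAt Φ' (Φ'' r) r) (hc : Continuous Φ'')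
    {s t : ℝ} (hs : 0 < s) (hst : s ≤ t) (ht : t < T) :
    (∫ y, Φ (w (y, t))) - ∫ y, Φ (w (y, s))
      = ∫ τ in Ioc s t, ((∑ i, ε * ∫ y, Φ'' (w (y, τ)) * V (y, τ) i ^ 2)
        + ∫ y, Φ' (w (y, τ)) * G (y, τ)) := by
  have hsub : Ioc s t ⊆ Ioo 0 T := fun τ hτ => ⟨hs.trans hτ.1, hτ.2.trans_lt ht⟩
  have cΦ : Continuous Φ := continuous_iff_continuousAt.2 fun r => (hΦ r).continuousAt
  have cΦ' : Continuous Φ' := continuous_iff_continuousAt.2 fun r => (hΦ' r).continuousAt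
  obtain ⟨C, hC0, -, hC⟩ := h.exists_bound_comp cΦ
  obtain ⟨C', hC0', -, hC'⟩ := h.exists_bound_comp cΦ'
  obtain ⟨C'', hC0'', -, hC''⟩ := h.exists_bound_comp hc
  have L : ∀ r, Tendsto (fun m => ∫ y, Φ (conv (kernel m) (fun x => w (x, r)) y)) atTop
      (𝓝 (∫ y, Φ (w (y, r)))) := fun r =>
    tendsto_integral_of_dominated_convergence (fun _ => C)
      (fun m => (cΦ.comp (h.continuous_slice_uncurry (continuous_kernel m) r)).aestronglyMeasurable)
      (integrable_const C) (fun m => Eventually.of_forall fun y => hC m r y)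
      (Eventually.of_forall fun y => h.tendsto_conv_comp cΦ r y)
  have aV := ae_restrict_of_ae_restrict_of_subset hsub h.ae_integrable_comp
  have aG := ae_restrict_of_ae_restrict_of_subset hsub h.ae_integrable_source
  have iV : ∀ i, Integrable (fun z => V z i ^ 2) (cylMeasure n T) := fun i => by
    have : MemLp (fun z => V z i) 2 (cylMeasure n T) :=
      h.memLp_grad.of_le (h.stronglyMeasurable_comp i).aestronglyMeasurable
        (Eventually.of_forall fun x => PiLp.norm_apply_le _ i)
    exact this.integrable_sq
  refine tendsto_nhds_unique ((L t).sub (L s)) ?_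
  simp_rw [fun m => h.mollified_energy m hΦ hΦ' hc hs hst ht]
  -- The majorant is independent of `m`, because mollification contracts `L²` (for the gradient) and
  -- `L¹` (for the source).
  refine tendsto_integral_of_dominated_convergence
    (fun τ => (∑ i, |ε| * (C'' * ∫ y, V (y, τ) i ^ 2)) + C' * ∫ y, ‖G (y, τ)‖) ?_ ?_ ?_ ?_
  · intro m
    have hk := continuous_kernel (n := n) m
    have cw := h.continuous_conv_uncurry hk
    refine StronglyMeasurable.aestronglyMeasurable (StronglyMeasurable.add
      (Finset.stronglyMeasurable_fun_sum _ fun i _ => StronglyMeasurable.const_mul ?_ _) ?_)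
    · exact StronglyMeasurable.integral_prod_left (μ := volume)
        (f := fun y τ => Φ'' (conv (kernel m) (fun x => w (x, τ)) y)
          * conv (kernel m) (fun x => V (x, τ) i) y ^ 2)
        ((hc.comp cw).stronglyMeasurable.mul
          ((stronglyMeasurable_conv hk (h.stronglyMeasurable_comp i)).pow 2))
    · exact StronglyMeasurable.integral_prod_left (μ := volume)
        (f := fun y τ => Φ' (conv (kernel m) (fun x => w (x, τ)) y)
          * conv (kernel m) (fun x => G (x, τ)) y)
        ((cΦ'.comp cw).stronglyMeasurable.mul
          (stronglyMeasurable_conv hk h.stronglyMeasurable_source))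
  · refine Integrable.mono_measure (ν := volume.restrict (Ioc s t)) ?_ le_rfl
    refine Integrable.mono_measure ?_ (Measure.restrict_mono hsub le_rfl)
    refine Integrable.add (integrable_finsetSum _ fun i _ => ?_) ?_
    · exact ((Integrable.integral_prod_right (iV i)).const_mul _).const_mul _
    · exact (Integrable.integral_prod_right h.integrable_source.norm).const_mul _
  · intro m
    filter_upwards [aV, aG] with τ hV hG
    refine (norm_add_le _ _).trans (add_le_add ((norm_sum_le _ _).trans
      (Finset.sum_le_sum fun i _ => ?_)) ?_)
    · rw [norm_mul, Real.norm_eq_abs ε]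
      refine mul_le_mul_of_nonneg_left ?_ (abs_nonneg _)
      have hVi := (hV i).integrable (by norm_num : (1 : ℝ≥0∞) ≤ 2)
      have cP := continuous_conv (continuous_kernel m) hVi
      calc ‖∫ y, Φ'' (conv (kernel m) (fun x => w (x, τ)) y) * conv (kernel m) (fun x => V (x, τ) i) y ^ 2‖
          ≤ ∫ y, C'' * conv (kernel m) (fun x => V (x, τ) i) y ^ 2 := by
            refine norm_integral_le_of_norm_le (Continuous.integrable_torus
              (continuous_const.mul (cP.pow 2))) (Eventually.of_forall fun y => ?_)
            rw [norm_mul, Real.norm_of_nonneg (sq_nonneg _)]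
            exact mul_le_mul_of_nonneg_right (hC'' m τ y) (sq_nonneg _)
        _ ≤ C'' * ∫ y, V (y, τ) i ^ 2 := by
            rw [integral_const_mul]
            refine mul_le_mul_of_nonneg_left ?_ hC0''
            have l := lintegral_conv_kernel_rpow_le m (hV i).1 (q := 2) (by norm_num)
            have e : ∀ r : ℝ, ‖r‖ₑ ^ (2 : ℝ) = ENNReal.ofReal (r ^ 2) := by
              intro r
              rw [Real.enorm_eq_ofReal_abs, ENNReal.ofReal_rpow_of_nonneg (abs_nonneg _) (by norm_num)]
              norm_num
            simp_rw [e] at l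
            rw [← ofReal_integral_eq_lintegral_ofReal (f := fun y => conv (kernel m) (fun x => V (x, τ) i) y ^ 2)
                (Continuous.integrable_torus (cP.pow 2)) (Eventually.of_forall fun y => sq_nonneg _),
              ← ofReal_integral_eq_lintegral_ofReal (hV i).integrable_sq
                (Eventually.of_forall fun y => sq_nonneg _)] at l
            exact (ENNReal.ofReal_le_ofReal_iff (integral_nonneg fun y => sq_nonneg _)).1 l
    · have cP := continuous_conv (continuous_kernel m) hG
      calc ‖∫ y, Φ' (conv (kernel m) (fun x => w (x, τ)) y) * conv (kernel m) (fun x => G (x, τ)) y‖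
          ≤ ∫ y, C' * ‖conv (kernel m) (fun x => G (x, τ)) y‖ := by
            refine norm_integral_le_of_norm_le (Continuous.integrable_torus
              (continuous_const.mul cP.norm)) (Eventually.of_forall fun y => ?_)
            rw [norm_mul]
            exact mul_le_mul_of_nonneg_right (hC' m τ y) (norm_nonneg _)
        _ ≤ C' * ∫ y, ‖G (y, τ)‖ := by
            rw [integral_const_mul]
            refine mul_le_mul_of_nonneg_left ?_ hC0'
            have l := lintegral_conv_kernel_rpow_le m hG.1 (q := 1) le_rfl
            simp_rw [ENNReal.rpow_one] at l
            rw [integral_norm_eq_lintegral_enorm cP.aestronglyMeasurable,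
              integral_norm_eq_lintegral_enorm hG.1]
            exact ENNReal.toReal_mono hG.2.ne l
  · filter_upwards [aV, aG] with τ hV hG
    refine Tendsto.add (tendsto_finsetSum _ fun i _ => Tendsto.const_mul _ ?_) ?_
    · have hVi := (hV i).integrable (by norm_num : (1 : ℝ≥0∞) ≤ 2)
      exact tendsto_integral_mul_of_tendsto
        (fun m => hc.comp (h.continuous_slice_uncurry (continuous_kernel m) τ))
        (fun m x => hC'' m τ x) (fun x => h.tendsto_conv_comp hc τ x)
        (fun m => Continuous.integrable_torus ((continuous_conv (continuous_kernel m) hVi).pow 2))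
        (hV i).integrable_sq (tendsto_eLpNorm_conv_kernel_sq (hV i))
    · exact tendsto_integral_mul_of_tendsto
        (fun m => cΦ'.comp (h.continuous_slice_uncurry (continuous_kernel m) τ))
        (fun m x => hC' m τ x) (fun x => h.tendsto_conv_comp cΦ' τ x)
        (fun m => Continuous.integrable_torus (continuous_conv (continuous_kernel m) hG))
        hG (tendsto_eLpNorm_conv_kernel le_rfl (by norm_num) (memLp_one_iff_integrable.2 hG))

end IsLinearSolution

/-! ### Gagliardo–Nirenberg inequalities on the torus -/

lemma shift_eq_update (i : Fin n) (x : Torus n) (s : ℝ) :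
    shift i x s = Function.update x i (x i + (s : UnitAddCircle)) := by
  ext j
  by_cases hj : j = i
  · subst hj; simp [shift]
  · simp [shift, hj]

lemma lintegral_shift (i : Fin n) (x : Torus n) (f : Torus n → ℝ≥0∞) :
    ∫⁻ s in Ioc (0 : ℝ) 1, f (shift i x s) = ∫⁻ a : UnitAddCircle, f (Function.update x i a) := by
  simp_rw [shift_eq_update]
  have h := UnitAddCircle.lintegral_preimage 0 (fun a => f (Function.update x i (x i + a)))
  rw [zero_add] at h
  rw [h]
  exact lintegral_add_left_eq_self (fun a => f (Function.update x i a)) (x i)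

/-- A function of class `C¹` on the torus is dominated by its `W^{1,1}` norm on each grid line. -/
lemma ofReal_le_lintegral_update {v v' : Torus n → ℝ} {i : Fin n} (hv : Continuous v)
    (hv' : Continuous v') (H : HasPartial v i v') (h0 : ∀ x, 0 ≤ v x) (x : Torus n) :
    ENNReal.ofReal (v x) ≤ ∫⁻ a : UnitAddCircle, (ENNReal.ofReal (v (Function.update x i a))
      + ENNReal.ofReal |v' (Function.update x i a)|) := by
  rw [← lintegral_shift i x (fun z => ENNReal.ofReal (v z) + ENNReal.ofReal |v' z|)]
  have cs : Continuous fun s : ℝ => shift i x s :=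
    (continuous_shift i).comp (continuous_const.prodMk continuous_id)
  have c1 : Continuous fun s : ℝ => v (shift i x s) := hv.comp cs
  have c2 : Continuous fun s : ℝ => v' (shift i x s) := hv'.comp cs
  -- Compare `v x` with its value anywhere on the same coordinate circle; averaging over `s ∈ [0,1]`
  -- then gives the claim.
  have key : ∀ s ∈ Icc (0 : ℝ) 1, v x ≤ v (shift i x s) + ∫ σ in (0 : ℝ)..1, |v' (shift i x σ)| := by
    intro s hs
    have h1 : ∫ σ in (0 : ℝ)..s, v' (shift i x σ) = v (shift i x s) - v x := by
      have := intervalIntegral.integral_eq_sub_of_hasDerivAt (a := 0) (b := s)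
        (f := fun s => v (shift i x s)) (fun σ _ => H.hasDerivAt x σ) (c2.intervalIntegrable _ _)
      simpa using this
    have h2 : |∫ σ in (0 : ℝ)..s, v' (shift i x σ)| ≤ ∫ σ in (0 : ℝ)..s, |v' (shift i x σ)| :=
      intervalIntegral.abs_integral_le_integral_abs hs.1
    have h3 : ∫ σ in (0 : ℝ)..s, |v' (shift i x σ)| ≤ ∫ σ in (0 : ℝ)..1, |v' (shift i x σ)| :=
      intervalIntegral.integral_mono_interval le_rfl hs.1 hs.2
        (Eventually.of_forall fun _ => abs_nonneg _) (c2.abs.intervalIntegrable _ _)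
    have h4 := neg_abs_le (∫ σ in (0 : ℝ)..s, v' (shift i x σ))
    linarith
  have h5 : v x ≤ ∫ s in (0 : ℝ)..1, (v (shift i x s) + |v' (shift i x s)|) := by
    have := intervalIntegral.integral_mono_on (μ := volume) (zero_le_one' ℝ)
      (f := fun _ => v x) (g := fun s => v (shift i x s) + ∫ σ in (0 : ℝ)..1, |v' (shift i x σ)|)
      (continuous_const.intervalIntegrable _ _) ((c1.add continuous_const).intervalIntegrable _ _) key
    rw [intervalIntegral.integral_add (c1.intervalIntegrable _ _)
      (continuous_const.intervalIntegrable _ _)] at this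
    rw [intervalIntegral.integral_add (c1.intervalIntegrable _ _) (c2.abs.intervalIntegrable _ _)]
    simpa using this
  rw [intervalIntegral.integral_of_le zero_le_one] at h5
  refine (ENNReal.ofReal_le_ofReal h5).trans (le_of_eq ?_)
  rw [ofReal_integral_eq_lintegral_ofReal]
  · exact lintegral_congr fun s => ENNReal.ofReal_add (h0 _) (abs_nonneg _)
  · exact ((c1.add c2.abs).continuousOn (s := Icc 0 1)).integrableOn_Icc.mono_set Ioc_subset_Icc_self
  · exact Eventually.of_forall fun s => add_nonneg (h0 _) (abs_nonneg _)

/-- The Gagliardo inequality `W^{1,1} ⊂ L^{n/(n-1)}` on the torus. -/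
lemma lintegral_pow_le_pow_lintegral_partials (hn : 2 ≤ n) {v : Torus n → ℝ}
    {v' : Fin n → Torus n → ℝ} (hv : Continuous v) (hv' : ∀ i, Continuous (v' i))
    (H : ∀ i, HasPartial v i (v' i)) (h0 : ∀ x, 0 ≤ v x) :
    ∫⁻ x, ENNReal.ofReal (v x) ^ ((n : ℝ) / (n - 1))
      ≤ ((∫⁻ x, ENNReal.ofReal (v x)) + ∑ i, ∫⁻ x, ENNReal.ofReal |v' i x|) ^ ((n : ℝ) / (n - 1)) := by
  have hn1 : (1 : ℝ) < n := by exact_mod_cast (by omega : 1 < n)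
  have hconj : Real.HolderConjugate (Fintype.card (Fin n)) ((n : ℝ) / (n - 1)) := by
    rw [Fintype.card_fin]
    exact Real.HolderConjugate.conjExponent hn1
  let f : Torus n → ℝ≥0∞ := fun x => ENNReal.ofReal (v x) + ∑ i, ENNReal.ofReal |v' i x|
  have m1 : Measurable fun x => ENNReal.ofReal (v x) :=
    (ENNReal.continuous_ofReal.comp hv).measurable
  have m2 : ∀ i, Measurable fun x => ENNReal.ofReal |v' i x| := fun i =>
    (ENNReal.continuous_ofReal.comp (hv' i).abs).measurable
  have hf : Measurable f := m1.add (Finset.measurable_fun_sum _ fun i _ => m2 i)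
  -- The grid-lines inequality bounds the integral of the product of the `n` line integrals, each to
  -- the power `1/(n-1)`. Every line integral of `f` dominates `v x`, so this product dominates `v x
  -- ^ (n/(n-1))`.
  have h := lintegral_prod_lintegral_pow_le (fun _ : Fin n => (volume : Measure UnitAddCircle))
    hconj hf
  have hfi : ∫⁻ x, f x = (∫⁻ x, ENNReal.ofReal (v x)) + ∑ i, ∫⁻ x, ENNReal.ofReal |v' i x| := by
    simp only [f]
    rw [lintegral_add_left m1, lintegral_finsetSum _ fun i _ => m2 i]
  rw [← hfi]
  refine le_trans (lintegral_mono fun x => ?_) h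
  rw [Fintype.card_fin]
  have hx : ∀ i, ENNReal.ofReal (v x) ≤ ∫⁻ a : UnitAddCircle, f (Function.update x i a) := fun i =>
    (ofReal_le_lintegral_update hv (hv' i) (H i) h0 x).trans (lintegral_mono fun a => by
      simp only [f]
      gcongr
      exact Finset.single_le_sum (f := fun j => ENNReal.ofReal |v' j (Function.update x i a)|)
        (fun _ _ => zero_le) (Finset.mem_univ i))
  calc ENNReal.ofReal (v x) ^ ((n : ℝ) / (n - 1))
      = ∏ _i : Fin n, ENNReal.ofReal (v x) ^ ((1 : ℝ) / (n - 1)) := by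
        rw [Finset.prod_const, Finset.card_univ, Fintype.card_fin, ← ENNReal.rpow_natCast,
          ← ENNReal.rpow_mul]
        congr 1
        field_simp
    _ ≤ ∏ i : Fin n, (∫⁻ a : UnitAddCircle, f (Function.update x i a)) ^ ((1 : ℝ) / (n - 1)) := by
        refine Finset.prod_le_prod' fun i _ => ?_
        exact ENNReal.rpow_le_rpow (hx i) (by apply div_nonneg <;> linarith)

/-- The exponent of the `L²` norm in the Gagliardo–Nirenberg inequality for `∫ v ^ r`. -/
def gnExponent (n : ℕ) (r : ℝ) : ℝ := (r * (1 - n / 2) + n) / 2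

/-- The squared `H¹` norm of a function `v` with gradient `v'`. -/
def sobolevSq (v : Torus n → ℝ) (v' : Fin n → Torus n → ℝ) : ℝ≥0∞ :=
  (∫⁻ x, ENNReal.ofReal (v x) ^ (2 : ℝ)) + ∑ i, ∫⁻ x, ENNReal.ofReal |v' i x| ^ (2 : ℝ)

/-- The Gagliardo–Nirenberg inequality for the exponent `r` and positive `C¹` functions. -/
def HasGN (n : ℕ) (r : ℝ) : Prop :=
  ∃ C : ℝ≥0, ∀ (v : Torus n → ℝ) (v' : Fin n → Torus n → ℝ), Continuous v →
    (∀ i, Continuous (v' i)) → (∀ i, HasPartial v i (v' i)) → (∀ x, 0 < v x) →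
    ∫⁻ x, ENNReal.ofReal (v x) ^ r
      ≤ C * (∫⁻ x, ENNReal.ofReal (v x) ^ (2 : ℝ)) ^ gnExponent n r
        * sobolevSq v v' ^ (r / 2 - gnExponent n r)

/-- Cauchy–Schwarz, in the form that meets `v^(r/2)|Dv|`, the size of the gradient of `v^(1+r/2)` up
to a constant. -/
lemma lintegral_rpow_mul_le {U W : Torus n → ℝ≥0∞} (hU : Measurable U) (hW : Measurable W) {r : ℝ} :
    ∫⁻ x, U x ^ (r / 2) * W x
      ≤ (∫⁻ x, U x ^ r) ^ (1 / 2 : ℝ) * (∫⁻ x, W x ^ (2 : ℝ)) ^ (1 / 2 : ℝ) := by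
  refine le_trans (le_of_eq ?_) (ENNReal.lintegral_mul_norm_pow_le (hU.pow_const r).aemeasurable
    (hW.pow_const (2 : ℝ)).aemeasurable (by norm_num) (by norm_num) (by norm_num))
  refine lintegral_congr fun x => ?_
  rw [← ENNReal.rpow_mul, ← ENNReal.rpow_mul]
  norm_num
  rw [div_eq_mul_one_div]

lemma HasGN.two : HasGN n 2 := by
  refine ⟨1, fun v v' _ _ _ _ => ?_⟩
  have : gnExponent n 2 = 1 := by unfold gnExponent; ring
  simp [this]

/-- Apply the Gagliardo inequality to `v^γ` with `γ = 1 + r/2`. Its gradient is `γ v^(r/2) Dv`, so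
by Cauchy–Schwarz its `W^{1,1}` norm is at most a constant times `(∫v^r)^(1/2) S^(1/2)`, and the
inequality for `r` bounds `∫v^r`. For `n > 2` the map `r ↦ n/(n-1) (1 + r/2)` has the critical
exponent `2n/(n-2)` as fixed point; for `n = 2` it is `r ↦ r + 2`. Strict positivity of `v` avoids
case distinctions for real powers. -/
lemma HasGN.step (hn : 2 ≤ n) {r : ℝ} (hr : 2 ≤ r) (h : HasGN n r) :
    HasGN n ((n : ℝ) / (n - 1) * (1 + r / 2)) := by
  have hn1 : (1 : ℝ) < n := by exact_mod_cast (by omega : 1 < n)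
  have hn0 : (0 : ℝ) < n - 1 := by linarith
  obtain ⟨C, hC⟩ := h
  set q : ℝ := (n : ℝ) / (n - 1) with hq
  have hq0 : 0 < q := by positivity
  set γ : ℝ := 1 + r / 2 with hγ
  have hβ : 0 ≤ r / 2 - gnExponent n r := by
    unfold gnExponent
    have : 0 ≤ n * (r - 2) := mul_nonneg (by linarith) (by linarith)
    linarith
  -- The step multiplies the `L²` exponent by `q/2`, exactly the power to which `∫v^r` enters; this
  -- keeps the form of the inequality along the iteration.
  have e1 : gnExponent n (q * γ) = gnExponent n r * (q / 2) := by
    unfold gnExponent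
    simp only [hγ, hq]
    field_simp
    ring
  refine ⟨(1 + n * Real.toNNReal γ) ^ q * C ^ (q / 2), fun v v' hv hv' H h0 => ?_⟩
  have hJ := hC v v' hv hv' H h0
  set J := ∫⁻ x, ENNReal.ofReal (v x) ^ r with hJdef
  set A := ∫⁻ x, ENNReal.ofReal (v x) ^ (2 : ℝ) with hA
  set S := sobolevSq v v' with hS
  have hAS : A ≤ S := le_self_add
  have mU : Measurable fun x => ENNReal.ofReal (v x) := (ENNReal.continuous_ofReal.comp hv).measurable
  have mU' : ∀ i, Measurable fun x => ENNReal.ofReal |v' i x| := fun i =>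
    (ENNReal.continuous_ofReal.comp (hv' i).abs).measurable
  have hpow : ∀ a : ℝ, Continuous fun x => v x ^ a := fun a =>
    hv.rpow_const fun x => Or.inl (h0 x).ne'
  have G := lintegral_pow_le_pow_lintegral_partials hn (hpow γ)
    (v' := fun i x => γ * v x ^ (γ - 1) * v' i x)
    (fun i => (continuous_const.mul (hpow (γ - 1))).mul (hv' i)) (fun i x => by
      have h1 : HasDerivAt (fun y : ℝ => y ^ γ) (γ * v x ^ (γ - 1)) (v (shift i x 0)) := by
        rw [shift_zero]; exact Real.hasDerivAt_rpow_const (Or.inl (h0 x).ne')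
      exact HasDerivAt.comp (h₂ := fun y : ℝ => y ^ γ) (0 : ℝ) h1 (H i x))
    (fun x => Real.rpow_nonneg (h0 x).le _)
  have hγ1 : γ - 1 = r / 2 := by rw [hγ]; ring
  have hγ0 : 0 ≤ γ := by rw [hγ]; linarith
  have b0 : ∫⁻ x, ENNReal.ofReal (v x ^ γ) ≤ J ^ (1 / 2 : ℝ) * S ^ (1 / 2 : ℝ) := by
    calc ∫⁻ x, ENNReal.ofReal (v x ^ γ) = ∫⁻ x, ENNReal.ofReal (v x) ^ (r / 2) * ENNReal.ofReal (v x) := by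
          refine lintegral_congr fun x => ?_
          rw [ENNReal.ofReal_rpow_of_pos (h0 x), ← ENNReal.ofReal_mul (Real.rpow_nonneg (h0 x).le _),
            ← Real.rpow_add_one (h0 x).ne', hγ, add_comm]
      _ ≤ J ^ (1 / 2 : ℝ) * A ^ (1 / 2 : ℝ) := lintegral_rpow_mul_le mU mU
      _ ≤ _ := mul_le_mul_right (ENNReal.rpow_le_rpow hAS (by norm_num)) _
  have b1 : ∀ i, ∫⁻ x, ENNReal.ofReal |γ * v x ^ (γ - 1) * v' i x|
      ≤ ENNReal.ofReal γ * (J ^ (1 / 2 : ℝ) * S ^ (1 / 2 : ℝ)) := by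
    intro i
    calc ∫⁻ x, ENNReal.ofReal |γ * v x ^ (γ - 1) * v' i x|
        = ∫⁻ x, ENNReal.ofReal γ * (ENNReal.ofReal (v x) ^ (r / 2) * ENNReal.ofReal |v' i x|) := by
          refine lintegral_congr fun x => ?_
          have hp := Real.rpow_nonneg (h0 x).le (r / 2)
          rw [ENNReal.ofReal_rpow_of_pos (h0 x), ← ENNReal.ofReal_mul hp, ← ENNReal.ofReal_mul hγ0,
            abs_mul, abs_mul, abs_of_nonneg hγ0, hγ1, abs_of_nonneg hp, mul_assoc]
      _ = ENNReal.ofReal γ * ∫⁻ x, ENNReal.ofReal (v x) ^ (r / 2) * ENNReal.ofReal |v' i x| :=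
          lintegral_const_mul _ ((mU.pow_const _).mul (mU' i))
      _ ≤ _ := by
          refine mul_le_mul_right ((lintegral_rpow_mul_le mU (mU' i)).trans
            (mul_le_mul_right (ENNReal.rpow_le_rpow ?_ (by norm_num)) _)) _
          refine le_trans ?_ (le_add_self : _ ≤ S)
          exact Finset.single_le_sum
            (f := fun j => ∫⁻ x, ENNReal.ofReal |v' j x| ^ (2 : ℝ)) (fun _ _ => zero_le)
            (Finset.mem_univ i)
  have b2 : (∫⁻ x, ENNReal.ofReal (v x ^ γ)) + ∑ i, ∫⁻ x, ENNReal.ofReal |γ * v x ^ (γ - 1) * v' i x|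
      ≤ (1 + n * ENNReal.ofReal γ) * (J ^ (1 / 2 : ℝ) * S ^ (1 / 2 : ℝ)) := by
    refine (add_le_add b0 (Finset.sum_le_sum fun i _ => b1 i)).trans (le_of_eq ?_)
    simp only [Finset.sum_const, Finset.card_univ, Fintype.card_fin, nsmul_eq_mul]
    ring
  calc ∫⁻ x, ENNReal.ofReal (v x) ^ (q * γ) = ∫⁻ x, ENNReal.ofReal (v x ^ γ) ^ q := by
        refine lintegral_congr fun x => ?_
        rw [← ENNReal.ofReal_rpow_of_pos (h0 x), ← ENNReal.rpow_mul, mul_comm γ q]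
    _ ≤ ((1 + n * ENNReal.ofReal γ) * (J ^ (1 / 2 : ℝ) * S ^ (1 / 2 : ℝ))) ^ q :=
        G.trans (ENNReal.rpow_le_rpow b2 hq0.le)
    _ = (1 + n * ENNReal.ofReal γ) ^ q * (J ^ (q / 2) * S ^ (q / 2)) := by
        rw [ENNReal.mul_rpow_of_nonneg _ _ hq0.le, ENNReal.mul_rpow_of_nonneg _ _ hq0.le,
          ← ENNReal.rpow_mul, ← ENNReal.rpow_mul, one_div_mul_eq_div]
    _ ≤ (1 + n * ENNReal.ofReal γ) ^ q * ((C * A ^ gnExponent n r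
          * S ^ (r / 2 - gnExponent n r)) ^ (q / 2) * S ^ (q / 2)) :=
        mul_le_mul_right (mul_le_mul_left (ENNReal.rpow_le_rpow hJ (by positivity)) _) _
    _ = _ := by
        have hq2 : 0 ≤ q / 2 := by positivity
        rw [ENNReal.mul_rpow_of_nonneg _ _ hq2, ENNReal.mul_rpow_of_nonneg _ _ hq2,
          ← ENNReal.rpow_mul, ← ENNReal.rpow_mul, e1]
        have e2 : q * γ / 2 - gnExponent n r * (q / 2)
            = (r / 2 - gnExponent n r) * (q / 2) + q / 2 := by rw [hγ]; ring
        rw [e2, ENNReal.rpow_add_of_nonneg _ _ (mul_nonneg hβ hq2) hq2]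
        rw [ENNReal.coe_mul, ENNReal.coe_rpow_of_nonneg _ hq0.le, ENNReal.coe_rpow_of_nonneg _ hq2]
        push_cast
        rw [show ENNReal.ofReal γ = (Real.toNNReal γ : ℝ≥0∞) from rfl]
        ring

/-- The Gagliardo–Nirenberg inequality holds for exponents arbitrarily close to the critical one. -/
lemma exists_hasGN (hn : 2 ≤ n) {q : ℝ} (hq : (n : ℝ) < q) :
    ∃ r, 2 < r ∧ 0 ≤ gnExponent n r ∧ 2 * q / (q - 2) ≤ r ∧ HasGN n r := by
  have hn2 : (2 : ℝ) ≤ n := by exact_mod_cast hn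
  have hq2 : 0 < q - 2 := by linarith
  -- The exponent dual to the drift: for `β ∈ L^q`, Hölder controls `∫β²v²` by `v` in `L^ρ`. Because
  -- `q > n`, `ρ` lies strictly below the critical exponent.
  set ρ := 2 * q / (q - 2) with hρ
  have hρ2 : 2 < ρ := by rw [hρ, lt_div_iff₀ hq2]; linarith
  -- The increase of the exponent in a step from `r` is `(n - r(n-2)/2)/(n-1)`, nonincreasing in
  -- `r`. Its value `c` at `ρ` is positive, so every step below `ρ` gains at least `c` and finitely
  -- many steps suffice.
  set c : ℝ := (n - ρ * (n - 2) / 2) / (n - 1) with hc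
  have hn0 : (0 : ℝ) < n - 1 := by linarith
  have hc0 : 0 < c := by
    refine div_pos ?_ hn0
    rw [hρ, sub_pos, div_mul_eq_mul_div, div_div, div_lt_iff₀ (by positivity)]
    nlinarith
  have key : ∀ k : ℕ, ∃ r, 2 ≤ r ∧ 0 ≤ gnExponent n r ∧ min ρ (2 + k * c) ≤ r ∧ HasGN n r := by
    intro k
    induction k with
    | zero =>
      exact ⟨2, le_rfl, by unfold gnExponent; linarith, by simp, HasGN.two⟩
    | succ k ih =>
      obtain ⟨r, hr2, hα, hr, hGN⟩ := ih
      by_cases hrρ : ρ ≤ r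
      · exact ⟨r, hr2, hα, (min_le_left _ _).trans hrρ, hGN⟩
      · rw [not_le] at hrρ
        have hrk : 2 + k * c ≤ r := by
          rcases min_le_iff.1 hr with h | h
          · linarith
          · exact h
        have hstep : r + c ≤ (n : ℝ) / (n - 1) * (1 + r / 2) := by
          have : (n : ℝ) / (n - 1) * (1 + r / 2) - r - c = (ρ - r) * (n - 2) / (2 * (n - 1)) := by
            rw [hc]; field_simp; ring
          have h2 : 0 ≤ (ρ - r) * (n - 2) / (2 * (n - 1)) :=
            div_nonneg (mul_nonneg (by linarith) (by linarith)) (by linarith)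
          linarith
        refine ⟨_, by linarith, ?_, ?_, hGN.step hn hr2⟩
        · have : gnExponent n ((n : ℝ) / (n - 1) * (1 + r / 2))
              = gnExponent n r * ((n : ℝ) / (n - 1) / 2) := by
            unfold gnExponent
            field_simp
            ring
          rw [this]
          exact mul_nonneg hα (by positivity)
        · refine (min_le_right _ _).trans ?_
          push_cast
          linarith
  obtain ⟨k, hk⟩ := exists_nat_gt ((ρ - 2) / c)
  obtain ⟨r, hr2, hα, hr, hGN⟩ := key k
  rw [div_lt_iff₀ hc0] at hk
  rw [min_eq_left (by linarith)] at hr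
  exact ⟨r, by linarith, hα, hr, hGN⟩

/-- A continuous function `w` on the torus with weak gradient `V ∈ L²`. -/
structure IsSobolevSlice (w : Torus n → ℝ) (V : Torus n → Vec n) : Prop where
  continuous : Continuous w
  weakGrad : IsWeakGrad w V
  memLp : ∀ i, MemLp (fun x => V x i) 2 volume

lemma ofReal_abs_rpow_two (a : ℝ) : ENNReal.ofReal |a| ^ (2 : ℝ) = ENNReal.ofReal (a ^ 2) := by
  rw [ENNReal.ofReal_rpow_of_nonneg (abs_nonneg _) (by norm_num)]
  norm_num

/-! ### From `C¹` functions to compositions with a weakly differentiable slice -/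

section

variable {w : Torus n → ℝ} {V : Torus n → Vec n} {Ψ Ψ' : ℝ → ℝ}

lemma lintegral_ofReal_rpow_ne_top {f : Torus n → ℝ} (hf : Continuous f) {r : ℝ} (hr : 0 ≤ r) :
    ∫⁻ x, ENNReal.ofReal (f x) ^ r ≠ ⊤ := by
  obtain ⟨C, -, hC⟩ := continuous_exists_bound hf
  refine ne_top_of_le_ne_top (b := ENNReal.ofReal C ^ r)
    (ENNReal.rpow_ne_top_of_nonneg hr ENNReal.ofReal_ne_top) ?_
  calc ∫⁻ x, ENNReal.ofReal (f x) ^ r ≤ ∫⁻ _ : Torus n, ENNReal.ofReal C ^ r :=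
        lintegral_mono fun x => ENNReal.rpow_le_rpow
          (ENNReal.ofReal_le_ofReal ((le_abs_self _).trans (hC x))) hr
    _ = _ := by simp

lemma IsSobolevSlice.exists_bound_comp (h : IsSobolevSlice w V) (hΨ : Continuous Ψ) :
    ∃ C, ∀ m y, ‖Ψ (conv (kernel m) w y)‖ ≤ C := by
  obtain ⟨C, -, hC⟩ := continuous_exists_bound h.continuous
  obtain ⟨D, hD⟩ := (isCompact_Icc (a := -C) (b := C)).exists_bound_of_continuousOn hΨ.continuousOn
  exact ⟨D, fun m y => hD _ (abs_le.1 (norm_conv_kernel_le hC m y))⟩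

lemma IsSobolevSlice.continuous_conv_kernel (h : IsSobolevSlice w V) (m : ℕ) :
    Continuous (conv (kernel m) w) :=
  continuous_conv (continuous_kernel m) (Continuous.integrable_torus h.continuous)

lemma IsSobolevSlice.tendsto_conv_comp (h : IsSobolevSlice w V) (hΨ : Continuous Ψ) (y : Torus n) :
    Tendsto (fun m => Ψ (conv (kernel m) w y)) atTop (𝓝 (Ψ (w y))) :=
  (hΨ.tendsto _).comp ((tendstoUniformly_conv_kernel h.continuous).tendsto_at y)

lemma IsSobolevSlice.tendsto_lintegral_rpow (h : IsSobolevSlice w V) (hΨ : Continuous Ψ) {r : ℝ}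
    (hr : 0 ≤ r) :
    Tendsto (fun m => ∫⁻ x, ENNReal.ofReal (Ψ (conv (kernel m) w x)) ^ r) atTop
      (𝓝 (∫⁻ x, ENNReal.ofReal (Ψ (w x)) ^ r)) := by
  obtain ⟨C, hC⟩ := h.exists_bound_comp hΨ
  refine tendsto_lintegral_of_dominated_convergence (fun _ => ENNReal.ofReal C ^ r)
    (fun m => ?_) (fun m => Eventually.of_forall fun x => ?_) ?_ (Eventually.of_forall fun x => ?_)
  · exact (ENNReal.continuous_ofReal.comp (hΨ.comp (h.continuous_conv_kernel m))).measurable.pow_const r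
  · exact ENNReal.rpow_le_rpow (ENNReal.ofReal_le_ofReal ((le_abs_self _).trans (hC m x))) hr
  · simpa using ENNReal.rpow_ne_top_of_nonneg hr ENNReal.ofReal_ne_top
  · exact (ENNReal.continuous_rpow_const.tendsto _).comp
      (ENNReal.tendsto_ofReal (h.tendsto_conv_comp hΨ x))

lemma IsSobolevSlice.integrable_sq (h : IsSobolevSlice w V) (hΨ' : Continuous Ψ') (i : Fin n) :
    Integrable (fun x => (Ψ' (w x) * V x i) ^ 2) volume := by
  obtain ⟨C, -, hC⟩ := continuous_exists_bound ((hΨ'.comp h.continuous).pow 2)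
  have := (h.memLp i).integrable_sq.bdd_mul ((hΨ'.comp h.continuous).pow 2).aestronglyMeasurable
    (Eventually.of_forall hC)
  refine this.congr (Eventually.of_forall fun x => ?_)
  simp only [Pi.pow_apply, Function.comp_apply]
  ring

/-- The factors `Ψ'²` are bounded and converge pointwise, while the squares of the mollified
gradient converge in `L¹`. -/
lemma IsSobolevSlice.tendsto_lintegral_grad (h : IsSobolevSlice w V) (hΨ' : Continuous Ψ')
    (i : Fin n) :
    Tendsto (fun m => ∫⁻ x, ENNReal.ofReal |Ψ' (conv (kernel m) w x)
      * conv (kernel m) (fun x => V x i) x| ^ (2 : ℝ)) atTop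
      (𝓝 (∫⁻ x, ENNReal.ofReal |Ψ' (w x) * V x i| ^ (2 : ℝ))) := by
  have hV := h.memLp i
  have hVi := hV.integrable (by norm_num : (1 : ℝ≥0∞) ≤ 2)
  have c2 : Continuous fun r => Ψ' r ^ 2 := hΨ'.pow 2
  obtain ⟨C, hC⟩ := h.exists_bound_comp c2
  have cP := fun m => continuous_conv (continuous_kernel (n := n) m) hVi
  have key := tendsto_integral_mul_of_tendsto (fun m => c2.comp (h.continuous_conv_kernel m))
    hC (h.tendsto_conv_comp c2)
    (fun m => Continuous.integrable_torus ((cP m).pow 2)) hV.integrable_sq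
    (tendsto_eLpNorm_conv_kernel_sq hV)
  have key2 := ENNReal.tendsto_ofReal key
  simp_rw [ofReal_abs_rpow_two]
  convert key2 using 1
  · ext m
    rw [← ofReal_integral_eq_lintegral_ofReal
      (f := fun x => (Ψ' (conv (kernel m) w x) * conv (kernel m) (fun x => V x i) x) ^ 2)
      (Continuous.integrable_torus (((hΨ'.comp (h.continuous_conv_kernel m)).mul (cP m)).pow 2))
      (Eventually.of_forall fun x => sq_nonneg _)]
    simp only [mul_pow]
    rfl
  · rw [← ofReal_integral_eq_lintegral_ofReal (h.integrable_sq hΨ' i)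
      (Eventually.of_forall fun x => sq_nonneg _)]
    simp only [mul_pow]

lemma IsSobolevSlice.sobolevSq_ne_top (h : IsSobolevSlice w V) (hΨ : Continuous Ψ)
    (hΨ' : Continuous Ψ') :
    sobolevSq (fun x => Ψ (w x)) (fun i x => Ψ' (w x) * V x i) ≠ ⊤ := by
  unfold sobolevSq
  refine ENNReal.add_ne_top.2 ⟨lintegral_ofReal_rpow_ne_top (hΨ.comp h.continuous) (by norm_num),
    ENNReal.sum_ne_top.2 fun i _ => ?_⟩
  simp_rw [ofReal_abs_rpow_two]
  rw [← ofReal_integral_eq_lintegral_ofReal (h.integrable_sq hΨ' i)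
      (Eventually.of_forall fun x => sq_nonneg _)]
  exact ENNReal.ofReal_ne_top

/-- The Gagliardo–Nirenberg inequality for `Ψ(w)`, where `w` has a weak gradient. -/
lemma HasGN.comp_slice {r : ℝ} (hr : 2 ≤ r) (hα : 0 ≤ gnExponent n r) (hGN : HasGN n r) :
    ∃ C : ℝ≥0, ∀ (w : Torus n → ℝ) (V : Torus n → Vec n) (Ψ Ψ' : ℝ → ℝ), IsSobolevSlice w V →
      (∀ a, HasDerivAt Ψ (Ψ' a) a) → Continuous Ψ' → (∀ a, 0 < Ψ a) →
      ∫⁻ x, ENNReal.ofReal (Ψ (w x)) ^ r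
        ≤ C * (∫⁻ x, ENNReal.ofReal (Ψ (w x)) ^ (2 : ℝ)) ^ gnExponent n r
          * sobolevSq (fun x => Ψ (w x)) (fun i x => Ψ' (w x) * V x i)
            ^ (r / 2 - gnExponent n r) := by
  obtain ⟨C, hC⟩ := hGN
  refine ⟨C, fun w V Ψ Ψ' h hΨ hc' hpos => ?_⟩
  have hc : Continuous Ψ := continuous_iff_continuousAt.2 fun a => (hΨ a).continuousAt
  have hβ : 0 ≤ r / 2 - gnExponent n r := by
    unfold gnExponent
    have : 0 ≤ n * (r - 2) := mul_nonneg (by positivity) (by linarith)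
    linarith
  have t2 := h.tendsto_lintegral_rpow hc (r := 2) (by norm_num)
  have tS : Tendsto (fun m => sobolevSq (fun x => Ψ (conv (kernel m) w x))
      (fun i x => Ψ' (conv (kernel m) w x) * conv (kernel m) (fun x => V x i) x)) atTop
      (𝓝 (sobolevSq (fun x => Ψ (w x)) (fun i x => Ψ' (w x) * V x i))) :=
    t2.add (tendsto_finsetSum _ fun i _ => h.tendsto_lintegral_grad hc' i)
  have f2 := lintegral_ofReal_rpow_ne_top (hc.comp h.continuous) (r := 2) (by norm_num)
  have fS := h.sobolevSq_ne_top hc hc'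
  have ta := (ENNReal.continuous_rpow_const (y := gnExponent n r)).tendsto _ |>.comp t2
  have tb := (ENNReal.continuous_rpow_const (y := r / 2 - gnExponent n r)).tendsto _ |>.comp tS
  have fa := ENNReal.rpow_ne_top_of_nonneg hα f2
  have fb := ENNReal.rpow_ne_top_of_nonneg hβ fS
  -- The inequality for the smooth `conv (kernel m) w` passes to the limit. Finiteness of the
  -- limiting factors is needed because multiplication in `ℝ≥0∞` is discontinuous at `0 · ∞`.
  refine le_of_tendsto_of_tendsto' (h.tendsto_lintegral_rpow hc (by linarith))
    (ENNReal.Tendsto.mul (ENNReal.Tendsto.const_mul ta (Or.inr ENNReal.coe_ne_top)) (Or.inr fb) tb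
      (Or.inr (ENNReal.mul_ne_top ENNReal.coe_ne_top fa))) fun m => ?_
  have hVi := fun i => (h.memLp i).integrable (by norm_num : (1 : ℝ≥0∞) ≤ 2)
  have hk := torusSmooth_kernel (n := n) m
  refine hC _ _ (hc.comp (h.continuous_conv_kernel m))
    (fun i => (hc'.comp (h.continuous_conv_kernel m)).mul (continuous_conv hk.continuous (hVi i)))
    (fun i => HasPartial.comp ?_ hΨ) (fun x => hpos _)
  have := hasPartial_conv hk.continuous (hk.torusGrad i).continuous (hk.hasPartial i)
    (Continuous.integrable_torus h.continuous)
  convert this using 1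
  ext y
  exact (conv_partial_of_isWeakGrad hk h.weakGrad i y).symm

end

/-- The interpolation exponent `1 - n / Q`. -/
def interpExponent (n : ℕ) (Q : ℝ≥0∞) : ℝ := 1 - n / Q.toReal

lemma interpExponent_pos {Q : ℝ≥0∞} (hQ : (n : ℝ≥0∞) < Q) : 0 < interpExponent n Q := by
  unfold interpExponent
  by_cases h : Q = ⊤
  · simp [h]
  · have h1 : (n : ℝ) < Q.toReal := by
      have := (ENNReal.toReal_lt_toReal (ENNReal.natCast_ne_top n) h).2 hQ
      simpa using this
    have h2 : (0 : ℝ) < Q.toReal := lt_of_le_of_lt (by positivity) h1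
    rw [sub_pos, div_lt_one h2]
    exact h1

/-- A crude weighted Young inequality: both bases are at most `x + y`. -/
lemma rpow_mul_rpow_le_add {x y : ℝ≥0∞} {s : ℝ} (hs : 0 ≤ s) (hs1 : s ≤ 1) :
    x ^ s * y ^ (1 - s) ≤ x + y := by
  calc x ^ s * y ^ (1 - s) ≤ (x + y) ^ s * (x + y) ^ (1 - s) :=
        mul_le_mul' (ENNReal.rpow_le_rpow le_self_add hs)
          (ENNReal.rpow_le_rpow le_add_self (by linarith))
    _ = x + y := by
        rw [← ENNReal.rpow_add_of_nonneg _ _ hs (by linarith)]; simp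

/-- The interpolation estimate for the product of an `L^Q` drift and `Ψ(w)`. -/
lemma exists_slice_estimate (hn : 2 ≤ n) {Q : ℝ≥0∞} (hQ : (n : ℝ≥0∞) < Q) {δ : ℝ≥0} (hδ : 0 < δ) :
    ∃ K : ℝ≥0, ∀ (w : Torus n → ℝ) (V : Torus n → Vec n) (Ψ Ψ' : ℝ → ℝ) (β : Torus n → ℝ),
      IsSobolevSlice w V → (∀ a, HasDerivAt Ψ (Ψ' a) a) → Continuous Ψ' → (∀ a, 0 < Ψ a) →
      AEStronglyMeasurable β volume →
      ∫⁻ x, ‖β x‖ₑ ^ (2 : ℝ) * ENNReal.ofReal (Ψ (w x)) ^ (2 : ℝ)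
        ≤ δ * (∑ i, ∫⁻ x, ENNReal.ofReal |Ψ' (w x) * V x i| ^ (2 : ℝ))
          + K * (1 + eLpNorm β Q volume ^ (2 / interpExponent n Q))
            * ∫⁻ x, ENNReal.ofReal (Ψ (w x)) ^ (2 : ℝ) := by
  -- For a bounded drift no interpolation is needed: `s = 1` and the drift is pulled out by its
  -- essential supremum.
  by_cases hQt : Q = ⊤
  · subst hQt
    refine ⟨1, fun w V Ψ Ψ' β h hΨ hc' hpos hβ => ?_⟩
    have hs : interpExponent n ⊤ = 1 := by simp [interpExponent]
    have hc : Continuous Ψ := continuous_iff_continuousAt.2 fun a => (hΨ a).continuousAt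
    have m1 : Measurable fun x => ENNReal.ofReal (Ψ (w x)) ^ (2 : ℝ) :=
      (ENNReal.continuous_ofReal.comp (hc.comp h.continuous)).measurable.pow_const _
    rw [hs, div_one]
    calc ∫⁻ x, ‖β x‖ₑ ^ (2 : ℝ) * ENNReal.ofReal (Ψ (w x)) ^ (2 : ℝ)
        ≤ ∫⁻ x, eLpNorm β ⊤ volume ^ (2 : ℝ) * ENNReal.ofReal (Ψ (w x)) ^ (2 : ℝ) := by
          refine lintegral_mono_ae ?_
          filter_upwards [enorm_ae_le_eLpNormEssSup β volume] with x hx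
          rw [eLpNorm_exponent_top]
          exact mul_le_mul_left (ENNReal.rpow_le_rpow hx (by norm_num)) _
      _ = eLpNorm β ⊤ volume ^ (2 : ℝ) * ∫⁻ x, ENNReal.ofReal (Ψ (w x)) ^ (2 : ℝ) :=
          lintegral_const_mul _ m1
      _ ≤ _ := by
          refine le_trans ?_ le_add_self
          rw [ENNReal.coe_one, one_mul]
          exact mul_le_mul_left le_add_self _
  set q := Q.toReal with hq
  have hnq : (n : ℝ) < q := by
    have := (ENNReal.toReal_lt_toReal (ENNReal.natCast_ne_top n) hQt).2 hQ
    simpa using this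
  have hn2 : (2 : ℝ) ≤ n := by exact_mod_cast hn
  have hq0 : 0 < q := by linarith
  have hq2 : 0 < q - 2 := by linarith
  obtain ⟨r, hr2, hα, hr, hGN⟩ := exists_hasGN hn hnq
  obtain ⟨C, hC⟩ := hGN.comp_slice hr2.le hα
  set s := interpExponent n Q with hs
  have hs' : s = 1 - n / q := rfl
  have hs0 : 0 < s := interpExponent_pos hQ
  have hs1 : 0 ≤ 1 - s := by rw [hs']; simp; positivity
  have hr2' : 0 < r - 2 := by linarith
  -- The weights `2/q`, `a`, `b` solve `2/q + a + b = 1` and `2a + rb = 2`: a three-factor Hölder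
  -- inequality for `|β|^q`, `ψ²`, `ψ^r` with product `β²ψ²`. The weight `a` is nonnegative because
  -- `r ≥ 2q/(q-2)`.
  set b : ℝ := 4 / q / (r - 2) with hb
  set a : ℝ := 1 - 2 / q - b with ha
  have hb0 : 0 ≤ b := by positivity
  have ha0 : 0 ≤ a := by
    rw [div_le_iff₀ hq2] at hr
    have : a = (r * (q - 2) - 2 * q) / (q * (r - 2)) := by
      rw [ha, hb]; field_simp; ring
    rw [this]
    exact div_nonneg (by linarith) (by positivity)
  have hβ0 : 0 ≤ r / 2 - gnExponent n r := by
    unfold gnExponent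
    have : 0 ≤ n * (r - 2) := mul_nonneg (by positivity) (by linarith)
    linarith
  -- After inserting Gagliardo–Nirenberg, the `L²` integral carries total power `s` and the Sobolev
  -- term power `1 - s`, whatever `r` was chosen.
  have hexp : a + gnExponent n r * b = s := by
    rw [ha, hb, hs']; unfold gnExponent; field_simp; ring
  have hexp2 : (r / 2 - gnExponent n r) * b = 1 - s := by
    rw [hb, hs']; unfold gnExponent; field_simp; ring
  have hab2 : 2 * a + r * b = 2 := by
    rw [ha, hb]; field_simp; ring
  -- Chosen so that `K₀^s δ^(1-s) = C^b`, which lets Young's inequality put exactly `δ` before the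
  -- Sobolev term. That term also contains `∫ψ²`, whence the constant `δ + K₀`.
  set K₀ : ℝ≥0 := (C ^ b * δ ^ (-(1 - s))) ^ (1 / s) with hK₀
  refine ⟨δ + K₀, fun w V Ψ Ψ' β h hΨ hc' hpos hβ => ?_⟩
  have hc : Continuous Ψ := continuous_iff_continuousAt.2 fun a => (hΨ a).continuousAt
  have hG := hC w V Ψ Ψ' h hΨ hc' hpos
  set B := eLpNorm β Q volume with hB
  set A := ∫⁻ x, ENNReal.ofReal (Ψ (w x)) ^ (2 : ℝ) with hA
  set J := ∫⁻ x, ENNReal.ofReal (Ψ (w x)) ^ r with hJ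
  set S := sobolevSq (fun x => Ψ (w x)) (fun i x => Ψ' (w x) * V x i) with hS
  have mU : Measurable fun x => ENNReal.ofReal (Ψ (w x)) :=
    (ENNReal.continuous_ofReal.comp (hc.comp h.continuous)).measurable
  have hB2 : (∫⁻ x, ‖β x‖ₑ ^ q) ^ (2 / q) = B ^ (2 : ℝ) := by
    have hQ0 : Q ≠ 0 := by rintro rfl; simp at hQ
    rw [hB, eLpNorm_eq_lintegral_rpow_enorm_toReal hQ0 hQt, ← ENNReal.rpow_mul]
    congr 1
    rw [← hq]; ring
  have holder : ∫⁻ x, ‖β x‖ₑ ^ (2 : ℝ) * ENNReal.ofReal (Ψ (w x)) ^ (2 : ℝ)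
      ≤ B ^ (2 : ℝ) * (A ^ a * J ^ b) := by
    have hh := ENNReal.lintegral_mul_prod_norm_pow_le (μ := (volume : Measure (Torus n)))
      (Finset.univ : Finset (Fin 2)) (g := fun x => ‖β x‖ₑ ^ q)
      (f := ![fun x => ENNReal.ofReal (Ψ (w x)) ^ (2 : ℝ), fun x => ENNReal.ofReal (Ψ (w x)) ^ r])
      (hβ.enorm.pow_const q) (fun i _ => by
        fin_cases i
        · exact (mU.pow_const _).aemeasurable
        · exact (mU.pow_const _).aemeasurable) (2 / q) (p := ![a, b])
      (by simp [Fin.sum_univ_two, ha]) (by positivity)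
      (fun i _ => by fin_cases i; exacts [ha0, hb0])
    simp only [Fin.prod_univ_two, Matrix.cons_val_zero, Matrix.cons_val_one] at hh
    rw [hB2] at hh
    refine le_trans (le_of_eq (lintegral_congr fun x => ?_)) hh
    rw [← ENNReal.rpow_mul, ← ENNReal.rpow_mul, ← ENNReal.rpow_mul,
      ← ENNReal.rpow_add_of_nonneg _ _ (by positivity) (by positivity), hab2]
    congr 2
    field_simp
  have hJb : J ^ b ≤ C ^ b * A ^ (gnExponent n r * b) * S ^ (1 - s) := by
    calc J ^ b ≤ _ := ENNReal.rpow_le_rpow hG hb0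
      _ = _ := by
        rw [ENNReal.mul_rpow_of_nonneg _ _ hb0, ENNReal.mul_rpow_of_nonneg _ _ hb0,
          ← ENNReal.rpow_mul, ← ENNReal.rpow_mul, hexp2]
  have hδ1 : ((δ ^ (-(1 - s)) : ℝ≥0) : ℝ≥0∞) * (δ : ℝ≥0∞) ^ (1 - s) = 1 := by
    rw [← ENNReal.coe_rpow_of_nonneg _ hs1, ← ENNReal.coe_mul, ← NNReal.rpow_add hδ.ne']
    simp
  have hKs : (K₀ : ℝ≥0∞) ^ s = (C : ℝ≥0∞) ^ b * ((δ ^ (-(1 - s)) : ℝ≥0) : ℝ≥0∞) := by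
    rw [hK₀, ← ENNReal.coe_rpow_of_nonneg _ hs0.le, ← NNReal.rpow_mul, one_div_mul_cancel hs0.ne',
      NNReal.rpow_one, ENNReal.coe_mul, ENNReal.coe_rpow_of_nonneg _ hb0]
  have hBs : (B ^ (2 / s)) ^ s = B ^ (2 : ℝ) := by
    rw [← ENNReal.rpow_mul]; congr 1; field_simp
  calc ∫⁻ x, ‖β x‖ₑ ^ (2 : ℝ) * ENNReal.ofReal (Ψ (w x)) ^ (2 : ℝ)
      ≤ B ^ (2 : ℝ) * (A ^ a * (C ^ b * A ^ (gnExponent n r * b) * S ^ (1 - s))) :=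
        holder.trans (mul_le_mul_right (mul_le_mul_right hJb _) _)
    _ = B ^ (2 : ℝ) * (C : ℝ≥0∞) ^ b * A ^ s * S ^ (1 - s) := by
        rw [← hexp, ENNReal.rpow_add_of_nonneg _ _ ha0 (mul_nonneg hα hb0), hexp]; ring
    _ = (K₀ * B ^ (2 / s) * A) ^ s * (δ * S) ^ (1 - s) := by
        rw [ENNReal.mul_rpow_of_nonneg _ _ hs0.le, ENNReal.mul_rpow_of_nonneg _ _ hs0.le,
          ENNReal.mul_rpow_of_nonneg _ _ hs1, hKs, hBs]
        calc _ = B ^ (2 : ℝ) * (C : ℝ≥0∞) ^ b * A ^ s * S ^ (1 - s) * 1 := by ring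
          _ = _ := by rw [← hδ1]; ring
    _ ≤ K₀ * B ^ (2 / s) * A + δ * S := rpow_mul_rpow_le_add hs0.le (by linarith)
    _ = δ * (∑ i, ∫⁻ x, ENNReal.ofReal |Ψ' (w x) * V x i| ^ (2 : ℝ))
          + (δ * 1 + K₀ * B ^ (2 / s)) * A := by
        rw [hS]; unfold sobolevSq; ring
    _ ≤ _ := by
        refine add_le_add le_rfl (mul_le_mul_left ?_ _)
        rw [ENNReal.coe_add, mul_add]
        exact add_le_add (mul_le_mul_left le_self_add _) (mul_le_mul_left le_add_self _)

/-! ### Measurability of the drift -/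

lemma measurable_of_dense_of_continuous {X E : Type*} [MeasurableSpace X] [TopologicalSpace E]
    [FirstCountableTopology E] {u : E → X → ℝ} {S : Set E} (hS : Dense S)
    (hc : ∀ x, Continuous fun p => u p x) (hm : ∀ p ∈ S, Measurable (u p)) (p : E) :
    Measurable (u p) := by
  obtain ⟨a, ha, hlim⟩ := mem_closure_iff_seq_limit.1 (hS p)
  refine measurable_of_tendsto_metrizable (fun k => hm (a k) (ha k)) ?_
  exact tendsto_pi_nhds.2 fun x => ((hc x).tendsto p).comp hlim

lemma gradient_apply {f : Vec n → ℝ} {p : Vec n} (hf : DifferentiableAt ℝ f p) (v : Vec n) :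
    inner ℝ (gradient f p) v = fderiv ℝ f p v := by
  have h := hf.hasGradientAt.hasFDerivAt.fderiv
  rw [h]
  simp

lemma norm_gradient (f : Vec n → ℝ) (p : Vec n) : ‖gradient f p‖ = ‖fderiv ℝ f p‖ := by
  simp [gradient]

lemma tendsto_diffQuot_gradient {f : Vec n → ℝ} {p : Vec n} (hf : DifferentiableAt ℝ f p)
    (j : Fin n) :
    Tendsto (fun k : ℕ => (k + 1 : ℝ) * (f (p + (k + 1 : ℝ)⁻¹ • EuclideanSpace.single j (1 : ℝ)) - f p))
      atTop (𝓝 (gradient f p j)) := by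
  have e : gradient f p j = fderiv ℝ f p (EuclideanSpace.single j 1) := by
    rw [← gradient_apply hf, EuclideanSpace.inner_single_right]; simp
  rw [e]
  have h1 : HasDerivAt (fun s : ℝ => p + s • EuclideanSpace.single j (1 : ℝ))
      (EuclideanSpace.single j (1 : ℝ)) 0 := by
    simpa using ((hasDerivAt_id (0 : ℝ)).smul_const (EuclideanSpace.single j (1 : ℝ))).const_add p
  have h2 := HasFDerivAt.comp_hasDerivAt (0 : ℝ) (l := f)
    (f := fun s : ℝ => p + s • EuclideanSpace.single j (1 : ℝ)) (by simpa using hf.hasFDerivAt) h1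
  have h3 := h2.tendsto_slope_zero
  have h4 : Tendsto (fun k : ℕ => (k + 1 : ℝ)⁻¹) atTop (𝓝[≠] 0) := by
    refine tendsto_nhdsWithin_iff.2 ⟨?_, Eventually.of_forall fun k => ?_⟩
    · simpa using tendsto_one_div_add_atTop_nhds_zero_nat (𝕜 := ℝ)
    · have : (0 : ℝ) < (k + 1 : ℝ)⁻¹ := by positivity
      exact this.ne'
  have h5 := h3.comp h4
  refine h5.congr fun k => ?_
  simp

/-- A Carathéodory function of class `C¹` in `p` has a jointly measurable gradient, after a
modification on a null set. -/
lemma IsHamiltonian.exists_measurable_gradient {T : ℝ} {H : Torus n × ℝ → Vec n → ℝ}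
    (hH : IsHamiltonian T H) :
    ∃ g : Vec n × (Torus n × ℝ) → ℝ, Measurable g ∧
      ∀ᵐ z ∂(cylMeasure n T), ∀ p, g (p, z) = ‖gradient (H z) p‖ := by
  let d : ℕ → Vec n := TopologicalSpace.denseSeq (Vec n)
  have hae : ∀ᵐ z ∂(cylMeasure n T), ContDiff ℝ 1 (H z) ∧
      ∀ k, H z (d k) = (hH.measurable (d k)).mk _ z :=
    hH.contDiff.and (ae_all_iff.2 fun k => (hH.measurable (d k)).ae_eq_mk)
  -- The exceptional set in the measurability hypothesis depends on `p`. For a countable dense set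
  -- of `p` the exceptions fit in one measurable null set `N`; setting `H` to zero on `N`,
  -- continuity in `p` handles all other `p`.
  obtain ⟨N, hNsub, hNm, hN0⟩ := exists_measurable_superset_of_null (ae_iff.1 hae)
  have hN : ∀ z ∉ N, ContDiff ℝ 1 (H z) ∧ ∀ k, H z (d k) = (hH.measurable (d k)).mk _ z := by
    intro z hz
    by_contra hcon
    exact hz (hNsub hcon)
  classical
  let h : Torus n × ℝ → Vec n → ℝ := fun z p => if z ∈ N then 0 else H z p
  have hdiff : ∀ z, ContDiff ℝ 1 (h z) := by
    intro z
    by_cases hz : z ∈ N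
    · simp only [h, hz, if_true]; exact contDiff_const
    · simp only [h, hz, if_false]; exact (hN z hz).1
  have hmeas : ∀ p, Measurable fun z => h z p := by
    refine measurable_of_dense_of_continuous (u := fun p z => h z p)
      (TopologicalSpace.denseRange_denseSeq (Vec n)) (fun z => (hdiff z).continuous) ?_
    rintro _ ⟨k, rfl⟩
    have : (fun z => h z (d k)) = fun z => if z ∈ N then 0 else (hH.measurable (d k)).mk _ z := by
      ext z
      by_cases hz : z ∈ N
      · simp [h, hz]
      · simp only [h, hz, if_false]; exact (hN z hz).2 k
    change Measurable fun z => h z (d k)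
    rw [this]
    exact Measurable.ite hNm measurable_const (hH.measurable (d k)).stronglyMeasurable_mk.measurable
  have hjoint : Measurable fun q : Vec n × (Torus n × ℝ) => h q.2 q.1 :=
    (stronglyMeasurable_uncurry_of_continuous_of_stronglyMeasurable (u := fun p z => h z p)
      (fun z => (hdiff z).continuous) fun p => (hmeas p).stronglyMeasurable).measurable
  have hdz : ∀ z p, DifferentiableAt ℝ (h z) p := fun z p => (hdiff z).differentiable (by simp) p
  -- Each component of the gradient is a pointwise limit of jointly measurable difference quotients.
  have hcomp : ∀ j, Measurable fun q : Vec n × (Torus n × ℝ) => gradient (h q.2) q.1 j := by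
    intro j
    refine measurable_of_tendsto_metrizable (f := fun (k : ℕ) (q : Vec n × (Torus n × ℝ)) =>
      (k + 1 : ℝ) * (h q.2 (q.1 + (k + 1 : ℝ)⁻¹ • EuclideanSpace.single j (1 : ℝ)) - h q.2 q.1))
      (fun k => ?_) (tendsto_pi_nhds.2 fun q => tendsto_diffQuot_gradient (hdz q.2 q.1) j)
    refine measurable_const.mul (Measurable.sub ?_ hjoint)
    exact hjoint.comp (g := fun q : Vec n × (Torus n × ℝ) => h q.2 q.1)
      (f := fun q : Vec n × (Torus n × ℝ) =>
        (q.1 + (k + 1 : ℝ)⁻¹ • EuclideanSpace.single j (1 : ℝ), q.2)) (by fun_prop)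
  refine ⟨fun q => Real.sqrt (∑ j, gradient (h q.2) q.1 j ^ 2),
    (Finset.measurable_fun_sum _ fun j _ => (hcomp j).pow_const 2).sqrt, ?_⟩
  have hNae : ∀ᵐ z ∂(cylMeasure n T), z ∉ N := measure_eq_zero_iff_ae_notMem.1 hN0
  filter_upwards [hNae] with z hz p
  have : h z = H z := by ext p; simp [h, hz]
  simp only [this, EuclideanSpace.norm_eq, Real.norm_eq_abs, sq_abs]

/-- The modulus of the drift along the segment joining two measurable vector fields. -/
lemma IsHamiltonian.exists_measurable_drift {T : ℝ} {H : Torus n × ℝ → Vec n → ℝ}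
    (hH : IsHamiltonian T H) {D₁ D₂ : Torus n × ℝ → Vec n} (h₁ : Measurable D₁) (h₂ : Measurable D₂) :
    ∃ b : ℝ × (Torus n × ℝ) → ℝ, Measurable b ∧
      (∀ᵐ z ∂(cylMeasure n T), ∀ θ, b (θ, z) = ‖gradient (H z) (θ • D₁ z + (1 - θ) • D₂ z)‖) ∧
      ∀ᵐ z ∂(cylMeasure n T), ‖H z (D₁ z) - H z (D₂ z)‖ₑ
        ≤ ∫⁻ θ in Icc (0 : ℝ) 1, ‖b (θ, z)‖ₑ * ‖D₁ z - D₂ z‖ₑ := by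
  obtain ⟨g, hg, hgz⟩ := hH.exists_measurable_gradient
  have hb : ∀ᵐ z ∂(cylMeasure n T), ∀ θ : ℝ, g (θ • D₁ z + (1 - θ) • D₂ z, z)
      = ‖gradient (H z) (θ • D₁ z + (1 - θ) • D₂ z)‖ := by
    filter_upwards [hgz] with z hz θ using hz _
  refine ⟨fun q => g (q.1 • D₁ q.2 + (1 - q.1) • D₂ q.2, q.2), hg.comp (by fun_prop), hb, ?_⟩
  filter_upwards [hb, hH.contDiff] with z hz hC
  let γ : ℝ → Vec n := fun θ => θ • D₁ z + (1 - θ) • D₂ z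
  have hγ : ∀ θ, HasDerivAt γ (D₁ z - D₂ z) θ := by
    intro θ
    have := ((hasDerivAt_id θ).smul_const (D₁ z)).add
      (((hasDerivAt_const θ (1 : ℝ)).sub (hasDerivAt_id θ)).smul_const (D₂ z))
    have e : D₁ z - D₂ z = (1 : ℝ) • D₁ z + ((0 : ℝ) - 1) • D₂ z := by
      rw [one_smul, zero_sub, neg_one_smul, sub_eq_add_neg]
    rw [e]
    exact this
  have hγc : Continuous γ := continuous_iff_continuousAt.2 fun θ => (hγ θ).continuousAt
  have hd : ∀ θ, HasDerivAt (fun θ => H z (γ θ)) (fderiv ℝ (H z) (γ θ) (D₁ z - D₂ z)) θ := fun θ =>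
    HasFDerivAt.comp_hasDerivAt θ (hC.differentiable (by simp) _).hasFDerivAt (hγ θ)
  have hcf : Continuous fun θ => fderiv ℝ (H z) (γ θ) :=
    (hC.continuous_fderiv (by simp)).comp hγc
  have hcd : Continuous fun θ => fderiv ℝ (H z) (γ θ) (D₁ z - D₂ z) :=
    hcf.clm_apply continuous_const
  -- The `C¹` regularity in `p` suffices for the fundamental theorem of calculus along the segment.
  have hftc := intervalIntegral.integral_eq_sub_of_hasDerivAt (a := 0) (b := 1)
    (fun θ _ => hd θ) (hcd.intervalIntegrable _ _)
  have e : H z (D₁ z) - H z (D₂ z) = ∫ θ in Icc (0 : ℝ) 1, fderiv ℝ (H z) (γ θ) (D₁ z - D₂ z) := by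
    rw [integral_Icc_eq_integral_Ioc, ← intervalIntegral.integral_of_le zero_le_one, hftc]
    simp [γ]
  rw [e]
  refine (enorm_integral_le_lintegral_enorm _).trans (lintegral_mono fun θ => ?_)
  rw [hz θ, norm_gradient, enorm_norm]
  exact ContinuousLinearMap.le_opENorm _ _

/-! ### Measurability of parametric norms -/

/-- For finite `q` this is Tonelli. For `q = ∞` the condition `essSup ≤ c` says that a section of
`{c < ‖f‖}` is null, and the measure of sections is measurable. -/
lemma measurable_eLpNorm_slice {X Y : Type*} [MeasurableSpace X] [MeasurableSpace Y] {μ : Measure Y}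
    [SFinite μ] {f : X × Y → ℝ} (hf : Measurable f) (q : ℝ≥0∞) :
    Measurable fun x => eLpNorm (fun y => f (x, y)) q μ := by
  by_cases h0 : q = 0
  · simp [h0]
  by_cases ht : q = ⊤
  · subst ht
    simp only [eLpNorm_exponent_top]
    refine measurable_of_Iic fun c => ?_
    have : (fun x => eLpNormEssSup (fun y => f (x, y)) μ) ⁻¹' Iic c
        = (fun x => μ (Prod.mk x ⁻¹' {q | c < ‖f q‖ₑ})) ⁻¹' {0} := by
      ext x
      simp only [mem_preimage, mem_Iic, mem_singleton_iff]
      constructor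
      · intro hx
        have : ∀ᵐ y ∂μ, ‖f (x, y)‖ₑ ≤ c := by
          filter_upwards [enorm_ae_le_eLpNormEssSup (fun y => f (x, y)) μ] with y hy
          exact hy.trans hx
        refine measure_mono_null ?_ (ae_iff.1 this)
        intro y hy
        simpa using hy
      · intro hx
        refine essSup_le_of_ae_le c ?_
        rw [EventuallyLE, ae_iff]
        refine measure_mono_null ?_ hx
        intro y hy
        simpa using hy
    rw [this]
    exact measurable_measure_prodMk_left (measurableSet_lt measurable_const hf.enorm)
      (measurableSet_singleton 0)
  · simp_rw [eLpNorm_eq_lintegral_rpow_enorm_toReal h0 ht]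
    exact (Measurable.lintegral_prod_right' (hf.enorm.pow_const q.toReal)).pow_const _

lemma ae_ae_cylMeasure {T : ℝ} {P : Torus n × ℝ → Prop} (h : ∀ᵐ z ∂(cylMeasure n T), P z) :
    ∀ᵐ t ∂((volume : Measure ℝ).restrict (Ioo 0 T)), ∀ᵐ x : Torus n, P (x, t) :=
  Measure.ae_ae_of_ae_prod ((Measure.measurePreserving_swap
    (μ := (volume : Measure ℝ).restrict (Ioo 0 T))
    (ν := (volume : Measure (Torus n)))).quasiMeasurePreserving.ae h)

/-! ### Regularised powers -/

/-- The regularised power `(r² + σ²)^(p/2)`. -/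
def regPow (p σ r : ℝ) : ℝ := (r ^ 2 + σ ^ 2) ^ (p / 2)

/-- The first derivative of `regPow`. -/
def regPowDeriv (p σ r : ℝ) : ℝ := p * r * (r ^ 2 + σ ^ 2) ^ (p / 2 - 1)

/-- The second derivative of `regPow`. -/
def regPowDeriv₂ (p σ r : ℝ) : ℝ :=
  p * (r ^ 2 + σ ^ 2) ^ (p / 2 - 1) + p * (p - 2) * (r ^ 2 * (r ^ 2 + σ ^ 2) ^ (p / 2 - 2))

section

variable {p σ : ℝ}

lemma reg_pos (hσ : 0 < σ) (r : ℝ) : 0 < r ^ 2 + σ ^ 2 := by positivity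

lemma continuous_reg_rpow (hσ : 0 < σ) (a : ℝ) : Continuous fun r : ℝ => (r ^ 2 + σ ^ 2) ^ a :=
  Continuous.rpow_const (by fun_prop) fun r => Or.inl (reg_pos hσ r).ne'

lemma hasDerivAt_reg_rpow (hσ : 0 < σ) (a r : ℝ) :
    HasDerivAt (fun r : ℝ => (r ^ 2 + σ ^ 2) ^ a) (2 * r * a * (r ^ 2 + σ ^ 2) ^ (a - 1)) r := by
  have h : HasDerivAt (fun r : ℝ => r ^ 2 + σ ^ 2) (2 * r) r := by
    simpa using (hasDerivAt_pow 2 r).add_const (σ ^ 2)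
  exact h.rpow_const (Or.inl (reg_pos hσ r).ne')

lemma hasDerivAt_regPow (hσ : 0 < σ) (r : ℝ) : HasDerivAt (regPow p σ) (regPowDeriv p σ r) r := by
  have h := hasDerivAt_reg_rpow hσ (p / 2) r
  have e : 2 * r * (p / 2) * (r ^ 2 + σ ^ 2) ^ (p / 2 - 1) = regPowDeriv p σ r := by
    unfold regPowDeriv; ring
  rw [e] at h
  exact h

lemma hasDerivAt_regPowDeriv (hσ : 0 < σ) (r : ℝ) :
    HasDerivAt (regPowDeriv p σ) (regPowDeriv₂ p σ r) r := by
  have h := ((hasDerivAt_id r).const_mul p).mul (hasDerivAt_reg_rpow hσ (p / 2 - 1) r)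
  have e : p * 1 * (r ^ 2 + σ ^ 2) ^ (p / 2 - 1)
      + p * id r * (2 * r * (p / 2 - 1) * (r ^ 2 + σ ^ 2) ^ (p / 2 - 1 - 1)) = regPowDeriv₂ p σ r := by
    unfold regPowDeriv₂
    rw [show p / 2 - 1 - 1 = p / 2 - 2 by ring]
    simp only [id]
    ring
  rw [e] at h
  exact h

lemma continuous_regPow (hσ : 0 < σ) : Continuous (regPow p σ) := continuous_reg_rpow hσ _

lemma continuous_regPowDeriv (hσ : 0 < σ) : Continuous (regPowDeriv p σ) :=
  (continuous_const.mul continuous_id).mul (continuous_reg_rpow hσ _)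

lemma continuous_regPowDeriv₂ (hσ : 0 < σ) : Continuous (regPowDeriv₂ p σ) :=
  (continuous_const.mul (continuous_reg_rpow hσ _)).add
    (continuous_const.mul ((continuous_pow 2).mul (continuous_reg_rpow hσ _)))

lemma regPow_pos (hσ : 0 < σ) (r : ℝ) : 0 < regPow p σ r := Real.rpow_pos_of_pos (reg_pos hσ r) _

lemma regPow_half_sq (hσ : 0 < σ) (r : ℝ) : regPow (p / 2) σ r ^ 2 = regPow p σ r := by
  unfold regPow
  rw [← Real.rpow_natCast, ← Real.rpow_mul (reg_pos hσ r).le]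
  congr 1
  push_cast
  ring

lemma sq_mul_reg_rpow_le (hσ : 0 < σ) (r : ℝ) :
    r ^ 2 * (r ^ 2 + σ ^ 2) ^ (p / 2 - 2) ≤ (r ^ 2 + σ ^ 2) ^ (p / 2 - 1) := by
  have h : (r ^ 2 + σ ^ 2) ^ (p / 2 - 1) = (r ^ 2 + σ ^ 2) * (r ^ 2 + σ ^ 2) ^ (p / 2 - 2) := by
    rw [show p / 2 - 1 = 1 + (p / 2 - 2) by ring, Real.rpow_add (reg_pos hσ r), Real.rpow_one]
  rw [h]
  exact mul_le_mul_of_nonneg_right (by nlinarith) (Real.rpow_nonneg (reg_pos hσ r).le _)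

/-- For `p ≥ 2` the second term of `Φ''` is nonnegative. For `p ≤ 2` it is negative at worst, but
`r²(r²+σ²)^(p/2-2) ≤ (r²+σ²)^(p/2-1)` leaves the factor `p(p-1)`. -/
lemma le_regPowDeriv₂ (hσ : 0 < σ) (hp : 1 < p) (r : ℝ) :
    min 1 (p - 1) * p * (r ^ 2 + σ ^ 2) ^ (p / 2 - 1) ≤ regPowDeriv₂ p σ r := by
  unfold regPowDeriv₂
  have h1 := sq_mul_reg_rpow_le (p := p) hσ r
  have h0 : 0 ≤ r ^ 2 * (r ^ 2 + σ ^ 2) ^ (p / 2 - 2) :=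
    mul_nonneg (sq_nonneg _) (Real.rpow_nonneg (reg_pos hσ r).le _)
  set A := r ^ 2 * (r ^ 2 + σ ^ 2) ^ (p / 2 - 2)
  set ρ := (r ^ 2 + σ ^ 2) ^ (p / 2 - 1)
  have hρ : 0 ≤ ρ := h0.trans h1
  have hp0 : 0 < p := by linarith
  rcases le_total 2 p with h | h
  · have : min 1 (p - 1) * p * ρ ≤ 1 * p * ρ := by gcongr; exact min_le_left _ _
    have h2 : 0 ≤ p * (p - 2) * A := mul_nonneg (mul_nonneg hp0.le (by linarith)) h0
    linarith
  · have : min 1 (p - 1) * p * ρ ≤ (p - 1) * p * ρ := by gcongr; exact min_le_right _ _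
    have h2 : 0 ≤ p * (2 - p) * (ρ - A) := mul_nonneg (mul_nonneg hp0.le (by linarith)) (by linarith)
    nlinarith

/-- Ensures that the gradient of `ψ = Φ^(1/2)` is controlled by the dissipation. -/
lemma regPowDeriv_half_sq_le (hσ : 0 < σ) (r : ℝ) :
    regPowDeriv (p / 2) σ r ^ 2 ≤ p ^ 2 / 4 * (r ^ 2 + σ ^ 2) ^ (p / 2 - 1) := by
  have h : ((r ^ 2 + σ ^ 2) ^ (p / 2 / 2 - 1)) ^ 2 = (r ^ 2 + σ ^ 2) ^ (p / 2 - 2) := by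
    rw [← Real.rpow_natCast, ← Real.rpow_mul (reg_pos hσ r).le]
    congr 1
    push_cast
    ring
  unfold regPowDeriv
  calc (p / 2 * r * (r ^ 2 + σ ^ 2) ^ (p / 2 / 2 - 1)) ^ 2
      = p ^ 2 / 4 * (r ^ 2 * (r ^ 2 + σ ^ 2) ^ (p / 2 - 2)) := by rw [← h]; ring
    _ ≤ _ := mul_le_mul_of_nonneg_left (sq_mul_reg_rpow_le hσ r) (by positivity)

lemma regPowDeriv_sq_le (hσ : 0 < σ) (r : ℝ) :
    regPowDeriv p σ r ^ 2 ≤ p ^ 2 * (regPow p σ r * (r ^ 2 + σ ^ 2) ^ (p / 2 - 1)) := by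
  have hq := reg_pos hσ r
  have h : regPow p σ r = (r ^ 2 + σ ^ 2) * (r ^ 2 + σ ^ 2) ^ (p / 2 - 1) := by
    unfold regPow
    nth_rewrite 2 [← Real.rpow_one (r ^ 2 + σ ^ 2)]
    rw [← Real.rpow_add hq]
    congr 1
    ring
  rw [h]
  unfold regPowDeriv
  have h2 : 0 ≤ ((r ^ 2 + σ ^ 2) ^ (p / 2 - 1)) ^ 2 := sq_nonneg _
  calc (p * r * (r ^ 2 + σ ^ 2) ^ (p / 2 - 1)) ^ 2
      = p ^ 2 * (r ^ 2 * ((r ^ 2 + σ ^ 2) ^ (p / 2 - 1)) ^ 2) := by ring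
    _ ≤ p ^ 2 * ((r ^ 2 + σ ^ 2) * ((r ^ 2 + σ ^ 2) ^ (p / 2 - 1)) ^ 2) := by
        gcongr
        nlinarith
    _ = _ := by ring

/-- The power `1 - 1/p` is the one that pairs, by Hölder, with a source in `L^p`. -/
lemma abs_regPowDeriv_le (hσ : 0 < σ) (hp : 0 < p) (r : ℝ) :
    |regPowDeriv p σ r| ≤ p * regPow p σ r ^ (1 - 1 / p) := by
  have hq := reg_pos hσ r
  have h1 : regPow p σ r ^ (1 - 1 / p) = (r ^ 2 + σ ^ 2) ^ (1 / 2 : ℝ) * (r ^ 2 + σ ^ 2) ^ (p / 2 - 1) := by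
    unfold regPow
    rw [← Real.rpow_mul hq.le, ← Real.rpow_add hq]
    congr 1
    field_simp
    ring
  have h2 : |r| ≤ (r ^ 2 + σ ^ 2) ^ (1 / 2 : ℝ) := by
    rw [← Real.sqrt_eq_rpow]
    exact Real.abs_le_sqrt (by nlinarith)
  rw [h1]
  unfold regPowDeriv
  rw [abs_mul, abs_mul, abs_of_pos hp, abs_of_nonneg (Real.rpow_nonneg hq.le _), mul_assoc]
  gcongr

/-- The pointwise absorption of the drift term. -/
lemma abs_regPowDeriv_mul_le (hσ : 0 < σ) {c₁ c₂ : ℝ} (hc₁ : 0 ≤ c₁) (hc₂ : 0 ≤ c₂)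
    (hc : p ^ 2 ≤ 4 * c₁ * c₂) (r β N : ℝ) :
    |regPowDeriv p σ r| * (|β| * |N|)
      ≤ c₁ * ((r ^ 2 + σ ^ 2) ^ (p / 2 - 1) * N ^ 2) + c₂ * (β ^ 2 * regPow p σ r) := by
  have h := regPowDeriv_sq_le (p := p) hσ r
  have hρ := Real.rpow_nonneg (reg_pos hσ r).le (p / 2 - 1)
  have hΦ := (regPow_pos (p := p) hσ r).le
  set ρ := (r ^ 2 + σ ^ 2) ^ (p / 2 - 1)
  set D := regPowDeriv p σ r
  set F := regPow p σ r
  have ha : 0 ≤ ρ * N ^ 2 := mul_nonneg hρ (sq_nonneg _)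
  have hb : 0 ≤ β ^ 2 * F := mul_nonneg (sq_nonneg _) hΦ
  rw [← abs_mul, ← abs_mul]
  refine abs_le_of_sq_le_sq ?_ (add_nonneg (mul_nonneg hc₁ ha) (mul_nonneg hc₂ hb))
  calc (D * (β * N)) ^ 2 = D ^ 2 * (β ^ 2 * N ^ 2) := by ring
    _ ≤ p ^ 2 * (F * ρ) * (β ^ 2 * N ^ 2) := by gcongr
    _ = p ^ 2 * ((ρ * N ^ 2) * (β ^ 2 * F)) := by ring
    _ ≤ 4 * c₁ * c₂ * ((ρ * N ^ 2) * (β ^ 2 * F)) :=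
        mul_le_mul_of_nonneg_right hc (mul_nonneg ha hb)
    _ ≤ _ := by nlinarith [sq_nonneg (c₁ * (ρ * N ^ 2) - c₂ * (β ^ 2 * F))]

end

lemma IsSobolevSlice.integrable_mul_sq {w : Torus n → ℝ} {V : Torus n → Vec n}
    (h : IsSobolevSlice w V) {a : ℝ → ℝ} (ha : Continuous a) (i : Fin n) :
    Integrable (fun x => a (w x) * V x i ^ 2) volume := by
  obtain ⟨C, -, hC⟩ := continuous_exists_bound (ha.comp h.continuous)
  exact (h.memLp i).integrable_sq.bdd_mul (ha.comp h.continuous).aestronglyMeasurable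
    (Eventually.of_forall hC)

/-- The drift term is absorbed by the diffusion, up to a multiple of the zeroth order term. -/
lemma exists_drift_estimate (hn : 2 ≤ n) {Q : ℝ≥0∞} (hQ : (n : ℝ≥0∞) < Q) {ε p : ℝ} (hε : 0 < ε)
    (hp : 1 < p) :
    ∃ K : ℝ≥0, ∀ (w : Torus n → ℝ) (V : Torus n → Vec n) (β : Torus n → ℝ) (σ : ℝ),
      IsSobolevSlice w V → AEStronglyMeasurable β volume → 0 < σ →
      ∫⁻ x, ‖regPowDeriv p σ (w x)‖ₑ * (‖β x‖ₑ * ‖V x‖ₑ)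
        ≤ ENNReal.ofReal (∑ i, ε * ∫ x, regPowDeriv₂ p σ (w x) * V x i ^ 2)
          + K * (1 + eLpNorm β Q volume ^ (2 / interpExponent n Q))
            * ∫⁻ x, ENNReal.ofReal (regPow p σ (w x)) := by
  set c₀ : ℝ := min 1 (p - 1) with hc₀
  have hc₀0 : 0 < c₀ := lt_min one_pos (by linarith)
  have hp0 : 0 < p := by linarith
  -- `c₁` is half of the dissipation constant `ε c₀ p`, and `c₂` is its partner in Young's
  -- inequality, with `4 c₁ c₂ = p²`.
  set c₁ : ℝ := ε * c₀ * p / 2 with hc₁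
  set c₂ : ℝ := p / (2 * (ε * c₀)) with hc₂
  have hc₁0 : 0 < c₁ := by positivity
  have hc₂0 : 0 < c₂ := by positivity
  have hcc : p ^ 2 ≤ 4 * c₁ * c₂ := by
    rw [hc₁, hc₂]
    have : 4 * (ε * c₀ * p / 2) * (p / (2 * (ε * c₀))) = p ^ 2 := by field_simp; norm_num
    rw [this]
  -- With this `d` the gradient term of the interpolation costs `c₂ · d · p²/4 = c₁`, the other half
  -- of the dissipation.
  set d : ℝ := c₁ / (c₂ * (p ^ 2 / 4)) with hd
  have hd0 : 0 < d := by positivity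
  obtain ⟨K, hK⟩ := exists_slice_estimate hn hQ (δ := d.toNNReal) (Real.toNNReal_pos.2 hd0)
  refine ⟨c₂.toNNReal * K, fun w V β σ h hβ hσ => ?_⟩
  have hpow := fun a : ℝ => continuous_reg_rpow hσ a
  have hS := hK w V (regPow (p / 2) σ) (regPowDeriv (p / 2) σ) β h (fun a => hasDerivAt_regPow hσ a)
    (continuous_regPowDeriv hσ) (fun a => regPow_pos hσ a) hβ
  have hsq : ∀ x, ENNReal.ofReal (regPow (p / 2) σ (w x)) ^ (2 : ℝ)
      = ENNReal.ofReal (regPow p σ (w x)) := by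
    intro x
    rw [← abs_of_pos (regPow_pos (p := p / 2) hσ (w x)), ofReal_abs_rpow_two, regPow_half_sq hσ]
  simp_rw [hsq] at hS
  set B := eLpNorm β Q volume ^ (2 / interpExponent n Q)
  set Y := ∫⁻ x, ENNReal.ofReal (regPow p σ (w x))
  let I : Fin n → ℝ := fun i => ∫ x, (w x ^ 2 + σ ^ 2) ^ (p / 2 - 1) * V x i ^ 2
  have hIi : ∀ i, Integrable (fun x => (w x ^ 2 + σ ^ 2) ^ (p / 2 - 1) * V x i ^ 2) volume := fun i =>
    h.integrable_mul_sq (hpow (p / 2 - 1)) i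
  have hI0 : ∀ i, 0 ≤ I i := fun i => integral_nonneg fun x =>
    mul_nonneg (Real.rpow_nonneg (reg_pos hσ _).le _) (sq_nonneg _)
  have hIS : 0 ≤ ∑ i, I i := Finset.sum_nonneg fun i _ => hI0 i
  -- the gradient of the half power
  have hgrad : ∑ i, ∫⁻ x, ENNReal.ofReal |regPowDeriv (p / 2) σ (w x) * V x i| ^ (2 : ℝ)
      ≤ ENNReal.ofReal (p ^ 2 / 4 * ∑ i, I i) := by
    rw [Finset.mul_sum, ENNReal.ofReal_sum_of_nonneg fun i _ => mul_nonneg (by positivity) (hI0 i)]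
    refine Finset.sum_le_sum fun i _ => ?_
    simp_rw [ofReal_abs_rpow_two]
    simp only [I]
    rw [← integral_const_mul, ofReal_integral_eq_lintegral_ofReal ((hIi i).const_mul _)
      (Eventually.of_forall fun x => mul_nonneg (by positivity)
        (mul_nonneg (Real.rpow_nonneg (reg_pos hσ _).le _) (sq_nonneg _)))]
    refine lintegral_mono fun x => ENNReal.ofReal_le_ofReal ?_
    rw [mul_pow, ← mul_assoc]
    exact mul_le_mul_of_nonneg_right (regPowDeriv_half_sq_le hσ _) (sq_nonneg _)
  have hlow : ε * c₀ * p * ∑ i, I i ≤ ∑ i, ε * ∫ x, regPowDeriv₂ p σ (w x) * V x i ^ 2 := by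
    rw [Finset.mul_sum]
    refine Finset.sum_le_sum fun i _ => ?_
    rw [mul_assoc, mul_assoc]
    refine mul_le_mul_of_nonneg_left ?_ hε.le
    simp only [I]
    rw [← integral_const_mul, ← integral_const_mul]
    refine integral_mono (((hIi i).const_mul _).const_mul _)
      (h.integrable_mul_sq (continuous_regPowDeriv₂ hσ) i) fun x => ?_
    rw [← mul_assoc, ← mul_assoc]
    exact mul_le_mul_of_nonneg_right (le_regPowDeriv₂ hσ hp _) (sq_nonneg _)
  have hnorm : ∀ x, ‖V x‖ ^ 2 = ∑ i, V x i ^ 2 := fun x => EuclideanSpace.real_norm_sq_eq (V x)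
  have hint : Integrable (fun x => c₁ * ((w x ^ 2 + σ ^ 2) ^ (p / 2 - 1) * ‖V x‖ ^ 2)) volume := by
    refine Integrable.const_mul ?_ _
    simp_rw [hnorm, Finset.mul_sum]
    exact integrable_finsetSum _ fun i _ => hIi i
  have hintI : ∫ x, c₁ * ((w x ^ 2 + σ ^ 2) ^ (p / 2 - 1) * ‖V x‖ ^ 2) = c₁ * ∑ i, I i := by
    rw [integral_const_mul]
    congr 1
    simp_rw [hnorm, Finset.mul_sum]
    rw [integral_finsetSum _ fun i _ => hIi i]
  have hpt : ∀ x, ‖regPowDeriv p σ (w x)‖ₑ * (‖β x‖ₑ * ‖V x‖ₑ)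
      ≤ ENNReal.ofReal (c₁ * ((w x ^ 2 + σ ^ 2) ^ (p / 2 - 1) * ‖V x‖ ^ 2))
        + ENNReal.ofReal c₂ * (‖β x‖ₑ ^ (2 : ℝ) * ENNReal.ofReal (regPow p σ (w x))) := by
    intro x
    have := abs_regPowDeriv_mul_le hσ hc₁0.le hc₂0.le hcc (w x) (β x) ‖V x‖
    have hΦ := (regPow_pos (p := p) hσ (w x)).le
    rw [Real.enorm_eq_ofReal_abs, Real.enorm_eq_ofReal_abs, ← enorm_norm (V x),
      Real.enorm_eq_ofReal_abs, ofReal_abs_rpow_two, ← ENNReal.ofReal_mul (abs_nonneg _),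
      ← ENNReal.ofReal_mul (abs_nonneg _), ← ENNReal.ofReal_mul (sq_nonneg _),
      ← ENNReal.ofReal_mul hc₂0.le, ← ENNReal.ofReal_add]
    · exact ENNReal.ofReal_le_ofReal this
    · exact mul_nonneg hc₁0.le (mul_nonneg (Real.rpow_nonneg (reg_pos hσ _).le _) (sq_nonneg _))
    · exact mul_nonneg hc₂0.le (mul_nonneg (sq_nonneg _) hΦ)
  calc ∫⁻ x, ‖regPowDeriv p σ (w x)‖ₑ * (‖β x‖ₑ * ‖V x‖ₑ)
      ≤ ∫⁻ x, (ENNReal.ofReal (c₁ * ((w x ^ 2 + σ ^ 2) ^ (p / 2 - 1) * ‖V x‖ ^ 2))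
        + ENNReal.ofReal c₂ * (‖β x‖ₑ ^ (2 : ℝ) * ENNReal.ofReal (regPow p σ (w x)))) :=
        lintegral_mono hpt
    _ = ENNReal.ofReal (c₁ * ∑ i, I i)
        + ENNReal.ofReal c₂ * ∫⁻ x, ‖β x‖ₑ ^ (2 : ℝ) * ENNReal.ofReal (regPow p σ (w x)) := by
        rw [lintegral_add_left' hint.aestronglyMeasurable.aemeasurable.ennreal_ofReal,
          ← ofReal_integral_eq_lintegral_ofReal hint, hintI, lintegral_const_mul'']
        · exact (hβ.enorm.pow_const _).mul
            ((continuous_regPow hσ).comp h.continuous).measurable.ennreal_ofReal.aemeasurable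
        · exact Eventually.of_forall fun x => mul_nonneg hc₁0.le
            (mul_nonneg (Real.rpow_nonneg (reg_pos hσ _).le _) (sq_nonneg _))
    _ ≤ ENNReal.ofReal (c₁ * ∑ i, I i)
        + ENNReal.ofReal c₂ * (d.toNNReal * ENNReal.ofReal (p ^ 2 / 4 * ∑ i, I i)
          + K * (1 + B) * Y) :=
        add_le_add le_rfl (mul_le_mul_right (hS.trans (add_le_add (mul_le_mul_right hgrad _) le_rfl)) _)
    _ = (ENNReal.ofReal (c₁ * ∑ i, I i) + ENNReal.ofReal c₂ * (ENNReal.ofReal d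
          * ENNReal.ofReal (p ^ 2 / 4 * ∑ i, I i))) + (c₂.toNNReal * K : ℝ≥0) * (1 + B) * Y := by
        rw [ENNReal.coe_mul]
        simp only [ENNReal.ofReal]
        ring
    _ ≤ _ := by
        refine add_le_add ?_ le_rfl
        rw [← ENNReal.ofReal_mul hd0.le, ← ENNReal.ofReal_mul hc₂0.le, ← ENNReal.ofReal_add]
        · refine ENNReal.ofReal_le_ofReal (le_trans (le_of_eq ?_) hlow)
          have e : c₂ * (d * (p ^ 2 / 4 * ∑ i, I i)) = c₁ * ∑ i, I i := by
            rw [hd]; field_simp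
          rw [e, hc₁]; ring
        · exact mul_nonneg hc₁0.le hIS
        · exact mul_nonneg hc₂0.le (mul_nonneg hd0.le (mul_nonneg (by positivity) hIS))

/-! ### The differential inequality for the regularised norm -/

/-- The growth rate of the `L^p` norm caused by the family of drifts `β (θ, ·)`, `θ ∈ [0,1]`. -/
def driftRate (Q : ℝ≥0∞) (β : ℝ × Torus n → ℝ) : ℝ≥0∞ :=
  ∫⁻ θ in Icc (0 : ℝ) 1,
    (1 + eLpNorm (fun x => β (θ, x)) Q volume ^ (2 / interpExponent n Q))

/-- The bound `|Φ'| ≤ pΦ^(1-1/p)`, followed by Hölder with weights `1 - 1/p` and `1/p`. -/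
lemma lintegral_regPowDeriv_mul_le {P : ℝ≥0∞} (hP : 1 < P) (hP' : P < ⊤) {σ : ℝ} (hσ : 0 < σ)
    {w f : Torus n → ℝ} (hw : Continuous w) (hf : AEStronglyMeasurable f volume) :
    ∫⁻ x, ‖regPowDeriv P.toReal σ (w x)‖ₑ * ‖f x‖ₑ
      ≤ ENNReal.ofReal P.toReal * eLpNorm f P volume
        * (∫⁻ x, ENNReal.ofReal (regPow P.toReal σ (w x))) ^ (1 - 1 / P.toReal) := by
  set p := P.toReal with hp
  have hp1 : 1 < p := by
    rw [hp, ← ENNReal.toReal_one]; exact (ENNReal.toReal_lt_toReal (by simp) hP'.ne).2 hP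
  have hp0 : 0 < p := by linarith
  have hq : 0 ≤ 1 - 1 / p := by
    rw [sub_nonneg, div_le_one hp0]; exact hp1.le
  have hm : Measurable fun x => ENNReal.ofReal (regPow p σ (w x)) :=
    ((continuous_regPow hσ).comp hw).measurable.ennreal_ofReal
  have hh := ENNReal.lintegral_mul_norm_pow_le (μ := (volume : Measure (Torus n)))
    (f := fun x => ENNReal.ofReal (regPow p σ (w x))) (g := fun x => ‖f x‖ₑ ^ p)
    hm.aemeasurable (hf.enorm.pow_const p) hq (by positivity : 0 ≤ 1 / p) (by ring)
  rw [eLpNorm_eq_lintegral_rpow_enorm_toReal (by rintro rfl; simp at hP) hP'.ne, ← hp]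
  calc ∫⁻ x, ‖regPowDeriv p σ (w x)‖ₑ * ‖f x‖ₑ
      ≤ ∫⁻ x, ENNReal.ofReal p * (ENNReal.ofReal (regPow p σ (w x)) ^ (1 - 1 / p)
          * (‖f x‖ₑ ^ p) ^ (1 / p)) := by
        refine lintegral_mono fun x => ?_
        rw [← ENNReal.rpow_mul, mul_one_div_cancel hp0.ne', ENNReal.rpow_one, ← mul_assoc]
        refine mul_le_mul_left ?_ _
        rw [Real.enorm_eq_ofReal_abs, ENNReal.ofReal_rpow_of_pos (regPow_pos hσ _),
          ← ENNReal.ofReal_mul hp0.le]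
        exact ENNReal.ofReal_le_ofReal (abs_regPowDeriv_le hσ hp0 _)
    _ = ENNReal.ofReal p * ∫⁻ x, (ENNReal.ofReal (regPow p σ (w x)) ^ (1 - 1 / p)
          * (‖f x‖ₑ ^ p) ^ (1 / p)) := lintegral_const_mul' _ _ ENNReal.ofReal_ne_top
    _ ≤ ENNReal.ofReal p * _ := mul_le_mul_right hh _
    _ = _ := by ring

lemma regPowDeriv₂_nonneg {p σ : ℝ} (hσ : 0 < σ) (hp : 1 < p) (r : ℝ) : 0 ≤ regPowDeriv₂ p σ r :=
  le_trans (by have := le_min one_pos.le (sub_pos.2 hp).le; have := reg_pos hσ r; positivity)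
    (le_regPowDeriv₂ hσ hp r)

/-- For each `θ` the drift is absorbed by the whole dissipation `E`. Since `[0,1]` has measure one,
averaging over `θ` still costs only one copy of `E`, which cancels against the dissipation in the
energy identity. -/
lemma exists_dissipation_estimate (hn : 2 ≤ n) {P Q : ℝ≥0∞} (hP : 1 < P) (hP' : P < ⊤)
    (hQ : (n : ℝ≥0∞) < Q) {ε : ℝ} (hε : 0 < ε) :
    ∃ K : ℝ≥0, ∀ (w : Torus n → ℝ) (V : Torus n → Vec n) (β : ℝ × Torus n → ℝ)
      (f G : Torus n → ℝ) (σ : ℝ), IsSobolevSlice w V → Measurable V → Measurable β →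
      AEStronglyMeasurable f volume →
      (∀ᵐ x, ‖G x‖ₑ ≤ (∫⁻ θ in Icc (0 : ℝ) 1, ‖β (θ, x)‖ₑ * ‖V x‖ₑ) + ‖f x‖ₑ) → 0 < σ →
      ENNReal.ofReal (-((∑ i, ε * ∫ x, regPowDeriv₂ P.toReal σ (w x) * V x i ^ 2)
          + ∫ x, regPowDeriv P.toReal σ (w x) * G x))
        ≤ K * driftRate Q β * (∫⁻ x, ENNReal.ofReal (regPow P.toReal σ (w x)))
          + ENNReal.ofReal P.toReal * eLpNorm f P volume
            * (∫⁻ x, ENNReal.ofReal (regPow P.toReal σ (w x))) ^ (1 - 1 / P.toReal) := by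
  have hp1 : 1 < P.toReal := by
    rw [← ENNReal.toReal_one]; exact (ENNReal.toReal_lt_toReal (by simp) hP'.ne).2 hP
  obtain ⟨K, hK⟩ := exists_drift_estimate hn hQ hε hp1
  refine ⟨K, fun w V β f G σ h hV hβ hf hG hσ => ?_⟩
  set p := P.toReal with hp
  set E : ℝ := ∑ i, ε * ∫ x, regPowDeriv₂ p σ (w x) * V x i ^ 2 with hE
  set Y := ∫⁻ x, ENNReal.ofReal (regPow p σ (w x)) with hY
  have hE0 : 0 ≤ E := Finset.sum_nonneg fun i _ => mul_nonneg hε.le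
    (integral_nonneg fun x => mul_nonneg (regPowDeriv₂_nonneg hσ hp1 _) (sq_nonneg _))
  have hmd : Measurable fun x => ‖regPowDeriv p σ (w x)‖ₑ :=
    ((continuous_regPowDeriv hσ).comp h.continuous).measurable.enorm
  have hdrift : ∫⁻ x, ‖regPowDeriv p σ (w x)‖ₑ * ∫⁻ θ in Icc (0 : ℝ) 1, ‖β (θ, x)‖ₑ * ‖V x‖ₑ
      ≤ ENNReal.ofReal E + K * driftRate Q β * Y := by
    have hm : Measurable fun q : Torus n × ℝ =>
        ‖regPowDeriv p σ (w q.1)‖ₑ * (‖β (q.2, q.1)‖ₑ * ‖V q.1‖ₑ) :=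
      (hmd.comp measurable_fst).mul
        ((hβ.comp measurable_swap).enorm.mul (hV.comp measurable_fst).enorm)
    calc _ = ∫⁻ x, ∫⁻ θ in Icc (0 : ℝ) 1,
          ‖regPowDeriv p σ (w x)‖ₑ * (‖β (θ, x)‖ₑ * ‖V x‖ₑ) :=
          lintegral_congr fun x => (lintegral_const_mul' _ _ enorm_ne_top).symm
      _ = ∫⁻ θ in Icc (0 : ℝ) 1, ∫⁻ x,
          ‖regPowDeriv p σ (w x)‖ₑ * (‖β (θ, x)‖ₑ * ‖V x‖ₑ) :=
          lintegral_lintegral_swap hm.aemeasurable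
      _ ≤ ∫⁻ θ in Icc (0 : ℝ) 1, (ENNReal.ofReal E
          + K * (1 + eLpNorm (fun x => β (θ, x)) Q volume ^ (2 / interpExponent n Q)) * Y) :=
          lintegral_mono fun θ => hK w V (fun x => β (θ, x)) σ h
            (hβ.comp measurable_prodMk_left).aestronglyMeasurable hσ
      _ = _ := by
          have m1 : Measurable fun θ : ℝ =>
              1 + eLpNorm (fun x => β (θ, x)) Q volume ^ (2 / interpExponent n Q) :=
            ((measurable_eLpNorm_slice hβ Q).pow_const _).const_add 1
          rw [lintegral_add_left measurable_const, lintegral_mul_const _ (m1.const_mul _),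
            lintegral_const_mul _ m1]
          simp [driftRate]
  have hsource := lintegral_regPowDeriv_mul_le hP hP' hσ h.continuous hf
  rw [← hp, ← hY] at hsource
  have hI : ENNReal.ofReal |∫ x, regPowDeriv p σ (w x) * G x|
      ≤ ENNReal.ofReal E + (K * driftRate Q β * Y
        + ENNReal.ofReal p * eLpNorm f P volume * Y ^ (1 - 1 / p)) := by
    rw [← Real.enorm_eq_ofReal_abs]
    calc _ ≤ ∫⁻ x, ‖regPowDeriv p σ (w x) * G x‖ₑ := enorm_integral_le_lintegral_enorm _
      _ ≤ ∫⁻ x, (‖regPowDeriv p σ (w x)‖ₑ * (∫⁻ θ in Icc (0 : ℝ) 1, ‖β (θ, x)‖ₑ * ‖V x‖ₑ)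
          + ‖regPowDeriv p σ (w x)‖ₑ * ‖f x‖ₑ) := by
          refine lintegral_mono_ae ?_
          filter_upwards [hG] with x hx
          rw [enorm_mul, ← mul_add]
          exact mul_le_mul_right hx _
      _ = _ := lintegral_add_right' _ (hmd.aemeasurable.mul hf.enorm)
      _ ≤ _ := by
          rw [← add_assoc]
          exact add_le_add hdrift hsource
  calc _ ≤ ENNReal.ofReal (|∫ x, regPowDeriv p σ (w x) * G x| - E) :=
        ENNReal.ofReal_le_ofReal (by
          have := neg_abs_le (∫ x, regPowDeriv p σ (w x) * G x); linarith)
    _ ≤ _ := by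
        rw [ENNReal.ofReal_sub _ hE0]
        exact tsub_le_iff_left.2 hI

/-- No integrability is needed: the Bochner integral of a non-integrable function is `0`. -/
lemma ofReal_integral_le_lintegral {X : Type*} [MeasurableSpace X] {μ : Measure X} (f : X → ℝ) :
    ENNReal.ofReal (∫ x, f x ∂μ) ≤ ∫⁻ x, ENNReal.ofReal (f x) ∂μ := by
  by_cases hf : Integrable f μ
  · rw [integral_eq_lintegral_pos_part_sub_lintegral_neg_part hf]
    exact (ENNReal.ofReal_le_ofReal (sub_le_self _ ENNReal.toReal_nonneg)).trans
      ENNReal.ofReal_toReal_le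
  · simp [integral_undef hf]

/-- The integrated differential inequality for the regularised `L^p` norm. -/
lemma exists_energy_inequality (hn : 2 ≤ n) {P Q : ℝ≥0∞} (hP : 1 < P) (hP' : P < ⊤)
    (hQ : (n : ℝ≥0∞) < Q) {ε : ℝ} (hε : 0 < ε) :
    ∃ K : ℝ≥0, ∀ (T : ℝ) (w : Torus n × ℝ → ℝ) (V : Torus n × ℝ → Vec n) (G f : Torus n × ℝ → ℝ)
      (b : ℝ × (Torus n × ℝ) → ℝ), IsLinearSolution T ε w V G → Measurable b → Measurable f →
      (∀ᵐ z ∂(cylMeasure n T),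
        ‖G z‖ₑ ≤ (∫⁻ θ in Icc (0 : ℝ) 1, ‖b (θ, z)‖ₑ * ‖V z‖ₑ) + ‖f z‖ₑ) →
      ∀ σ s t : ℝ, 0 < σ → 0 < s → s ≤ t → t < T →
        ENNReal.ofReal (∫ x, regPow P.toReal σ (w (x, s)))
          ≤ ENNReal.ofReal (∫ x, regPow P.toReal σ (w (x, t)))
            + ∫⁻ τ in Ioc s t, (K * driftRate Q (fun q : ℝ × Torus n => b (q.1, (q.2, τ)))
                * ENNReal.ofReal (∫ x, regPow P.toReal σ (w (x, τ)))
              + ENNReal.ofReal P.toReal * eLpNorm (fun x => f (x, τ)) P volume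
                * ENNReal.ofReal (∫ x, regPow P.toReal σ (w (x, τ))) ^ (1 - 1 / P.toReal)) := by
  obtain ⟨K, hK⟩ := exists_dissipation_estimate hn hP hP' hQ hε
  refine ⟨K, fun T w V G f b h hb hf hG σ s t hσ hs hst ht => ?_⟩
  set p := P.toReal with hp
  have hsub : Ioc s t ⊆ Ioo 0 T := fun τ hτ => ⟨hs.trans hτ.1, hτ.2.trans_lt ht⟩
  have he := h.energy (fun r => hasDerivAt_regPow (p := p) hσ r) (fun r => hasDerivAt_regPowDeriv hσ r)
    (continuous_regPowDeriv₂ hσ) hs hst ht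
  have e : ∫ x, regPow p σ (w (x, s)) = (∫ x, regPow p σ (w (x, t)))
      + ∫ τ in Ioc s t, -((∑ i, ε * ∫ y, regPowDeriv₂ p σ (w (y, τ)) * V (y, τ) i ^ 2)
        + ∫ y, regPowDeriv p σ (w (y, τ)) * G (y, τ)) := by
    rw [integral_neg, ← he]; ring
  rw [e]
  refine ENNReal.ofReal_add_le.trans (add_le_add le_rfl
    ((ofReal_integral_le_lintegral _).trans (lintegral_mono_ae ?_)))
  have a1 := ae_restrict_of_ae_restrict_of_subset hsub (ae_ae_cylMeasure hG)
  have a2 := ae_restrict_of_ae_restrict_of_subset hsub h.ae_integrable_comp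
  have a3 := ae_restrict_of_ae_restrict_of_subset hsub h.weakGrad
  filter_upwards [a1, a2, a3] with τ h1 h2 h3
  have hc := h.continuous_slice τ
  have hY : ENNReal.ofReal (∫ x, regPow p σ (w (x, τ)))
      = ∫⁻ x, ENNReal.ofReal (regPow p σ (w (x, τ))) :=
    ofReal_integral_eq_lintegral_ofReal
      (Continuous.integrable_torus ((continuous_regPow hσ).comp hc))
      (Eventually.of_forall fun x => (regPow_pos hσ _).le)
  rw [hY]
  exact hK (fun x => w (x, τ)) (fun x => V (x, τ)) (fun q => b (q.1, (q.2, τ))) (fun x => f (x, τ))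
    (fun x => G (x, τ)) σ ⟨hc, h3, h2⟩ (h.stronglyMeasurable_grad.measurable.comp measurable_prodMk_right)
    (hb.comp (by fun_prop)) (hf.comp measurable_prodMk_right).aestronglyMeasurable h1 hσ

/-! ### A nonlinear Gronwall inequality -/

/-- The integrand is `-1/2` times the a.e. derivative of `exp(2∫_τ^t a)`; as `a` is merely
integrable, the chain rule for absolutely continuous functions is used. -/
lemma integral_mul_exp_tail {a : ℝ → ℝ} {r t : ℝ} (hrt : r ≤ t) (ha : IntervalIntegrable a volume r t) :
    ∫ τ in r..t, a τ * Real.exp (2 * ∫ x in τ..t, a x)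
      = (Real.exp (2 * ∫ x in r..t, a x) - 1) / 2 := by
  have hsub : ∀ τ ∈ Icc r t, IntervalIntegrable a volume r τ := fun τ hτ =>
    ha.mono_set (by rw [uIcc_of_le hrt, uIcc_of_le hτ.1]; exact Icc_subset_Icc_right hτ.2)
  have h := integral_chain_rule (W := fun τ => ∫ x in τ..t, a x) (A := fun τ => -a τ)
    (Φ := fun x => Real.exp (2 * x)) (Φ' := fun x => Real.exp (2 * x) * 2) hrt ha.neg
    (fun τ hτ => by
      rw [intervalIntegral.integral_neg,
        ← intervalIntegral.integral_interval_sub_left ha (hsub τ hτ)]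
      ring)
    (fun x => by simpa using ((hasDerivAt_id x).const_mul 2).exp) (by fun_prop)
  have e : ∫ τ in r..t, Real.exp (2 * ∫ x in τ..t, a x) * 2 * -a τ
      = -2 * ∫ τ in r..t, a τ * Real.exp (2 * ∫ x in τ..t, a x) := by
    rw [← intervalIntegral.integral_const_mul]
    congr 1; ext τ; ring
  rw [e] at h
  simp only [intervalIntegral.integral_same, mul_zero, Real.exp_zero] at h
  linarith

/-- A backward Gronwall inequality with a linear and a sublinear term. -/
lemma gronwall_rpow {p s t : ℝ} (hp : 1 ≤ p) (hst : s ≤ t) {a F y : ℝ → ℝ} (ha0 : ∀ τ, 0 ≤ a τ)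
    (hF0 : ∀ τ, 0 ≤ F τ) (ha : IntervalIntegrable a volume s t) (hF : IntervalIntegrable F volume s t)
    (hy : Continuous y) (hy0 : ∀ τ, 0 ≤ y τ)
    (h : ∀ r ∈ Icc s t, y r ≤ y t + ∫ τ in r..t, (a τ * y τ + p * F τ * y τ ^ (1 - 1 / p))) :
    y s ^ (1 / p) ≤ 2 * Real.exp (2 * (∫ τ in s..t, a τ) / p)
      * (y t ^ (1 / p) + p * ∫ τ in s..t, F τ) := by
  have hp0 : 0 < p := by linarith
  have hq : 0 ≤ 1 - 1 / p := by rw [sub_nonneg, div_le_one hp0]; exact hp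
  set A : ℝ → ℝ := fun r => ∫ τ in r..t, a τ with hA
  have hsubL : ∀ r ∈ Icc s t, IntervalIntegrable a volume s r := fun r hr =>
    ha.mono_set (by rw [uIcc_of_le hst, uIcc_of_le hr.1]; exact Icc_subset_Icc_right hr.2)
  have hsub : ∀ {g : ℝ → ℝ}, IntervalIntegrable g volume s t → ∀ r ∈ Icc s t,
      IntervalIntegrable g volume r t := fun hg r hr =>
    hg.mono_set (by rw [uIcc_of_le hst, uIcc_of_le hr.2]; exact Icc_subset_Icc_left hr.1)
  have hAc : ContinuousOn A (Icc s t) := by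
    have h1 : ContinuousOn (fun r => (∫ τ in s..t, a τ) - ∫ τ in s..r, a τ) (Icc s t) := by
      refine continuousOn_const.sub ?_
      have := intervalIntegral.continuousOn_primitive_interval (a := s) (b := t) (f := a) (μ := volume)
        (by rw [uIcc_of_le hst]; exact (intervalIntegrable_iff_integrableOn_Icc_of_le hst).1 ha)
      rwa [uIcc_of_le hst] at this
    refine h1.congr fun r hr => ?_
    rw [hA]
    exact (intervalIntegral.integral_interval_sub_left ha (hsubL r hr)).symm
  have hA0 : ∀ r ∈ Icc s t, 0 ≤ A r := fun r hr =>
    intervalIntegral.integral_nonneg hr.2 fun τ _ => ha0 τ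
  have hAmono : ∀ r ∈ Icc s t, ∀ τ ∈ Icc r t, A τ ≤ A r := by
    intro r hr τ hτ
    have h1 := intervalIntegral.integral_add_adjacent_intervals
      (((hsub ha r hr)).mono_set (c := r) (d := τ)
        (by rw [uIcc_of_le hr.2, uIcc_of_le hτ.1]; exact Icc_subset_Icc_right hτ.2))
      (hsub ha τ ⟨hr.1.trans hτ.1, hτ.2⟩)
    have h2 : 0 ≤ ∫ x in r..τ, a x := intervalIntegral.integral_nonneg hτ.1 fun x _ => ha0 x
    simp only [hA]
    linarith
  -- Take `r` maximising `y e^{-2A}`, and let `X = y r`. The weight `2` makes the linear term on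
  -- `[r,t]` contribute at most `X/2`, which is absorbed; also `y ≤ X` on `[r,t]`, so `X^(1-1/p)`
  -- factors out of the sublinear term.
  obtain ⟨r, hr, hmax⟩ := isCompact_Icc.exists_isMaxOn (nonempty_Icc.2 hst)
    ((hy.continuousOn).mul ((continuousOn_const.mul hAc).rexp :
      ContinuousOn (fun r => Real.exp (-2 * A r)) (Icc s t)))
  set K : ℝ := y r * Real.exp (-2 * A r) with hK
  have hle : ∀ τ ∈ Icc s t, y τ ≤ K * Real.exp (2 * A τ) := by
    intro τ hτ
    have h1 : y τ * Real.exp (-2 * A τ) ≤ K := hmax hτ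
    calc y τ = y τ * Real.exp (-2 * A τ) * Real.exp (2 * A τ) := by
          rw [mul_assoc, ← Real.exp_add]; simp
      _ ≤ _ := by gcongr
  have hK0 : 0 ≤ K := mul_nonneg (hy0 r) (Real.exp_pos _).le
  set X : ℝ := y r with hX
  have hKX : K * Real.exp (2 * A r) = X := by
    rw [hK, mul_assoc, ← Real.exp_add]; simp
  have hKleX : K ≤ X := by
    rw [← hKX]
    exact le_mul_of_one_le_right hK0 (Real.one_le_exp (by have := hA0 r hr; linarith))
  have hyt : y t ≤ X := by
    have := hle t (right_mem_Icc.2 hst)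
    simp only [hA, intervalIntegral.integral_same, mul_zero, Real.exp_zero, mul_one] at this
    exact this.trans hKleX
  have hyX : ∀ τ ∈ Icc r t, y τ ≤ X := fun τ hτ => by
    refine (hle τ ⟨hr.1.trans hτ.1, hτ.2⟩).trans ?_
    rw [← hKX]
    gcongr
    exact hAmono r hr τ hτ
  have hAcr : ContinuousOn A (uIcc r t) := by
    rw [uIcc_of_le hr.2]; exact hAc.mono (Icc_subset_Icc_left hr.1)
  have i1 : IntervalIntegrable (fun τ => a τ * y τ) volume r t :=
    (hsub ha r hr).mul_continuousOn hy.continuousOn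
  have i2 : IntervalIntegrable (fun τ => p * F τ * y τ ^ (1 - 1 / p)) volume r t :=
    ((hsub hF r hr).const_mul p).mul_continuousOn
      (hy.rpow_const fun _ => Or.inr hq).continuousOn
  have b1 : ∫ τ in r..t, a τ * y τ ≤ X / 2 := by
    have i3 : IntervalIntegrable (fun τ => a τ * Real.exp (2 * A τ)) volume r t :=
      (hsub ha r hr).mul_continuousOn ((continuousOn_const.mul hAcr).rexp)
    calc ∫ τ in r..t, a τ * y τ ≤ ∫ τ in r..t, K * (a τ * Real.exp (2 * A τ)) := by
          refine intervalIntegral.integral_mono_on hr.2 i1 (i3.const_mul K) fun τ hτ => ?_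
          have := hle τ ⟨hr.1.trans hτ.1, hτ.2⟩
          have := ha0 τ
          calc a τ * y τ ≤ a τ * (K * Real.exp (2 * A τ)) := by gcongr
            _ = _ := by ring
      _ = K * ((Real.exp (2 * A r) - 1) / 2) := by
          rw [intervalIntegral.integral_const_mul, integral_mul_exp_tail hr.2 (hsub ha r hr)]
      _ ≤ X / 2 := by rw [← hKX]; nlinarith
  have b2 : ∫ τ in r..t, p * F τ * y τ ^ (1 - 1 / p)
      ≤ X ^ (1 - 1 / p) * (p * ∫ τ in s..t, F τ) := by
    calc ∫ τ in r..t, p * F τ * y τ ^ (1 - 1 / p)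
        ≤ ∫ τ in r..t, X ^ (1 - 1 / p) * (p * F τ) := by
          refine intervalIntegral.integral_mono_on hr.2 i2 (((hsub hF r hr).const_mul p).const_mul _)
            fun τ hτ => ?_
          rw [mul_comm]
          have := hF0 τ
          exact mul_le_mul_of_nonneg_right (Real.rpow_le_rpow (hy0 τ) (hyX τ hτ) hq) (by positivity)
      _ = X ^ (1 - 1 / p) * (p * ∫ τ in r..t, F τ) := by
          rw [intervalIntegral.integral_const_mul, intervalIntegral.integral_const_mul]
      _ ≤ _ := by
          have hX0 : 0 ≤ X := hy0 r
          have : ∫ τ in r..t, F τ ≤ ∫ τ in s..t, F τ :=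
            intervalIntegral.integral_mono_interval hr.1 hr.2 le_rfl
              (Eventually.of_forall hF0) hF
          gcongr
  have key : X ≤ 2 * X ^ (1 - 1 / p) * (y t ^ (1 / p) + p * ∫ τ in s..t, F τ) := by
    have h1 := h r hr
    rw [intervalIntegral.integral_add i1 i2] at h1
    have h2 : y t ≤ X ^ (1 - 1 / p) * y t ^ (1 / p) := by
      calc y t = y t ^ (1 - 1 / p) * y t ^ (1 / p) := by
            rw [← Real.rpow_add_of_nonneg (hy0 t) hq (by positivity)]; simp
        _ ≤ _ := by
            have := Real.rpow_nonneg (hy0 t) (1 / p)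
            exact mul_le_mul_of_nonneg_right (Real.rpow_le_rpow (hy0 t) hyt hq) this
    have : X ≤ y t + (X / 2 + X ^ (1 - 1 / p) * (p * ∫ τ in s..t, F τ)) :=
      h1.trans (add_le_add le_rfl (add_le_add b1 b2))
    linarith
  have hS0 : 0 ≤ y t ^ (1 / p) + p * ∫ τ in s..t, F τ :=
    add_nonneg (Real.rpow_nonneg (hy0 t) _)
      (mul_nonneg hp0.le (intervalIntegral.integral_nonneg hst fun τ _ => hF0 τ))
  have hXp : X ^ (1 / p) ≤ 2 * (y t ^ (1 / p) + p * ∫ τ in s..t, F τ) := by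
    -- Dividing by `X^(1-1/p)` requires `X > 0`; for `X = 0` the bound is trivial.
    rcases (hy0 r).eq_or_lt with h0 | h0
    · rw [hX, ← h0, Real.zero_rpow (by positivity)]
      positivity
    · have hpos : 0 < X ^ (1 - 1 / p) := Real.rpow_pos_of_pos h0 _
      have e : X = X ^ (1 - 1 / p) * X ^ (1 / p) := by
        rw [← Real.rpow_add h0, sub_add_cancel, Real.rpow_one]
      refine le_of_mul_le_mul_left ?_ hpos
      rw [← e]
      linarith
  calc y s ^ (1 / p) ≤ (X * Real.exp (2 * A s)) ^ (1 / p) := by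
        refine Real.rpow_le_rpow (hy0 s) ((hle s (left_mem_Icc.2 hst)).trans ?_) (by positivity)
        gcongr
    _ = X ^ (1 / p) * Real.exp (2 * A s / p) := by
        rw [Real.mul_rpow (hy0 r) (Real.exp_pos _).le, ← Real.exp_mul]
        congr 2; ring
    _ ≤ 2 * (y t ^ (1 / p) + p * ∫ τ in s..t, F τ) * Real.exp (2 * A s / p) := by gcongr
    _ = _ := by ring

/-- The Gronwall inequality `gronwall_rpow` for coefficients with values in `[0,∞]`. -/
lemma lintegral_gronwall_rpow {p T : ℝ} (hp : 1 ≤ p) {α φ : ℝ → ℝ≥0∞} (hα : Measurable α)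
    (hφ : Measurable φ) {B : ℝ≥0} (hB : ∫⁻ τ in Ioo 0 T, α τ ≤ B)
    (hφt : ∫⁻ τ in Ioo 0 T, φ τ ≠ ⊤) {y : ℝ → ℝ} (hy : Continuous y) (hy0 : ∀ τ, 0 ≤ y τ)
    (h : ∀ s t, 0 < s → s ≤ t → t < T → ENNReal.ofReal (y s) ≤ ENNReal.ofReal (y t)
      + ∫⁻ τ in Ioc s t, (α τ * ENNReal.ofReal (y τ)
        + ENNReal.ofReal p * φ τ * ENNReal.ofReal (y τ) ^ (1 - 1 / p)))
    {s : ℝ} (hs : s ∈ Ioo 0 T) :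
    ENNReal.ofReal (y s) ^ (1 / p) ≤ ENNReal.ofReal (2 * Real.exp (2 * B / p) * p)
      * (ENNReal.ofReal (y T) ^ (1 / p) + ∫⁻ τ in Ioo 0 T, φ τ) := by
  have hp0 : 0 < p := by linarith
  have hq : 0 ≤ 1 - 1 / p := by rw [sub_nonneg, div_le_one hp0]; exact hp
  have hp1 : 0 ≤ 1 / p := by positivity
  have hαt : ∫⁻ τ in Ioo 0 T, α τ ≠ ⊤ := ne_top_of_le_ne_top ENNReal.coe_ne_top hB
  set a : ℝ → ℝ := fun τ => (α τ).toReal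
  set F : ℝ → ℝ := fun τ => (φ τ).toReal
  have ia : IntegrableOn a (Ioo 0 T) := integrable_toReal_of_lintegral_ne_top hα.aemeasurable hαt
  have iF : IntegrableOn F (Ioo 0 T) := integrable_toReal_of_lintegral_ne_top hφ.aemeasurable hφt
  have fa : ∀ᵐ τ ∂(volume.restrict (Ioo 0 T)), α τ < ⊤ := ae_lt_top hα hαt
  have fF : ∀ᵐ τ ∂(volume.restrict (Ioo 0 T)), φ τ < ⊤ := ae_lt_top hφ hφt
  -- The integral inequality is available only for `t < T`; continuity of `y` gives the terminal
  -- time in the limit.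
  have main : ∀ t ∈ Ico s T, ENNReal.ofReal (y s) ^ (1 / p)
      ≤ ENNReal.ofReal (2 * Real.exp (2 * B / p) * p)
        * (ENNReal.ofReal (y t) ^ (1 / p) + ∫⁻ τ in Ioo 0 T, φ τ) := by
    intro t ht
    have hsubs : ∀ r, s ≤ r → Ioc r t ⊆ Ioo 0 T := fun r hr τ hτ =>
      ⟨hs.1.trans_le (hr.trans hτ.1.le), hτ.2.trans_lt ht.2⟩
    have ja : ∀ r ∈ Icc s t, IntervalIntegrable a volume r t := fun r hr =>
      (intervalIntegrable_iff_integrableOn_Ioc_of_le hr.2).2 (ia.mono_set (hsubs r hr.1))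
    have jF : ∀ r ∈ Icc s t, IntervalIntegrable F volume r t := fun r hr =>
      (intervalIntegrable_iff_integrableOn_Ioc_of_le hr.2).2 (iF.mono_set (hsubs r hr.1))
    have hg := gronwall_rpow hp ht.1 (a := a) (F := F) (fun _ => ENNReal.toReal_nonneg)
      (fun _ => ENNReal.toReal_nonneg) (ja s (left_mem_Icc.2 ht.1)) (jF s (left_mem_Icc.2 ht.1)) hy hy0
      (fun r hr => by
        have i0 : IntervalIntegrable (fun τ => a τ * y τ + p * F τ * y τ ^ (1 - 1 / p)) volume r t :=
          ((ja r hr).mul_continuousOn hy.continuousOn).add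
            (((jF r hr).const_mul p).mul_continuousOn
              (hy.rpow_const fun _ => Or.inr hq).continuousOn)
        have n0 : ∀ τ, 0 ≤ a τ * y τ + p * F τ * y τ ^ (1 - 1 / p) := fun τ =>
          add_nonneg (mul_nonneg ENNReal.toReal_nonneg (hy0 τ))
            (mul_nonneg (mul_nonneg hp0.le ENNReal.toReal_nonneg) (Real.rpow_nonneg (hy0 τ) _))
        have h1 := h r t (hs.1.trans_le hr.1) hr.2 ht.2
        have h2 : ∫⁻ τ in Ioc r t, (α τ * ENNReal.ofReal (y τ)
            + ENNReal.ofReal p * φ τ * ENNReal.ofReal (y τ) ^ (1 - 1 / p))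
            = ENNReal.ofReal (∫ τ in r..t, (a τ * y τ + p * F τ * y τ ^ (1 - 1 / p))) := by
          rw [intervalIntegral.integral_of_le hr.2, ofReal_integral_eq_lintegral_ofReal
            ((intervalIntegrable_iff_integrableOn_Ioc_of_le hr.2).1 i0) (Eventually.of_forall n0)]
          refine lintegral_congr_ae ?_
          filter_upwards [ae_restrict_of_ae_restrict_of_subset (hsubs r hr.1) fa,
            ae_restrict_of_ae_restrict_of_subset (hsubs r hr.1) fF] with τ h3 h4
          rw [ENNReal.ofReal_add (mul_nonneg ENNReal.toReal_nonneg (hy0 τ))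
              (mul_nonneg (mul_nonneg hp0.le ENNReal.toReal_nonneg) (Real.rpow_nonneg (hy0 τ) _)),
            ENNReal.ofReal_mul ENNReal.toReal_nonneg,
            ENNReal.ofReal_mul (mul_nonneg hp0.le ENNReal.toReal_nonneg), ENNReal.ofReal_mul hp0.le,
            ENNReal.ofReal_toReal h3.ne, ENNReal.ofReal_toReal h4.ne,
            ENNReal.ofReal_rpow_of_nonneg (hy0 τ) hq]
        have h5 : 0 ≤ ∫ τ in r..t, (a τ * y τ + p * F τ * y τ ^ (1 - 1 / p)) :=
          intervalIntegral.integral_nonneg hr.2 fun τ _ => n0 τ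
        rw [h2, ← ENNReal.ofReal_add (hy0 t) h5] at h1
        exact (ENNReal.ofReal_le_ofReal_iff (add_nonneg (hy0 t) h5)).1 h1)
    have ha1 : ∫ τ in s..t, a τ ≤ B := by
      rw [intervalIntegral.integral_of_le ht.1]
      refine (setIntegral_mono_set ia (Eventually.of_forall fun _ => ENNReal.toReal_nonneg)
        (hsubs s le_rfl).eventuallyLE).trans ?_
      rw [integral_toReal hα.aemeasurable fa]
      exact ENNReal.toReal_le_coe_of_le_coe hB
    have hF1 : ENNReal.ofReal (∫ τ in s..t, F τ) ≤ ∫⁻ τ in Ioo 0 T, φ τ := by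
      rw [intervalIntegral.integral_of_le ht.1]
      refine (ENNReal.ofReal_le_ofReal (setIntegral_mono_set iF
        (Eventually.of_forall fun _ => ENNReal.toReal_nonneg) (hsubs s le_rfl).eventuallyLE)).trans ?_
      rw [integral_toReal hφ.aemeasurable fF]
      exact ENNReal.ofReal_toReal_le
    have hF0 : 0 ≤ ∫ τ in s..t, F τ :=
      intervalIntegral.integral_nonneg ht.1 fun _ _ => ENNReal.toReal_nonneg
    have hyt := Real.rpow_nonneg (hy0 t) (1 / p)
    calc ENNReal.ofReal (y s) ^ (1 / p) = ENNReal.ofReal (y s ^ (1 / p)) :=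
          ENNReal.ofReal_rpow_of_nonneg (hy0 s) hp1
      _ ≤ ENNReal.ofReal (2 * Real.exp (2 * B / p) * p * (y t ^ (1 / p) + ∫ τ in s..t, F τ)) := by
          refine ENNReal.ofReal_le_ofReal (hg.trans ?_)
          calc _ ≤ 2 * Real.exp (2 * B / p) * (p * y t ^ (1 / p) + p * ∫ τ in s..t, F τ) := by
                gcongr
                exact le_mul_of_one_le_left hyt hp
            _ = _ := by ring
      _ ≤ _ := by
          rw [ENNReal.ofReal_mul (by positivity), ENNReal.ofReal_add hyt hF0,
            ← ENNReal.ofReal_rpow_of_nonneg (hy0 t) hp1]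
          gcongr
  have hc : Continuous fun t => ENNReal.ofReal (2 * Real.exp (2 * B / p) * p)
        * (ENNReal.ofReal (y t) ^ (1 / p) + ∫⁻ τ in Ioo 0 T, φ τ) := by
    refine ENNReal.continuous_const_mul ENNReal.ofReal_ne_top |>.comp ?_
    exact ((ENNReal.continuous_rpow_const).comp (ENNReal.continuous_ofReal.comp hy)).add
      continuous_const
  have hmem : ∀ᶠ t in 𝓝[<] T, t ∈ Ico s T := Ico_mem_nhdsLT hs.2
  exact ge_of_tendsto (hc.continuousAt.mono_left nhdsWithin_le_nhds)
    (hmem.mono fun t ht => main t ht)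

/-! ### Integrability of the growth rate -/

lemma measurable_driftIntegrand (Q : ℝ≥0∞) {b : ℝ × (Torus n × ℝ) → ℝ} (hb : Measurable b) :
    Measurable fun q : ℝ × ℝ =>
      1 + eLpNorm (fun x => b (q.1, (x, q.2))) Q volume ^ (2 / interpExponent n Q) := by
  have h := measurable_eLpNorm_slice (X := ℝ × ℝ) (μ := (volume : Measure (Torus n)))
    (f := fun r : (ℝ × ℝ) × Torus n => b (r.1.1, (r.2, r.1.2))) (hb.comp (by fun_prop)) Q
  exact (h.pow_const _).const_add 1

/-- The hypothesis rearranges to `1/R ≤ s/2` with `s = 1 - n/Q`. For `Q = ∞` the convention `x / 0 =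
0` after `toReal` gives the intended `n/Q = 0`. -/
lemma ofReal_two_div_interpExponent_le {Q R : ℝ≥0∞} (hR : 2 ≤ R) (hQ : (n : ℝ≥0∞) < Q)
    (hQR : (n : ℝ≥0∞) / (2 * Q) + 1 / R ≤ 1 / 2) :
    ENNReal.ofReal (2 / interpExponent n Q) ≤ R := by
  rcases eq_or_ne R ⊤ with rfl | hRt
  · exact le_top
  have hQ0 : Q ≠ 0 := by rintro rfl; simp at hQ
  have hR0 : R ≠ 0 := by rintro rfl; simp at hR
  have hs := interpExponent_pos hQ
  have t1 : (n : ℝ≥0∞) / (2 * Q) ≠ ⊤ := ENNReal.div_ne_top (by simp) (by simp [hQ0])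
  have t2 : 1 / R ≠ ⊤ := ENNReal.div_ne_top (by simp) hR0
  have h := ENNReal.toReal_mono (by simp) hQR
  rw [ENNReal.toReal_add t1 t2, ENNReal.toReal_div, ENNReal.toReal_div, ENNReal.toReal_div,
    ENNReal.toReal_mul] at h
  simp only [ENNReal.toReal_natCast, ENNReal.toReal_ofNat, ENNReal.toReal_one] at h
  have hr : 0 < R.toReal := ENNReal.toReal_pos hR0 hRt
  rw [ENNReal.ofReal_le_iff_le_toReal hRt, div_le_iff₀ hs]
  have e : (n : ℝ) / (2 * Q.toReal) = (1 - interpExponent n Q) / 2 := by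
    unfold interpExponent; rw [← div_div, div_right_comm]; ring
  rw [e] at h
  have h2 : 1 / R.toReal ≤ interpExponent n Q / 2 := by linarith
  rw [div_le_iff₀ hr] at h2
  linarith

/-- On the finite interval, `L^R` embeds in `L^e` with `e = 2/s ≤ R`; this is used for each `θ`, and
the `θ` and time integrals are exchanged. -/
lemma exists_lintegral_driftRate_le {Q R : ℝ≥0∞} (hR : 2 ≤ R) (hQ : (n : ℝ≥0∞) < Q)
    (hQR : (n : ℝ≥0∞) / (2 * Q) + 1 / R ≤ 1 / 2) (T : ℝ) (M : ℝ≥0) :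
    ∃ B : ℝ≥0, ∀ b : ℝ × (Torus n × ℝ) → ℝ, Measurable b →
      (∀ θ ∈ Icc (0 : ℝ) 1, mixedNorm T R Q (fun z => b (θ, z)) ≤ M) →
      ∫⁻ τ in Ioo 0 T, driftRate Q (fun q : ℝ × Torus n => b (q.1, (q.2, τ))) ≤ B := by
  have hs := interpExponent_pos hQ
  set e : ℝ := 2 / interpExponent n Q with he
  have he0 : 0 < e := by positivity
  have hle := ofReal_two_div_interpExponent_le hR hQ hQR
  rw [← he] at hle
  set μ : Measure ℝ := volume.restrict (Ioo 0 T)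
  have hc : 0 ≤ 1 / (ENNReal.ofReal e).toReal - 1 / R.toReal := by
    rcases eq_or_ne R ⊤ with rfl | hRt
    · simp
    have := ENNReal.toReal_mono hRt hle
    rw [sub_nonneg]
    exact one_div_le_one_div_of_le (by rw [ENNReal.toReal_ofReal he0.le]; exact he0) this
  set D : ℝ≥0∞ := μ univ + (M * μ univ ^ (1 / (ENNReal.ofReal e).toReal - 1 / R.toReal)) ^ e with hD
  have hDt : D ≠ ⊤ := ENNReal.add_ne_top.2 ⟨measure_ne_top _ _, ENNReal.rpow_ne_top_of_nonneg he0.le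
    (ENNReal.mul_ne_top ENNReal.coe_ne_top (ENNReal.rpow_ne_top_of_nonneg hc (measure_ne_top _ _)))⟩
  refine ⟨D.toNNReal, fun b hb hM => ?_⟩
  rw [ENNReal.coe_toNNReal hDt]
  have hm := measurable_driftIntegrand Q hb
  have hN : ∀ θ, Measurable fun τ => eLpNorm (fun x => b (θ, (x, τ))) Q volume := fun θ =>
    measurable_eLpNorm_slice (f := fun r : ℝ × Torus n => b (θ, (r.2, r.1))) (hb.comp (by fun_prop)) Q
  have hθ : ∀ θ ∈ Icc (0 : ℝ) 1,
      ∫⁻ τ, (1 + eLpNorm (fun x => b (θ, (x, τ))) Q volume ^ e) ∂μ ≤ D := by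
    intro θ hθ
    rw [lintegral_add_left measurable_const, lintegral_const, one_mul]
    refine add_le_add le_rfl ?_
    have h1 := eLpNorm_le_eLpNorm_mul_rpow_measure_univ (μ := μ) hle (hN θ).aestronglyMeasurable
    have h2 := h1.trans (mul_le_mul_left (hM θ hθ) _)
    rw [eLpNorm_eq_lintegral_rpow_enorm_toReal (by simpa using he0) ENNReal.ofReal_ne_top] at h2
    have h3 := ENNReal.rpow_le_rpow h2 he0.le
    rw [← ENNReal.rpow_mul, ENNReal.toReal_ofReal he0.le, one_div_mul_cancel he0.ne',
      ENNReal.rpow_one] at h3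
    rw [ENNReal.toReal_ofReal he0.le]
    exact h3
  unfold driftRate
  calc _ = ∫⁻ θ in Icc (0 : ℝ) 1, ∫⁻ τ, (1 + eLpNorm (fun x => b (θ, (x, τ))) Q volume ^ e) ∂μ :=
        lintegral_lintegral_swap (hm.comp measurable_swap).aemeasurable
    _ ≤ ∫⁻ _ in Icc (0 : ℝ) 1, D := setLIntegral_mono' measurableSet_Icc hθ
    _ = D := by simp

/-! ### The regularised norm as the regularisation vanishes -/

lemma ofReal_integral_regPow (p : ℝ) {σ : ℝ} (hσ : 0 < σ) {v : Torus n → ℝ} (hv : Continuous v) :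
    ENNReal.ofReal (∫ x, regPow p σ (v x)) = ∫⁻ x, ENNReal.ofReal (regPow p σ (v x)) :=
  ofReal_integral_eq_lintegral_ofReal
    (Continuous.integrable_torus ((continuous_regPow hσ).comp hv))
    (Eventually.of_forall fun _ => (regPow_pos hσ _).le)

lemma eLpNorm_le_regPow {P : ℝ≥0∞} (hP : 1 < P) (hP' : P < ⊤) {σ : ℝ} (hσ : 0 < σ)
    {v : Torus n → ℝ} (hv : Continuous v) :
    eLpNorm v P volume ≤ ENNReal.ofReal (∫ x, regPow P.toReal σ (v x)) ^ (1 / P.toReal) := by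
  have hP0 : P ≠ 0 := by rintro rfl; simp at hP
  have hp0 : 0 < P.toReal := ENNReal.toReal_pos hP0 hP'.ne
  rw [eLpNorm_eq_lintegral_rpow_enorm_toReal hP0 hP'.ne, ofReal_integral_regPow _ hσ hv]
  refine ENNReal.rpow_le_rpow (lintegral_mono fun x => ?_) (by positivity)
  rw [Real.enorm_eq_ofReal_abs, ENNReal.ofReal_rpow_of_nonneg (abs_nonneg _) hp0.le]
  refine ENNReal.ofReal_le_ofReal ?_
  have e : |v x| ^ P.toReal = (v x ^ 2) ^ (P.toReal / 2) := by
    rw [← sq_abs, ← Real.rpow_natCast, ← Real.rpow_mul (abs_nonneg _)]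
    congr 1; push_cast; ring
  rw [e, regPow]
  exact Real.rpow_le_rpow (sq_nonneg _) (by nlinarith) (by positivity)

/-- Pointwise `r² + σ² ≤ (|r| + σ)²`; then Minkowski, where the constant `σ` has norm `σ` because
the torus has measure one. -/
lemma regPow_le_eLpNorm {P : ℝ≥0∞} (hP : 1 < P) (hP' : P < ⊤) {σ : ℝ} (hσ : 0 < σ)
    {v : Torus n → ℝ} (hv : Continuous v) :
    ENNReal.ofReal (∫ x, regPow P.toReal σ (v x)) ^ (1 / P.toReal)
      ≤ eLpNorm v P volume + ENNReal.ofReal σ := by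
  have hP0 : P ≠ 0 := by rintro rfl; simp at hP
  have hp0 : 0 < P.toReal := ENNReal.toReal_pos hP0 hP'.ne
  have h : eLpNorm (fun x => |v x| + σ) P volume ≤ eLpNorm v P volume + ENNReal.ofReal σ := by
    refine (eLpNorm_add_le (f := fun x => |v x|) (g := fun _ => σ) hv.abs.aestronglyMeasurable
      aestronglyMeasurable_const hP.le).trans (add_le_add (le_of_eq ?_) (le_of_eq ?_))
    · exact eLpNorm_norm v
    · rw [eLpNorm_const σ hP0 (NeZero.ne _)]
      simp [Real.enorm_eq_ofReal hσ.le]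
  refine le_trans ?_ h
  rw [eLpNorm_eq_lintegral_rpow_enorm_toReal hP0 hP'.ne, ofReal_integral_regPow _ hσ hv]
  refine ENNReal.rpow_le_rpow (lintegral_mono fun x => ?_) (by positivity)
  have h0 : 0 ≤ |v x| + σ := by positivity
  rw [Real.enorm_eq_ofReal h0, ENNReal.ofReal_rpow_of_nonneg h0 hp0.le]
  refine ENNReal.ofReal_le_ofReal ?_
  have e : (|v x| + σ) ^ P.toReal = ((|v x| + σ) ^ 2) ^ (P.toReal / 2) := by
    rw [← Real.rpow_natCast, ← Real.rpow_mul h0]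
    congr 1; push_cast; ring
  rw [e, regPow]
  refine Real.rpow_le_rpow (reg_pos hσ _).le ?_ (by positivity)
  have := mul_nonneg (abs_nonneg (v x)) hσ.le
  nlinarith [sq_abs (v x)]

/-! ### Integrability of the sources -/

/-- On a probability space the `L¹` norm of a slice is at most its `L^P` norm; Tonelli gives
integrability on the cylinder. -/
lemma MemMixed.integrable {T : ℝ} {P : ℝ≥0∞} (hP : 1 ≤ P) {f : Torus n × ℝ → ℝ}
    (hf : MemMixed T 1 P f) : Integrable f (cylMeasure n T) := by
  refine ⟨hf.1, ?_⟩
  have hmk := ae_ae_cylMeasure hf.1.ae_eq_mk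
  have h2 := hf.2
  rw [mixedNorm, eLpNorm_one_eq_lintegral_enorm] at h2
  simp only [enorm_eq_self] at h2
  refine lt_of_le_of_lt ?_ h2
  rw [cylMeasure, lintegral_prod_symm _ (by exact hf.1.enorm)]
  refine lintegral_mono_ae ?_
  filter_upwards [hmk] with t ht
  have hm : AEStronglyMeasurable (fun x => f (x, t)) volume :=
    ⟨_, hf.1.stronglyMeasurable_mk.comp_measurable measurable_prodMk_right, ht⟩
  rw [← eLpNorm_one_eq_lintegral_enorm]
  exact eLpNorm_le_eLpNorm_of_exponent_le hP hm

/-! ### The equation for the difference of two solutions -/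

lemma IsWeakGrad.sub {v₁ v₂ : Torus n → ℝ} {V₁ V₂ : Torus n → Vec n} (hv₁ : Continuous v₁)
    (hv₂ : Continuous v₂) (hV₁ : Integrable V₁ volume) (hV₂ : Integrable V₂ volume)
    (h₁ : IsWeakGrad v₁ V₁) (h₂ : IsWeakGrad v₂ V₂) :
    IsWeakGrad (fun x => v₁ x - v₂ x) (fun x => V₁ x - V₂ x) := by
  intro ψ hψ i
  obtain ⟨C, -, hC⟩ := continuous_exists_bound hψ.continuous
  have hc := (hψ.torusGrad i).continuous
  have hi : ∀ {V : Torus n → Vec n}, Integrable V volume →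
      Integrable (fun x => V x i * ψ x) volume := fun hV =>
    (((EuclideanSpace.proj (𝕜 := ℝ) i).integrable_comp hV).mul_bdd
      hψ.continuous.aestronglyMeasurable (Eventually.of_forall hC) :)
  have i₁ : Integrable (fun x => v₁ x * torusGrad ψ x i) volume :=
    Continuous.integrable_torus (hv₁.mul hc)
  have i₂ : Integrable (fun x => v₂ x * torusGrad ψ x i) volume :=
    Continuous.integrable_torus (hv₂.mul hc)
  simp only [sub_mul, PiLp.sub_apply]
  rw [integral_sub i₁ i₂, integral_sub (hi hV₁) (hi hV₂), h₁ ψ hψ i, h₂ ψ hψ i]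
  ring

lemma IsWeakGrad.congr {v v' : Torus n → ℝ} {V V' : Torus n → Vec n} (h : IsWeakGrad v V)
    (hv : v' = v) (hV : V' =ᵐ[volume] V) : IsWeakGrad v' V' := by
  intro ψ hψ i
  rw [hv, h ψ hψ i, integral_congr_ae]
  filter_upwards [hV] with x hx
  rw [hx]

namespace IsEnergySolution

variable {T ε : ℝ} {H : Torus n × ℝ → Vec n → ℝ} {f : Torus n × ℝ → ℝ} {g : Torus n → ℝ}
  {u : Torus n × ℝ → ℝ} {Du : Torus n × ℝ → Vec n}

lemma continuous_slice (h : IsEnergySolution T ε H f g u Du) {t : ℝ} (ht : t ∈ Icc 0 T) :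
    Continuous fun x => u (x, t) :=
  h.continuousOn.comp_continuous (f := fun x : Torus n => (x, t)) (by fun_prop)
    fun x => ⟨mem_univ _, ht⟩

lemma ae_integrable_grad (h : IsEnergySolution T ε H f g u Du) :
    ∀ᵐ t ∂((volume : Measure ℝ).restrict (Ioo 0 T)), Integrable (fun x => Du (x, t)) volume :=
  Integrable.prod_left_ae (μ := (volume : Measure (Torus n)))
    (h.energy.memLp_grad.integrable (by norm_num))

/-- The weak formulation with a test function that splits the variables. -/
lemma equation_mul (h : IsEnergySolution T ε H f g u Du) (hf : Integrable f (cylMeasure n T))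
    {ψ : Torus n → ℝ} {η : ℝ → ℝ} (hψ : TorusSmooth ψ) (hη : ContDiff ℝ ∞ η)
    (hs : ∃ a b, 0 < a ∧ b < T ∧ ∀ t ∉ Icc a b, η t = 0) :
    Integrable (fun z : Torus n × ℝ => u z * ψ z.1 * deriv η z.2
      + (ε * inner ℝ (Du z) (torusGrad ψ z.1) + (H z (Du z) - f z) * ψ z.1) * η z.2) (cylMeasure n T)
    ∧ ∫ z, (u z * ψ z.1 * deriv η z.2
      + (ε * inner ℝ (Du z) (torusGrad ψ z.1) + (H z (Du z) - f z) * ψ z.1) * η z.2)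
        ∂(cylMeasure n T) = 0 := by
  have e := h.equation _ (isTestFunction_mul hψ hη hs)
  obtain ⟨a, b, -, -, hz⟩ := hs
  obtain ⟨D, -, hD⟩ := continuous_exists_bound hψ.continuous
  obtain ⟨E, hE⟩ := isCompact_univ.exists_bound_of_continuousOn
    hψ.continuous_torusGrad.continuousOn
  have hηc : HasCompactSupport η := HasCompactSupport.intro isCompact_Icc hz
  obtain ⟨M, hM⟩ := hηc.exists_bound_of_continuous hη.continuous
  obtain ⟨M', hM'⟩ := (hηc.deriv).exists_bound_of_continuous (hη.continuous_deriv (by simp))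
  have mη : AEStronglyMeasurable (fun z : Torus n × ℝ => η z.2) (cylMeasure n T) :=
    (hη.continuous.comp continuous_snd).aestronglyMeasurable
  have mψ : AEStronglyMeasurable (fun z : Torus n × ℝ => ψ z.1) (cylMeasure n T) :=
    (hψ.continuous.comp continuous_fst).aestronglyMeasurable
  have iDu := h.energy.memLp_grad.integrable (by norm_num : (1 : ℝ≥0∞) ≤ 2)
  have i1 : Integrable (fun z : Torus n × ℝ => u z * ψ z.1 * deriv η z.2) (cylMeasure n T) :=
    ((h.energy.memLp.integrable (by norm_num)).mul_bdd mψ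
      (Eventually.of_forall fun z => hD z.1)).mul_bdd
      ((hη.continuous_deriv (by simp)).comp continuous_snd).aestronglyMeasurable
      (Eventually.of_forall fun z => hM' z.2)
  have i2 : Integrable (fun z : Torus n × ℝ => ε * inner ℝ (Du z) (torusGrad ψ z.1) * η z.2)
      (cylMeasure n T) := by
    refine (Integrable.const_mul ?_ ε).mul_bdd mη (Eventually.of_forall fun z => hM z.2)
    refine (iDu.norm.mul_const E).mono' (iDu.aestronglyMeasurable.inner
      (hψ.continuous_torusGrad.comp continuous_fst).aestronglyMeasurable)
      (Eventually.of_forall fun z => ?_)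
    exact (norm_inner_le_norm _ _).trans (by gcongr; exact hE z.1 (mem_univ _))
  have i3 : Integrable (fun z : Torus n × ℝ => H z (Du z) * (ψ z.1 * η z.2)) (cylMeasure n T) := by
    simp_rw [← mul_assoc]
    exact (h.integrable_hamiltonian.mul_bdd mψ (Eventually.of_forall fun z => hD z.1)).mul_bdd mη
      (Eventually.of_forall fun z => hM z.2)
  have i4 : Integrable (fun z : Torus n × ℝ => f z * (ψ z.1 * η z.2)) (cylMeasure n T) := by
    simp_rw [← mul_assoc]
    exact (hf.mul_bdd mψ (Eventually.of_forall fun z => hD z.1)).mul_bdd mη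
      (Eventually.of_forall fun z => hM z.2)
  have i123 : Integrable (fun z : Torus n × ℝ => u z * ψ z.1 * deriv η z.2
      + ε * inner ℝ (Du z) (torusGrad ψ z.1) * η z.2 + H z (Du z) * (ψ z.1 * η z.2))
      (cylMeasure n T) := (i1.add i2).add i3
  have hsplit : (fun z : Torus n × ℝ => u z * ψ z.1 * deriv η z.2
      + (ε * inner ℝ (Du z) (torusGrad ψ z.1) + (H z (Du z) - f z) * ψ z.1) * η z.2)
      = fun z => (u z * ψ z.1 * deriv η z.2 + ε * inner ℝ (Du z) (torusGrad ψ z.1) * η z.2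
        + H z (Du z) * (ψ z.1 * η z.2)) - f z * (ψ z.1 * η z.2) := by
    ext z; ring
  rw [hsplit]
  refine ⟨i123.sub i4, ?_⟩
  rw [integral_sub i123 i4, ← e, sub_eq_zero]
  refine integral_congr_ae (Eventually.of_forall fun z => ?_)
  simp only [timeDeriv_mul ψ hη, spaceGrad_mul hψ, inner_smul_right]
  ring

end IsEnergySolution

/-- The difference of two energy solutions solves a linear equation. -/
lemma exists_isLinearSolution {T ε : ℝ} (hT : 0 < T) {H : Torus n × ℝ → Vec n → ℝ}
    {f₁ f₂ : Torus n × ℝ → ℝ} {g₁ g₂ : Torus n → ℝ} {u₁ u₂ : Torus n × ℝ → ℝ}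
    {Du₁ Du₂ D₁ D₂ : Torus n × ℝ → Vec n} (h₁ : IsEnergySolution T ε H f₁ g₁ u₁ Du₁)
    (h₂ : IsEnergySolution T ε H f₂ g₂ u₂ Du₂) (hf₁ : Integrable f₁ (cylMeasure n T))
    (hf₂ : Integrable f₂ (cylMeasure n T)) (hD₁ : StronglyMeasurable D₁) (hD₂ : StronglyMeasurable D₂)
    (e₁ : Du₁ =ᵐ[cylMeasure n T] D₁) (e₂ : Du₂ =ᵐ[cylMeasure n T] D₂) :
    ∃ w G, IsLinearSolution T ε w (fun z => D₁ z - D₂ z) G ∧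
      (∀ x, ∀ t ∈ Icc 0 T, w (x, t) = u₁ (x, t) - u₂ (x, t)) ∧
      ∀ᵐ z ∂(cylMeasure n T), G z = (H z (Du₁ z) - f₁ z) - (H z (Du₂ z) - f₂ z) := by
  have hG : Integrable (fun z => (H z (Du₁ z) - f₁ z) - (H z (Du₂ z) - f₂ z)) (cylMeasure n T) :=
    (h₁.integrable_hamiltonian.sub hf₁).sub (h₂.integrable_hamiltonian.sub hf₂)
  have hGe := hG.1.ae_eq_mk
  -- Freezing time outside `[0,T]` makes the difference continuous and bounded everywhere while
  -- retaining its value at `T`.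
  let w : Torus n × ℝ → ℝ := fun z =>
    u₁ (z.1, projIcc 0 T hT.le z.2) - u₂ (z.1, projIcc 0 T hT.le z.2)
  have hw : ∀ x, ∀ t ∈ Icc 0 T, w (x, t) = u₁ (x, t) - u₂ (x, t) := by
    intro x t ht
    simp only [w, projIcc_of_mem hT.le ht]
  have hcp : Continuous fun z : Torus n × ℝ => (z.1, (projIcc 0 T hT.le z.2 : ℝ)) :=
    continuous_fst.prodMk (continuous_subtype_val.comp (continuous_projIcc.comp continuous_snd))
  have hmem : ∀ z : Torus n × ℝ,
      (z.1, (projIcc 0 T hT.le z.2 : ℝ)) ∈ (univ : Set (Torus n)) ×ˢ Icc 0 T :=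
    fun z => ⟨mem_univ _, (projIcc 0 T hT.le z.2).2⟩
  have aw : ∀ᵐ z ∂(cylMeasure n T), w z = u₁ z - u₂ z := by
    have : ∀ᵐ z ∂(cylMeasure n T), z.2 ∈ Ioo 0 T :=
      Measure.quasiMeasurePreserving_snd.ae (ae_restrict_mem measurableSet_Ioo)
    filter_upwards [this] with z hz using hw z.1 z.2 (Ioo_subset_Icc_self hz)
  refine ⟨w, hG.1.mk _, ⟨?_, ?_, hD₁.sub hD₂, ?_, ?_, hG.1.stronglyMeasurable_mk,
    hG.congr hGe, ?_⟩, hw, hGe.symm⟩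
  · exact (h₁.continuousOn.comp_continuous hcp hmem).sub (h₂.continuousOn.comp_continuous hcp hmem)
  · obtain ⟨C, hC⟩ := (isCompact_univ.prod isCompact_Icc).exists_bound_of_continuousOn
      (h₁.continuousOn.sub h₂.continuousOn)
    exact ⟨C, fun z => hC _ (hmem z)⟩
  · exact (h₁.energy.memLp_grad.ae_eq e₁).sub (h₂.energy.memLp_grad.ae_eq e₂)
  · filter_upwards [h₁.energy.weakGrad, h₂.energy.weakGrad, h₁.ae_integrable_grad,
      h₂.ae_integrable_grad, ae_ae_cylMeasure e₁, ae_ae_cylMeasure e₂,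
      ae_restrict_mem measurableSet_Ioo] with t a₁ a₂ i₁ i₂ b₁ b₂ ht
    have ht' := Ioo_subset_Icc_self ht
    refine (IsWeakGrad.sub (h₁.continuous_slice ht') (h₂.continuous_slice ht') i₁ i₂ a₁ a₂).congr
      (funext fun x => hw x t ht') ?_
    filter_upwards [b₁, b₂] with x c₁ c₂
    rw [c₁, c₂]
  · intro ψ η hψ hη hs
    obtain ⟨i₁, z₁⟩ := h₁.equation_mul hf₁ hψ hη hs
    obtain ⟨i₂, z₂⟩ := h₂.equation_mul hf₂ hψ hη hs
    have := integral_sub i₁ i₂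
    rw [z₁, z₂, sub_zero] at this
    rw [← this]
    refine integral_congr_ae ?_
    filter_upwards [e₁, e₂, hGe, aw] with z c₁ c₂ c₃ c₄
    rw [← c₃, c₄, ← c₁, ← c₂, inner_sub_left]
    ring

/-! ### The stability estimate -/

lemma continuous_integral_regPow {w : Torus n × ℝ → ℝ} (hw : Continuous w) (hb : ∃ C, ∀ z, ‖w z‖ ≤ C)
    {p σ : ℝ} (hσ : 0 < σ) : Continuous fun t => ∫ x, regPow p σ (w (x, t)) := by
  obtain ⟨C, hC⟩ := hb
  obtain ⟨D, hD⟩ := (isCompact_closedBall (0 : ℝ) C).exists_bound_of_continuousOn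
    (continuous_regPow (p := p) hσ).continuousOn
  refine continuous_of_dominated (bound := fun _ => D)
    (fun t => ((continuous_regPow hσ).comp (hw.comp (by fun_prop))).aestronglyMeasurable)
    (fun t => Eventually.of_forall fun x => hD _ (mem_closedBall_zero_iff.2 (hC _)))
    (integrable_const _) (Eventually.of_forall fun x => ?_)
  exact (continuous_regPow hσ).comp (hw.comp (by fun_prop))

lemma measurable_driftRate (Q : ℝ≥0∞) {b : ℝ × (Torus n × ℝ) → ℝ} (hb : Measurable b) :
    Measurable fun τ => driftRate Q (fun q : ℝ × Torus n => b (q.1, (q.2, τ))) := by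
  have h := (measurable_driftIntegrand Q hb).comp measurable_swap
  unfold driftRate
  exact h.lintegral_prod_right'

/-- The stability estimate for the linear equation. -/
lemma exists_linear_stability (hn : 2 ≤ n) {P Q R : ℝ≥0∞} (hP : 1 < P) (hP' : P < ⊤)
    (hR : 2 ≤ R) (hQ : (n : ℝ≥0∞) < Q) (hQR : (n : ℝ≥0∞) / (2 * Q) + 1 / R ≤ 1 / 2)
    {T ε : ℝ} (hε : 0 < ε) (M : ℝ≥0) :
    ∃ C : ℝ≥0, 0 < C ∧ ∀ (w : Torus n × ℝ → ℝ) (V : Torus n × ℝ → Vec n) (G f : Torus n × ℝ → ℝ)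
      (b : ℝ × (Torus n × ℝ) → ℝ), IsLinearSolution T ε w V G → Measurable b → Measurable f →
      (∀ᵐ z ∂(cylMeasure n T),
        ‖G z‖ₑ ≤ (∫⁻ θ in Icc (0 : ℝ) 1, ‖b (θ, z)‖ₑ * ‖V z‖ₑ) + ‖f z‖ₑ) →
      (∀ θ ∈ Icc (0 : ℝ) 1, mixedNorm T R Q (fun z => b (θ, z)) ≤ M) →
      ∫⁻ τ in Ioo 0 T, eLpNorm (fun x => f (x, τ)) P volume ≠ ⊤ →
      ∀ s ∈ Ioo 0 T, eLpNorm (fun x => w (x, s)) P volume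
        ≤ C * (eLpNorm (fun x => w (x, T)) P volume
          + ∫⁻ τ in Ioo 0 T, eLpNorm (fun x => f (x, τ)) P volume) := by
  obtain ⟨K, hK⟩ := exists_energy_inequality hn hP hP' hQ hε
  obtain ⟨B, hB⟩ := exists_lintegral_driftRate_le hR hQ hQR T M
  have hp1 : 1 < P.toReal := by
    rw [← ENNReal.toReal_one]; exact (ENNReal.toReal_lt_toReal (by simp) hP'.ne).2 hP
  -- This is the Gronwall constant with `K * B` bounding the total growth rate. Its positivity
  -- ensures `C · ∞ = ∞` when the source norm is infinite.
  obtain ⟨C, hC0, hCe⟩ : ∃ C : ℝ≥0, 0 < C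
      ∧ ENNReal.ofReal (2 * Real.exp (2 * (K * B : ℝ≥0) / P.toReal) * P.toReal) = C :=
    ⟨_, Real.toNNReal_pos.2 (by positivity), rfl⟩
  refine ⟨C, hC0, fun w V G f b h hb hf hG hM hft s hs => ?_⟩
  set S := ∫⁻ τ in Ioo 0 T, eLpNorm (fun x => f (x, τ)) P volume
  have hα : Measurable fun τ => K * driftRate Q (fun q : ℝ × Torus n => b (q.1, (q.2, τ))) :=
    (measurable_driftRate Q hb).const_mul _
  have hφ : Measurable fun τ => eLpNorm (fun x => f (x, τ)) P volume :=
    measurable_eLpNorm_slice (f := fun r : ℝ × Torus n => f (r.2, r.1)) (hf.comp measurable_swap) P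
  have hαB : ∫⁻ τ in Ioo 0 T, K * driftRate Q (fun q : ℝ × Torus n => b (q.1, (q.2, τ)))
      ≤ (K * B : ℝ≥0) := by
    rw [lintegral_const_mul' _ _ ENNReal.coe_ne_top, ENNReal.coe_mul]
    exact mul_le_mul_right (hB b hb hM) _
  have main : ∀ σ : ℝ, 0 < σ → eLpNorm (fun x => w (x, s)) P volume
      ≤ C * (eLpNorm (fun x => w (x, T)) P volume + ENNReal.ofReal σ + S) := by
    intro σ hσ
    have hy := continuous_integral_regPow h.continuous h.bounded (p := P.toReal) hσ
    have hg := lintegral_gronwall_rpow hp1.le hα hφ hαB hft hy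
      (fun τ => integral_nonneg fun x => (regPow_pos hσ _).le)
      (fun s t hs hst ht => hK T w V G f b h hb hf hG σ s t hσ hs hst ht) hs
    rw [hCe] at hg
    exact (eLpNorm_le_regPow hP hP' hσ (h.continuous_slice s)).trans (hg.trans
      (mul_le_mul_right (add_le_add (regPow_le_eLpNorm hP hP' hσ (h.continuous_slice T)) le_rfl) _))
  -- The constant does not depend on `σ`, so the regularisation can be removed.
  have hlim : Tendsto (fun σ : ℝ => (C : ℝ≥0∞)
      * (eLpNorm (fun x => w (x, T)) P volume + ENNReal.ofReal σ + S)) (𝓝[>] 0)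
      (𝓝 (C * (eLpNorm (fun x => w (x, T)) P volume + ENNReal.ofReal 0 + S))) := by
    have hc : Continuous fun σ : ℝ => (C : ℝ≥0∞)
        * (eLpNorm (fun x => w (x, T)) P volume + ENNReal.ofReal σ + S) :=
      (ENNReal.continuous_const_mul ENNReal.coe_ne_top).comp
        ((continuous_const.add ENNReal.continuous_ofReal).add continuous_const)
    exact (hc.tendsto 0).mono_left nhdsWithin_le_nhds
  rw [ENNReal.ofReal_zero, add_zero] at hlim
  exact ge_of_tendsto hlim (eventually_mem_nhdsWithin.mono fun σ hσ => main σ hσ)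

end ViscousHJ

end

/-! ### Transfer to the two nonlinear solutions -/

theorem mainTheorem10 (n : ℕ) (hn : 2 ≤ n) (T ε : ℝ) (hT : 0 < T) (hε : 0 < ε)
    (p Q R : ℝ≥0∞) (hp : 1 < p) (hp' : p < ⊤)
    (hR : 2 ≤ R) (hQ : (n : ℝ≥0∞) < Q)
    (hQR : (n : ℝ≥0∞) / (2 * Q) + 1 / R ≤ 1 / 2) (M : ℝ≥0) :
    ∃ C : ℝ≥0,
      ∀ (H : Torus n × ℝ → Vec n → ℝ) (f₁ f₂ : Torus n × ℝ → ℝ) (g₁ g₂ : Torus n → ℝ)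
        (u₁ u₂ : Torus n × ℝ → ℝ) (Du₁ Du₂ : Torus n × ℝ → Vec n),
        IsHamiltonian T H →
        MemMixed T 1 p f₁ → MemMixed T 1 p f₂ →
        MemLp g₁ p volume → MemLp g₂ p volume →
        IsEnergySolution T ε H f₁ g₁ u₁ Du₁ →
        IsEnergySolution T ε H f₂ g₂ u₂ Du₂ →
        (∀ θ ∈ Icc (0 : ℝ) 1,
          mixedNorm T R Q (fun z => gradient (H z) (θ • Du₁ z + (1 - θ) • Du₂ z)) ≤ M) →
        ∀ t ∈ Ioo (0 : ℝ) T,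
          eLpNorm (fun x => u₁ (x, t) - u₂ (x, t)) p volume
            ≤ C * (eLpNorm (fun x => g₁ x - g₂ x) p volume
                + ∫⁻ s in Ioo (0 : ℝ) T,
                    eLpNorm (fun x => f₁ (x, s) - f₂ (x, s)) p volume) := by
  obtain ⟨C, hC0, hC⟩ := exists_linear_stability hn hp hp' hR hQ hQR (T := T) hε M
  refine ⟨C, fun H f₁ f₂ g₁ g₂ u₁ u₂ Du₁ Du₂ hH hf₁ hf₂ _ _ h₁ h₂ hM t ht => ?_⟩
  set S := ∫⁻ s in Ioo (0 : ℝ) T, eLpNorm (fun x => f₁ (x, s) - f₂ (x, s)) p volume with hS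
  -- If the source integral is infinite, so is the right-hand side, as `C > 0`; otherwise its
  -- finiteness is what the linear estimate requires.
  by_cases hSt : S = ⊤
  · rw [hSt, add_top, ENNReal.mul_top (by exact_mod_cast hC0.ne')]
    exact le_top
  have if₁ := hf₁.integrable hp.le
  have if₂ := hf₂.integrable hp.le
  have m₁ := h₁.energy.memLp_grad.1
  have m₂ := h₂.energy.memLp_grad.1
  have mf : AEStronglyMeasurable (fun z => f₁ z - f₂ z) (cylMeasure n T) := if₁.1.sub if₂.1
  -- The linear theory is applied to measurable representatives of the gradients and of `f₁ - f₂`;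
  -- the remaining goals transfer the bounds back almost everywhere.
  obtain ⟨w, G, hw, hwu, hG⟩ := exists_isLinearSolution hT h₁ h₂ if₁ if₂ m₁.stronglyMeasurable_mk
    m₂.stronglyMeasurable_mk m₁.ae_eq_mk m₂.ae_eq_mk
  obtain ⟨b, hb, hbH, hbG⟩ := hH.exists_measurable_drift m₁.stronglyMeasurable_mk.measurable
    m₂.stronglyMeasurable_mk.measurable
  have hSf : ∫⁻ s in Ioo (0 : ℝ) T, eLpNorm (fun x => mf.mk _ (x, s)) p volume = S := by
    refine lintegral_congr_ae ?_
    filter_upwards [Filter.Eventually.mono (ae_ae_cylMeasure mf.ae_eq_mk) fun _ h => h] with s hs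
    exact (eLpNorm_congr_ae hs).symm
  have hest := hC w _ G (mf.mk _) b hw hb mf.stronglyMeasurable_mk.measurable ?_ ?_
    (by rw [hSf]; exact hSt) t ht
  · rw [hSf] at hest
    have et : (fun x => w (x, t)) = fun x => u₁ (x, t) - u₂ (x, t) :=
      funext fun x => hwu x t (Ioo_subset_Icc_self ht)
    have eT : eLpNorm (fun x => w (x, T)) p volume = eLpNorm (fun x => g₁ x - g₂ x) p volume := by
      refine eLpNorm_congr_ae ?_
      filter_upwards [h₁.terminal, h₂.terminal] with x a₁ a₂
      rw [hwu x T (right_mem_Icc.2 hT.le), a₁, a₂]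
    rwa [et, eT] at hest
  · filter_upwards [hG, hbG, m₁.ae_eq_mk, m₂.ae_eq_mk, mf.ae_eq_mk] with z a₁ a₂ a₃ a₄ a₅
    rw [← a₃, ← a₄] at a₂
    rw [← a₅, a₁, ← a₃, ← a₄, show H z (Du₁ z) - f₁ z - (H z (Du₂ z) - f₂ z)
      = (H z (Du₁ z) - H z (Du₂ z)) - (f₁ z - f₂ z) by ring]
    exact (enorm_sub_le).trans (add_le_add a₂ le_rfl)
  · intro θ hθ
    refine le_trans (le_of_eq ?_) (hM θ hθ)
    refine eLpNorm_congr_ae ?_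
    have hz : ∀ᵐ z ∂(cylMeasure n T),
        ‖b (θ, z)‖ = ‖gradient (H z) (θ • Du₁ z + (1 - θ) • Du₂ z)‖ := by
      filter_upwards [hbH, m₁.ae_eq_mk, m₂.ae_eq_mk] with z a₁ a₂ a₃
      rw [a₁ θ, ← a₂, ← a₃, norm_norm]
    filter_upwards [ae_ae_cylMeasure hz] with s hs
    exact eLpNorm_congr_norm_ae hs
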